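/- Let $\Bbbk$ be a field and let $Q=(Q_0,Q_1,s,t)$ be a finite connected quiver with at least one arrow. Paths are written from right to left: a path $c_m\cdots c_1$ has first arrow $c_1$ and last arrow $c_m$; $e_i$ is the trivial path at the vertex $i$, and for a path $\alpha$ we also write $s(\alpha)$ for the trivial path at its source. Let $(Q,I)$ be a gentle presentation, that is, $I$ is a two-sided ideal of the path algebra $\Bbbk Q$ such that (a) every vertex is the source of at most two arrows and the target of at most two arrows; (b) for every arrow $a$ there is at most one arrow $b$ with $ab\notin I$ and at most one arrow $c$ with $ca\notin I$; (c) for every arrow $a$ there is at most one arrow $b$ with $t(a)=s(b)$ and $ba\in I$, and at most one arrow $c$ with $t(c)=s(a)$ and $ac\in I$; (d) $I$ is generated by paths of length $2$. Put $A=\Bbbk Q/I$, and let $T$ be (the set of arrows of) a spanning tree of $Q$. Let $\mathcal B$ be the set of paths in $Q$ none of whose subpaths of length $2$ is in $I$, and $\Gamma$ the set of paths all of whose subpaths of length $2$ are in $I$; $\Gamma_m$ is the set of elements of $\Gamma$ of length $m$. Let $\Gamma_m\parallel\mathcal B$ be the set of pairs $(\gamma,\alpha)\in\Gamma_m\times\mathcal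 B$ of parallel paths (same source and same target), and $\Bbbk(\Gamma_m\parallel\mathcal B)$ the vector space with that basis. The spaces $\Bbbk(\Gamma_m\parallel\mathcal B)$, $m\ge0$, form a complex $\Bbbk(\Gamma\parallel\mathcal B)$ with differential $$d^m(\gamma,\alpha)=\sum_{b}(b\gamma,b\alpha)-(-1)^m\sum_{a}(\gamma a,\alpha a),$$ where the sums run over the arrows $b$, respectively $a$, for which the summand is in $\Gamma_{m+1}\parallel\mathcal B$. Its cohomology is identified with the Hochschild cohomology $\mathrm{HH}^*(A)$ as follows: the class of a Hochschild cocycle $f:A^{\otimes m}\to A$ corresponds to the class of the cocycle $z=\sum z_{\gamma,\alpha}\,(\gamma,\alpha)$ determined by $$e_{t(\gamma)}\,f(c_m\otimes\cdots\otimes c_1)\,e_{s(\gamma)}=\sum_\alpha z_{\gamma,\alpha}\,\alpha\quad\text{in }A\text{, for all }\gamma=c_m\cdots c_1\in\Gamma_m .$$ A path is $\mathcal B$-maximal (resp. $\Gamma$-maximal) if it is in $\mathcal B$ (resp. $\Gamma$) and is not a proper subpath of another element of $\mathcal B$ (resp. $\Gamma$). A cycle is a closed path $C=c_m\cdots c_1$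 of positive length; it is primitive if it is not a proper power of a cycle. Put $\mathrm{rot}(C)=c_{m-1}\cdots c_1c_m$; the period of $C$ is the least $r\ge1$ with $\mathrm{rot}^r(C)=C$. Two cycles are conjugate if one is obtained from the other by repeated rotation; the conjugacy classes are the circuits. A cycle $C$ is cocomplete if $C^2\in\mathcal B$ and complete if $C^2\in\Gamma$; these properties depend only on the circuit of $C$. Let $\overline{\mathcal C}(\mathcal B)$ be a set of representatives of the cocomplete circuits obtained by choosing one representative of each primitive cocomplete circuit and taking all positive powers of these. Let $\overline{\mathcal C}^\circ(\Gamma)$ be a set of representatives of the complete circuits such that if $C,D\in\overline{\mathcal C}^\circ(\Gamma)$ and $CD$ is a complete cycle, then $CD\in\overline{\mathcal C}^\circ(\Gamma)$; $\overline{\mathcal C}^\circ_m(\Gamma)$ is the set of its elements of length $m$. **Theorem.** The Hochschild cohomology $\mathrm{HH}^*(A)$ is the graded vector space freely generated by the cohomology classes of the following homogeneous cocycles of the complex $\Bbbk(\Gamma\parallel\mathcal B)$, the elements of $\Bbbk(\Gamma_m\parallel\mathcal B)$ having degree $m$: * $(\mathsf{H_I})$ the element $\sum_{i\in Q_0}(e_i,e_i)$;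 * $(\mathsf{H_{II}})$ the pairs $(s(\alpha),\alpha)\in\Gamma_0\parallel\mathcal B$ with $\alpha$ a $\mathcal B$-maximal (closed) path; * $(\mathsf{H_{III}})$ the sums $\sum_{i=0}^{r-1}(s(\mathrm{rot}^i(\alpha)),\mathrm{rot}^i(\alpha))$ with $\alpha\in\overline{\mathcal C}(\mathcal B)$ and $r$ the period of $\alpha$; * $(\mathsf{H_{IV}})$ the pairs $(c,c)$ with $c\in Q_1\setminus T$; * $(\mathsf{H_V})$ the pairs $(c,c\alpha)$ with $\alpha\in\overline{\mathcal C}(\mathcal B)$ and $c$ the first arrow of $\alpha$; * $(\mathsf{H_{VI}})$ the pairs $(\gamma,\alpha)\in\Gamma_m\parallel\mathcal B$, $m\ge0$, with $\gamma$ a $\Gamma$-maximal path and such that $\gamma$ and $\alpha$ neither begin nor end with the same arrow; * $(\mathsf{H_{VII}})$ the sums $\sum_{i=0}^{r-1}(\mathrm{rot}^i(C),s(\mathrm{rot}^i(C)))$ with $C\in\overline{\mathcal C}^\circ_m(\Gamma)$ of period $r$, for every $m\ge1$ such that $m$ is even or the characteristic of $\Bbbk$ is $2$; * $(\mathsf{H_{VIII}})$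 the pairs $(bC,b)$ with $C\in\overline{\mathcal C}^\circ_{m-1}(\Gamma)$ and $b$ the first arrow of $C$, for every $m\ge2$ such that $m$ is odd or the characteristic of $\Bbbk$ is $2$. -/

import Mathlib

namespace GentleHH

universe u v w

/-! ### Quivers and paths

Paths are written from right to left, as compositions of functions: the path `c_m ⋯ c_1` has the
list of arrows `[c_m, …, c_1]`, its first arrow is `c_1` and its last arrow is `c_m`. -/

/-- A quiver `(Q_0, Q_1, s, t)` with vertices `V` and arrows `E`. -/
structure ArrowQuiver (V : Type v) (E : Type w) where
  s : E → V
  t : E → V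

variable {V : Type v} {E : Type w}

/-- `Q.IsWalk l x y`: the list of arrows `l = [c_m, …, c_1]` is a path `c_m ⋯ c_1` from `x` to
`y` (for `m = 0`, this says `x = y`). -/
def ArrowQuiver.IsWalk (Q : ArrowQuiver V E) : List E → V → V → Prop
  | [], x, y => x = y
  | c :: l, x, y => Q.t c = y ∧ Q.IsWalk l x (Q.s c)

theorem ArrowQuiver.IsWalk.append {Q : ArrowQuiver V E} {l₁ l₂ : List E} {x y z : V}
    (h₁ : Q.IsWalk l₁ y z) (h₂ : Q.IsWalk l₂ x y) : Q.IsWalk (l₁ ++ l₂) x z := by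
  induction l₁ generalizing z with
  | nil => cases h₁; exact h₂
  | cons c l ih => exact ⟨h₁.1, ih h₁.2⟩

theorem ArrowQuiver.IsWalk.source_getLast {Q : ArrowQuiver V E} {l : List E} {x y : V}
    (h : Q.IsWalk l x y) (hl : l ≠ []) : Q.s (l.getLast hl) = x := by
  induction l generalizing y with
  | nil => exact absurd rfl hl
  | cons c l ih =>
    cases l with
    | nil => exact h.2.symm
    | cons d l => simpa using ih h.2 (by simp)

/-- A path in `Q`, with its source, its target and its list of arrows. -/
@[ext]
structure Path (Q : ArrowQuiver V E) where
  src : V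
  tgt : V
  arrows : List E
  isWalk : Q.IsWalk arrows src tgt

namespace Path

variable {Q : ArrowQuiver V E}

def length (p : Path Q) : ℕ := p.arrows.length

/-- The trivial path `e_x` at the vertex `x`. -/
def trivial (x : V) : Path Q := ⟨x, x, [], rfl⟩

/-- An arrow, as a path of length one. -/
def ofArrow (c : E) : Path Q := ⟨Q.s c, Q.t c, [c], rfl, rfl⟩

/-- The product `p q` of two paths: first `q`, then `p`. -/
def comp (p q : Path Q) (h : p.src = q.tgt) : Path Q :=
  ⟨q.src, p.tgt, p.arrows ++ q.arrows, p.isWalk.append (by rw [h]; exact q.isWalk)⟩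

/-- `p` is a subpath of `q`: there are paths `x`, `y` with `q = x p y`. -/
def IsSubpath (p q : Path Q) : Prop :=
  ∃ (x y : Path Q) (h : p.src = y.tgt) (h' : x.src = (p.comp y h).tgt),
    q = x.comp (p.comp y h) h'

/-- The power `p ^ n` of a closed path `p`. -/
def power (p : Path Q) (h : p.src = p.tgt) (n : ℕ) : Path Q where
  src := p.src
  tgt := p.src
  arrows := (List.replicate n p.arrows).flatten
  isWalk := by
    induction n with
    | zero => rfl
    | succ n ih =>
      rw [List.replicate_succ, List.flatten_cons]
      refine ArrowQuiver.IsWalk.append (y := p.src) ?_ ih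
      have := p.isWalk
      rwa [← h] at this

/-- `p` and `q` begin with the same arrow. -/
def SameFirst (p q : Path Q) : Prop :=
  ∃ c, p.arrows.getLast? = some c ∧ q.arrows.getLast? = some c

/-- `p` and `q` end with the same arrow. -/
def SameLast (p q : Path Q) : Prop :=
  ∃ c, p.arrows.head? = some c ∧ q.arrows.head? = some c

end Path

/-- The set of arrows `T` is a spanning tree of `Q`: it contains no loop, no two of its elements
join the same two vertices (in whichever directions), and the resulting simple graph on the set
of all vertices is a tree. -/
structure ArrowQuiver.IsSpanningTree (Q : ArrowQuiver V E) (T : Set E) : Prop where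
  no_loop : ∀ c ∈ T, Q.s c ≠ Q.t c
  injOn : Set.InjOn (fun c => s(Q.s c, Q.t c)) T
  isTree : (SimpleGraph.fromEdgeSet ((fun c => s(Q.s c, Q.t c)) '' T)).IsTree

/-! ### Cycles -/

/-- A cycle: a closed path of positive length. -/
@[ext]
structure Cycle (Q : ArrowQuiver V E) extends Path Q where
  closed : src = tgt
  pos : arrows ≠ []

namespace Cycle

variable {Q : ArrowQuiver V E}

/-- The rotation `c_{m-1} ⋯ c_1 c_m` of the cycle `c_m ⋯ c_1`. -/
def rot (C : Cycle Q) : Cycle Q where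
  src := Q.s (C.arrows.head C.pos)
  tgt := Q.s (C.arrows.head C.pos)
  arrows := C.arrows.tail ++ [C.arrows.head C.pos]
  isWalk := by
    obtain ⟨⟨x, y, l, hl⟩, hc, hp⟩ := C
    cases l with
    | nil => exact absurd rfl hp
    | cons c l =>
      obtain ⟨h₁, h₂⟩ := hl
      refine ArrowQuiver.IsWalk.append h₂ ⟨?_, rfl⟩
      exact h₁.trans hc.symm
  closed := rfl
  pos := by simp

/-- The first arrow `c_1` of the cycle `c_m ⋯ c_1`. -/
def firstArrow (C : Cycle Q) : E := C.arrows.getLast C.pos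

theorem src_firstArrow (C : Cycle Q) : Q.s C.firstArrow = C.tgt :=
  (C.isWalk.source_getLast C.pos).trans C.closed

/-- The path `c C`, with `c` the first arrow of the cycle `C`. -/
def firstMul (C : Cycle Q) : Path Q := (Path.ofArrow C.firstArrow).comp C.toPath C.src_firstArrow

/-- A cycle is primitive if it is not a proper power of a cycle. -/
def IsPrimitive (C : Cycle Q) : Prop :=
  ∀ (D : Cycle Q) (n : ℕ), C.toPath = D.power D.closed n → n = 1

/-- Two cycles are conjugate if one is obtained from the other by repeated rotation. -/
def IsConj (C D : Cycle Q) : Prop := ∃ n : ℕ, rot^[n] C = D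

/-- The period of a cycle `C`: the least `r ≥ 1` such that `rot ^ r (C) = C`. -/
noncomputable def period (C : Cycle Q) : ℕ := Function.minimalPeriod rot C

end Cycle

/-! ### The path algebra -/

/-- The path algebra `k Q`: the vector space with basis the set of paths of `Q`. -/
def PathAlgebra (k : Type u) [Field k] (Q : ArrowQuiver V E) := Path Q →₀ k

namespace PathAlgebra

variable {k : Type u} [Field k] {Q : ArrowQuiver V E}

noncomputable instance : AddCommGroup (PathAlgebra k Q) :=
  inferInstanceAs (AddCommGroup (Path Q →₀ k))

noncomputable instance : Module k (PathAlgebra k Q) := inferInstanceAs (Module k (Path Q →₀ k))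

variable (k) in
/-- A path, as an element of the path algebra. -/
noncomputable def ofPath (p : Path Q) : PathAlgebra k Q := Finsupp.single p (1 : k)

variable (k Q) in
/-- An arrow, as an element of the path algebra. -/
noncomputable def ofArrow (c : E) : PathAlgebra k Q := ofPath k (Path.ofArrow c)

open Classical in
variable (k) in
/-- The product of two paths in the path algebra: their concatenation if they can be composed,
and zero otherwise. -/
noncomputable def pathMul (p q : Path Q) : PathAlgebra k Q :=
  if h : p.src = q.tgt then ofPath k (p.comp q h) else 0

/-- The product of the path algebra, as a bilinear map. -/
noncomputable def mulBilin : PathAlgebra k Q →ₗ[k] PathAlgebra k Q →ₗ[k] PathAlgebra k Q :=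
  Finsupp.linearCombination k fun p : Path Q =>
    (Finsupp.linearCombination k fun q : Path Q => pathMul k p q)

noncomputable instance : Mul (PathAlgebra k Q) := ⟨fun f g => mulBilin f g⟩

noncomputable instance [Fintype V] : One (PathAlgebra k Q) :=
  ⟨∑ x : V, ofPath k (Path.trivial x)⟩

theorem mul_def (f g : PathAlgebra k Q) : f * g = mulBilin f g := rfl

theorem one_def [Fintype V] : (1 : PathAlgebra k Q) = ∑ x : V, ofPath k (Path.trivial x) := rfl

theorem ofPath_mul_ofPath (p q : Path Q) : ofPath k p * ofPath k q = pathMul k p q := by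
  have h : mulBilin (ofPath k p) = Finsupp.linearCombination k fun q : Path Q => pathMul k p q :=
    (Finsupp.linearCombination_single k 1 p).trans (one_smul k _)
  rw [mul_def, h]
  exact (Finsupp.linearCombination_single k 1 q).trans (one_smul k _)

@[elab_as_elim]
theorem induction_ofPath {motive : PathAlgebra k Q → Prop} (f : PathAlgebra k Q)
    (zero : motive 0) (add : ∀ f g, motive f → motive g → motive (f + g))
    (smul : ∀ (c : k) (p : Path Q), motive (c • ofPath k p)) : motive f := by
  refine Finsupp.induction_linear (motive := motive) f zero add fun p c => ?_
  have h : (Finsupp.single p c : Path Q →₀ k) = c • Finsupp.single p (1 : k) := by simp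
  rw [h]
  exact smul c p

theorem smul_mul_aux (c : k) (f g : PathAlgebra k Q) : (c • f) * g = c • (f * g) := by
  simp only [mul_def, map_smul, LinearMap.smul_apply]

theorem mul_smul_aux (c : k) (f g : PathAlgebra k Q) : f * (c • g) = c • (f * g) := by
  simp only [mul_def, map_smul]

theorem add_mul_aux (f g h : PathAlgebra k Q) : (f + g) * h = f * h + g * h := by
  simp only [mul_def, map_add, LinearMap.add_apply]

theorem mul_add_aux (f g h : PathAlgebra k Q) : f * (g + h) = f * g + f * h := by
  simp only [mul_def, map_add]

theorem zero_mul_aux (f : PathAlgebra k Q) : 0 * f = 0 := by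
  simp only [mul_def, map_zero, LinearMap.zero_apply]

theorem mul_zero_aux (f : PathAlgebra k Q) : f * 0 = 0 := by
  simp only [mul_def, map_zero]

theorem mul_assoc_aux (f g h : PathAlgebra k Q) : f * g * h = f * (g * h) := by
  induction f using induction_ofPath with
  | zero => simp only [zero_mul_aux]
  | add f₁ f₂ h₁ h₂ => simp only [add_mul_aux, h₁, h₂]
  | smul c p =>
  induction g using induction_ofPath with
  | zero => simp only [zero_mul_aux, mul_zero_aux]
  | add f₁ f₂ h₁ h₂ => simp only [add_mul_aux, mul_add_aux, h₁, h₂]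
  | smul d q =>
  induction h using induction_ofPath with
  | zero => simp only [mul_zero_aux]
  | add f₁ f₂ h₁ h₂ => simp only [mul_add_aux, h₁, h₂]
  | smul e r =>
  simp only [smul_mul_aux, mul_smul_aux, ofPath_mul_ofPath]
  congr 3
  by_cases h₁ : p.src = q.tgt <;> by_cases h₂ : q.src = r.tgt
  · have h₃ : (p.comp q h₁).src = r.tgt := h₂
    have h₄ : p.src = (q.comp r h₂).tgt := h₁
    have h₅ : ((p.comp q h₁).comp r h₃) = p.comp (q.comp r h₂) h₄ := by
      ext1 <;> simp [Path.comp]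
    rw [pathMul, dif_pos h₁, ofPath_mul_ofPath, pathMul, dif_pos h₃, pathMul, dif_pos h₂,
      ofPath_mul_ofPath, pathMul, dif_pos h₄, h₅]
  · have h₃ : ¬ (p.comp q h₁).src = r.tgt := h₂
    simp only [pathMul, h₁, h₂, dif_pos, dif_neg, ofPath_mul_ofPath, h₃, mul_zero_aux,
      not_false_eq_true]
  · have h₄ : ¬ p.src = (q.comp r h₂).tgt := h₁
    simp only [pathMul, h₁, h₂, dif_pos, dif_neg, ofPath_mul_ofPath, h₄, zero_mul_aux,
      not_false_eq_true]
  · simp only [pathMul, h₁, h₂, dif_neg, zero_mul_aux, mul_zero_aux, not_false_eq_true]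

theorem one_mul_aux [Fintype V] (f : PathAlgebra k Q) : 1 * f = f := by
  induction f using induction_ofPath with
  | zero => exact mul_zero_aux _
  | add f₁ f₂ h₁ h₂ => rw [mul_add_aux, h₁, h₂]
  | smul c p =>
    rw [mul_smul_aux, one_def, mul_def, map_sum, LinearMap.sum_apply,
      Finset.sum_eq_single p.tgt]
    · congr 1
      rw [← mul_def, ofPath_mul_ofPath, pathMul,
        dif_pos (show (Path.trivial p.tgt).src = p.tgt from rfl)]
      rfl
    · intro x _ hx
      rw [← mul_def, ofPath_mul_ofPath, pathMul,
        dif_neg (show ¬ (Path.trivial x).src = p.tgt from hx)]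
    · exact fun h => absurd (Finset.mem_univ _) h

theorem mul_one_aux [Fintype V] (f : PathAlgebra k Q) : f * 1 = f := by
  induction f using induction_ofPath with
  | zero => exact zero_mul_aux _
  | add f₁ f₂ h₁ h₂ => rw [add_mul_aux, h₁, h₂]
  | smul c p =>
    rw [smul_mul_aux, one_def, mul_def, map_sum, Finset.sum_eq_single p.src]
    · congr 1
      rw [← mul_def, ofPath_mul_ofPath, pathMul,
        dif_pos (show p.src = (Path.trivial p.src).tgt from rfl)]
      exact congrArg (ofPath k) (by ext1 <;> simp [Path.comp, Path.trivial])
    · intro x _ hx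
      rw [← mul_def, ofPath_mul_ofPath, pathMul,
        dif_neg (show ¬ p.src = (Path.trivial x).tgt from hx.symm)]
    · exact fun h => absurd (Finset.mem_univ _) h

variable [Fintype V]

noncomputable instance : Ring (PathAlgebra k Q) :=
  { (inferInstance : AddCommGroup (PathAlgebra k Q)) with
    mul := (· * ·)
    one := 1
    left_distrib := mul_add_aux
    right_distrib := add_mul_aux
    zero_mul := zero_mul_aux
    mul_zero := mul_zero_aux
    mul_assoc := mul_assoc_aux
    one_mul := one_mul_aux
    mul_one := mul_one_aux }

noncomputable instance : Algebra k (PathAlgebra k Q) := Algebra.ofModule smul_mul_aux mul_smul_aux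

end PathAlgebra

/-! ### Gentle presentations -/

section Gentle

variable {k : Type u} [Field k] [Fintype V] {Q : ArrowQuiver V E}

open PathAlgebra in
/-- The pair `(Q, I)`, with `I` a two-sided ideal of the path algebra `k Q`, is a gentle
presentation. -/
structure IsGentle (I : TwoSidedIdeal (PathAlgebra k Q)) : Prop where
  source_le : ∀ x : V, {a | Q.s a = x}.encard ≤ 2
  target_le : ∀ x : V, {a | Q.t a = x}.encard ≤ 2
  right_notMem : ∀ a : E, {b | ofArrow k Q a * ofArrow k Q b ∉ I}.Subsingleton
  left_notMem : ∀ a : E, {c | ofArrow k Q c * ofArrow k Q a ∉ I}.Subsingleton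
  left_mem : ∀ a : E, {b | Q.t a = Q.s b ∧ ofArrow k Q b * ofArrow k Q a ∈ I}.Subsingleton
  right_mem : ∀ a : E, {c | Q.t c = Q.s a ∧ ofArrow k Q a * ofArrow k Q c ∈ I}.Subsingleton
  generated : ∃ S : Set (Path Q), (∀ p ∈ S, p.length = 2) ∧ I = TwoSidedIdeal.span (ofPath k '' S)

variable (I : TwoSidedIdeal (PathAlgebra k Q))

/-- The algebra `A = k Q / I`. -/
abbrev BoundAlgebra := I.ringCon.Quotient

/-- The class of a path in `A = k Q / I`. -/
noncomputable def pathClass (p : Path Q) : BoundAlgebra I := I.ringCon.mk' (PathAlgebra.ofPath k p)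

/-- The set `B` of the paths without subpaths of length two in `I`. -/
def InB (p : Path Q) : Prop :=
  p.arrows.IsChain fun b a => PathAlgebra.ofArrow k Q b * PathAlgebra.ofArrow k Q a ∉ I

/-- The set `Γ` of the paths all of whose subpaths of length two are in `I`. -/
def InΓ (p : Path Q) : Prop :=
  p.arrows.IsChain fun b a => PathAlgebra.ofArrow k Q b * PathAlgebra.ofArrow k Q a ∈ I

/-- `B`-maximal paths. -/
def IsBMaximal (p : Path Q) : Prop := InB I p ∧ ∀ q, InB I q → p.IsSubpath q → p = q

/-- `Γ`-maximal paths. -/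
def IsΓMaximal (p : Path Q) : Prop := InΓ I p ∧ ∀ q, InΓ I q → p.IsSubpath q → p = q

/-- A cycle `C` is cocomplete if `C ^ 2` is in `B`. -/
def IsCocomplete (C : Cycle Q) : Prop := InB I (C.power C.closed 2)

/-- A cycle `C` is complete if `C ^ 2` is in `Γ`. -/
def IsComplete (C : Cycle Q) : Prop := InΓ I (C.power C.closed 2)

/-- `X` is a set of representatives of the cocomplete circuits (the conjugacy classes of
cocomplete cycles), obtained by choosing a representative of each primitive cocomplete circuit
and taking all the positive powers of those. -/
def IsCocompleteReps (X : Set (Cycle Q)) : Prop :=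
  ∃ P : Set (Cycle Q),
    (∀ C ∈ P, C.IsPrimitive ∧ IsCocomplete I C) ∧
    (∀ C : Cycle Q, C.IsPrimitive → IsCocomplete I C → ∃! D, D ∈ P ∧ C.IsConj D) ∧
    X = {C | ∃ D ∈ P, ∃ n : ℕ, 1 ≤ n ∧ C.toPath = D.power D.closed n}

/-- `X` is a set of representatives of the complete circuits (the conjugacy classes of complete
cycles), closed under those products that are complete cycles. -/
def IsCompleteReps (X : Set (Cycle Q)) : Prop :=
  (∀ C ∈ X, IsComplete I C) ∧
  (∀ C : Cycle Q, IsComplete I C → ∃! D, D ∈ X ∧ C.IsConj D) ∧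
  (∀ C ∈ X, ∀ D ∈ X, ∀ (h : C.src = D.tgt) (F : Cycle Q),
    F.toPath = C.comp D.toPath h → IsComplete I F → F ∈ X)

end Gentle

/-! ### Cohomology of a sequence of linear maps -/

section Cohomology

variable {k : Type u} [Field k] {C : ℕ → Type*} [∀ m, AddCommGroup (C m)] [∀ m, Module k (C m)]

/-- The coboundaries of a cochain complex `C⁰ → C¹ → C² → ⋯`. -/
def coboundaries (d : ∀ m, C m →ₗ[k] C (m + 1)) : ∀ m, Submodule k (C m)
  | 0 => ⊥
  | m + 1 => LinearMap.range (d m)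

/-- The `m`-th cohomology space, cocycles modulo coboundaries. -/
abbrev Cohomology (d : ∀ m, C m →ₗ[k] C (m + 1)) (m : ℕ) :=
  LinearMap.ker (d m) ⧸ (coboundaries d m).submoduleOf (LinearMap.ker (d m))

/-- The cohomology class of a cocycle. -/
abbrev cohomologyClass (d : ∀ m, C m →ₗ[k] C (m + 1)) {m : ℕ} (z : LinearMap.ker (d m)) :
    Cohomology d m :=
  Submodule.Quotient.mk z

end Cohomology

/-! ### Hochschild cohomology -/

section Hochschild

variable (k : Type u) [Field k] (A : Type*) [Ring A] [Algebra k A]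

/-- Hochschild `m`-cochains with values in `A`: the multilinear maps `A × ⋯ × A → A`. -/
abbrev HochschildCochain (m : ℕ) := MultilinearMap k (fun _ : Fin m => A) A

variable {k A}

open Fin in
theorem contractNth_update {m : ℕ} (j : Fin m) (x : Fin (m + 1) → A) (i : Fin (m + 1)) :
    ∃ (i' : Fin m) (L : A →ₗ[k] A), ∀ v : A,
      contractNth j.castSucc (· * ·) (Function.update x i v) =
        Function.update (contractNth j.castSucc (· * ·) x) i' (L v) := by
  rcases lt_trichotomy (i : ℕ) (j : ℕ) with h | h | h
  · refine ⟨⟨i, by omega⟩, LinearMap.id, fun v => funext fun l => ?_⟩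
    simp only [contractNth, Function.update_apply, Fin.ext_iff, Fin.val_castSucc, Fin.val_succ,
      LinearMap.id_apply]
    grind
  · refine ⟨j, LinearMap.mulRight k (x j.succ), fun v => funext fun l => ?_⟩
    simp only [contractNth, Function.update_apply, Fin.ext_iff, Fin.val_castSucc, Fin.val_succ,
      LinearMap.mulRight_apply]
    grind
  · by_cases h' : (i : ℕ) = j + 1
    · refine ⟨j, LinearMap.mulLeft k (x j.castSucc), fun v => funext fun l => ?_⟩
      simp only [contractNth, Function.update_apply, Fin.ext_iff, Fin.val_castSucc, Fin.val_succ,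
        LinearMap.mulLeft_apply]
      grind
    · refine ⟨⟨i - 1, by omega⟩, LinearMap.id, fun v => funext fun l => ?_⟩
      simp only [contractNth, Function.update_apply, Fin.ext_iff, Fin.val_castSucc, Fin.val_succ,
        LinearMap.id_apply]
      grind

/-- The cochain `(x_0, …, x_m) ↦ f (x_0, …, x_j x_{j+1}, …, x_m)`. -/
def HochschildCochain.contract {m : ℕ} (j : Fin m) (f : HochschildCochain k A m) :
    HochschildCochain k A (m + 1) where
  toFun x := f (Fin.contractNth j.castSucc (· * ·) x)
  map_update_add' := by
    intro inst x i v w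
    rw [Subsingleton.elim inst (instDecidableEqFin (m + 1))]
    obtain ⟨i', L, h⟩ := contractNth_update (k := k) j x i
    rw [h, h, h, map_add, f.map_update_add]
  map_update_smul' := by
    intro inst x i c v
    rw [Subsingleton.elim inst (instDecidableEqFin (m + 1))]
    obtain ⟨i', L, h⟩ := contractNth_update (k := k) j x i
    rw [h, h, map_smul, f.map_update_smul]

/-- The cochain `(x_0, …, x_m) ↦ x_0 f (x_1, …, x_m)`. -/
def HochschildCochain.mulLeft {m : ℕ} (f : HochschildCochain k A m) :
    HochschildCochain k A (m + 1) :=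
  LinearMap.uncurryLeft (M := fun _ : Fin (m + 1) => A)
    { toFun := fun a => (LinearMap.mulLeft k a).compMultilinearMap f
      map_add' := fun a b => by ext x; simp [add_mul]
      map_smul' := fun c a => by ext x; simp }

/-- The cochain `(x_0, …, x_m) ↦ f (x_0, …, x_{m-1}) x_m`. -/
def HochschildCochain.mulRight {m : ℕ} (f : HochschildCochain k A m) :
    HochschildCochain k A (m + 1) :=
  MultilinearMap.uncurryRight (M := fun _ : Fin (m + 1) => A)
    ((LinearMap.mul k A).compMultilinearMap f)

variable (k A) in
/-- The Hochschild differential. -/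
def hochschildD (m : ℕ) : HochschildCochain k A m →ₗ[k] HochschildCochain k A (m + 1) where
  toFun f := f.mulLeft + ∑ j : Fin m, (-1 : k) ^ ((j : ℕ) + 1) • f.contract j
    + (-1 : k) ^ (m + 1) • f.mulRight
  map_add' f g := by
    ext x
    simp [HochschildCochain.mulLeft, HochschildCochain.mulRight, HochschildCochain.contract,
      Finset.sum_add_distrib]
    abel
  map_smul' c f := by
    ext x
    simp [HochschildCochain.mulLeft, HochschildCochain.mulRight, HochschildCochain.contract,
      Finset.smul_sum, smul_comm c]

theorem hochschildD_apply {m : ℕ} (f : HochschildCochain k A m) (x : Fin (m + 1) → A) :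
    hochschildD k A m f x =
      x 0 * f (fun i => x i.succ)
        + ∑ j : Fin m,
            (-1 : k) ^ ((j : ℕ) + 1) • f (Fin.contractNth j.castSucc (· * ·) x)
        + (-1 : k) ^ (m + 1) • (f (fun i => x i.castSucc) * x (Fin.last m)) := by
  simp [hochschildD, HochschildCochain.mulLeft, HochschildCochain.mulRight,
    HochschildCochain.contract]
  rfl

variable (k A) in
/-- The Hochschild cohomology space `HH^m(A)`. -/
abbrev HH (m : ℕ) := Cohomology (hochschildD k A) m

end Hochschild

/-! ### The complex of parallel paths -/

section Parallel

variable {k : Type u} [Field k] [Fintype V] {Q : ArrowQuiver V E}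
  (I : TwoSidedIdeal (PathAlgebra k Q))

/-- `(γ, α)` is an element of `Γ_m ∥ B`: a pair of parallel paths with `γ` in `Γ` of length `m`
and `α` in `B`. -/
structure IsParallelPair (m : ℕ) (x : Path Q × Path Q) : Prop where
  fst_mem : InΓ I x.1
  length_fst : x.1.length = m
  snd_mem : InB I x.2
  src_eq : x.1.src = x.2.src
  tgt_eq : x.1.tgt = x.2.tgt

/-- The vector space `k (Γ_m ∥ B)` with basis `Γ_m ∥ B`. -/
abbrev ParallelCochain (m : ℕ) := {x : Path Q × Path Q // IsParallelPair I m x} →₀ k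

open Classical in
/-- The pair `(γ, α)` as an element of `k (Γ_m ∥ B)`; zero if `(γ, α)` is not in `Γ_m ∥ B`. -/
noncomputable def pair (m : ℕ) (γ α : Path Q) : ParallelCochain I m :=
  if h : IsParallelPair I m (γ, α) then Finsupp.single ⟨(γ, α), h⟩ 1 else 0

variable [Fintype E]

open Classical in
/-- The differential of `k (Γ ∥ B)`: it maps `(γ, α)` to
`∑_b (b γ, b α) - (-1) ^ m ∑_a (γ a, α a)`, where the sums are over the arrows for which the
summands are in `Γ_{m+1} ∥ B`. -/
noncomputable def parallelD (m : ℕ) : ParallelCochain I m →ₗ[k] ParallelCochain I (m + 1) :=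
  Finsupp.linearCombination k fun x =>
    (∑ b : E,
      if h : Q.s b = x.1.1.tgt then
        pair I (m + 1) ((Path.ofArrow b).comp x.1.1 h)
          ((Path.ofArrow b).comp x.1.2 (h.trans x.2.tgt_eq))
      else 0)
    - (-1 : k) ^ m • ∑ a : E,
      if h : x.1.1.src = Q.t a then
        pair I (m + 1) (x.1.1.comp (Path.ofArrow a) h)
          (x.1.2.comp (Path.ofArrow a) (x.2.src_eq.symm.trans h))
      else 0

/-- The cohomology of the complex `k (Γ ∥ B)`. -/
abbrev ParallelCohomology (m : ℕ) := Cohomology (parallelD I) m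

open Classical in
/-- The value `∑_α z(γ, α) α ∈ A` at `γ` of an element `z` of `k (Γ_m ∥ B)`, seen as a map on
`Γ_m` with values in `A`. -/
noncomputable def parallelEval {m : ℕ} (z : ParallelCochain I m) (γ : Path Q) : BoundAlgebra I :=
  z.sum fun x c => if x.1.1 = γ then c • pathClass I x.1.2 else 0

/-- The value `e_{t(γ)} f (c_m, …, c_1) e_{s(γ)} ∈ A` at a path `γ = c_m ⋯ c_1` of a Hochschild
`m`-cochain `f` of `A`. -/
noncomputable def hochschildEval {m : ℕ} (f : HochschildCochain k (BoundAlgebra I) m)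
    (γ : Path Q) (h : γ.length = m) : BoundAlgebra I :=
  pathClass I (Path.trivial γ.tgt)
    * f (fun i => pathClass I (Path.ofArrow (γ.arrows.get (i.cast h.symm))))
    * pathClass I (Path.trivial γ.src)

/-- `f` restricts to `z`: on every `γ ∈ Γ_m`, the Hochschild cochain `f` and the element `z` of
`k (Γ_m ∥ B)` have the same value. Restriction along
`1 ⊗ γ ⊗ 1 ↦ e_{t(γ)} ⊗ c_m ⊗ ⋯ ⊗ c_1 ⊗ e_{s(γ)}` is the comparison map from the bar resolution
to the resolution `A ⊗_E k Γ ⊗_E A` of the bimodule `A`, and `k (Γ ∥ B)` is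
`Hom (A ⊗_E k Γ ⊗_E A, A)`. -/
def Restricts {m : ℕ} (f : HochschildCochain k (BoundAlgebra I) m) (z : ParallelCochain I m) :
    Prop :=
  ∀ (γ : Path Q) (h : γ.length = m), InΓ I γ → hochschildEval I f γ h = parallelEval I z γ

/-! ### The generators -/

variable (T : Set E) (XB XΓ : Set (Cycle Q))

/-- The index set of the eight families of cocycles, in degree `m`. -/
inductive Generator (m : ℕ) : Type (max v w)
  /-- (I) The unit. -/
  | unit (hm : m = 0)
  /-- (II) The pairs `(s(α), α)` in `Γ_0 ∥ B` with `α` a `B`-maximal path. -/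
  | bMax (hm : m = 0) (α : Path Q) (hα : IsBMaximal I α) (closed : α.src = α.tgt)
  /-- (III) The sums `∑_i (s(rot^i(α)), rot^i(α))` with `α` in the set of representatives of the
  cocomplete circuits. -/
  | bSum (hm : m = 0) (α : Cycle Q) (hα : α ∈ XB)
  /-- (IV) The pairs `(c, c)` with `c` an arrow not in the spanning tree. -/
  | fundamental (hm : m = 1) (c : E) (hc : c ∉ T)
  /-- (V) The pairs `(c, c α)` with `α` in the set of representatives of the cocomplete circuits
  and `c` the first arrow of `α`. -/
  | bPlus (hm : m = 1) (α : Cycle Q) (hα : α ∈ XB)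
  /-- (VI) The pairs `(γ, α)` in `Γ_m ∥ B` with `γ` a `Γ`-maximal path and `γ` and `α` neither
  beginning nor ending with the same arrow. -/
  | clean (γ α : Path Q) (h : IsParallelPair I m (γ, α)) (hγ : IsΓMaximal I γ)
      (first : ¬ γ.SameFirst α) (last : ¬ γ.SameLast α)
  /-- (VII) The sums `∑_i (rot^i(C), s(rot^i(C)))` with `C` of length `m` in the set of
  representatives of the complete circuits, if `m` is even or the characteristic is two. -/
  | gammaSum (C : Cycle Q) (hC : C ∈ XΓ) (hm : C.length = m) (parity : Even m ∨ ringChar k = 2)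
  /-- (VIII) The pairs `(b C, b)` with `C` of length `m - 1` in the set of representatives of the
  complete circuits and `b` the first arrow of `C`, if `m` is odd or the characteristic is two. -/
  | gammaPlus (C : Cycle Q) (hC : C ∈ XΓ) (hm : C.length + 1 = m)
      (parity : Odd m ∨ ringChar k = 2)

/-- The element of `k (Γ_m ∥ B)` that belongs to an index. -/
noncomputable def Generator.cochain {m : ℕ} : Generator I T XB XΓ m → ParallelCochain I m
  | .unit _ => ∑ x : V, pair I m (Path.trivial x) (Path.trivial x)
  | .bMax _ α _ _ => pair I m (Path.trivial α.src) α
  | .bSum _ α _ => ∑ i ∈ Finset.range α.period,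
      pair I m (Path.trivial (Cycle.rot^[i] α).src) (Cycle.rot^[i] α).toPath
  | .fundamental _ c _ => pair I m (Path.ofArrow c) (Path.ofArrow c)
  | .bPlus _ α _ => pair I m (Path.ofArrow α.firstArrow) α.firstMul
  | .clean γ α _ _ _ _ => pair I m γ α
  | .gammaSum C _ _ _ => ∑ i ∈ Finset.range C.period,
      pair I m (Cycle.rot^[i] C).toPath (Path.trivial (Cycle.rot^[i] C).src)
  | .gammaPlus C _ _ _ => pair I m C.firstMul (Path.ofArrow C.firstArrow)

end Parallel

end GentleHH

/-!
The proof has two independent parts, the comparison of Hochschild cohomology with the complex of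
parallel paths, and the computation of the cohomology of that complex.

*The comparison.* The classes of the paths in `B` form a basis of `A` (`IsGentle.basisB`). For a
bimodule `X`, the maps `γ ↦ z γ ∈ e_t X e_s` on `Γ` form a complex with the differential `mapD`,
and restricting a Hochschild cochain to the words `c_m ⊗ ⋯ ⊗ c_1` with `c_m ⋯ c_1 ∈ Γ` is a map of
complexes (`restr_d`). For `X = A` it is the complex of parallel paths. Instead of the Koszul
resolution, the proof uses dimension shifting: a unital bimodule `X` embeds in the coinduced
bimodule `Hom(A, X)`, for which both complexes are acyclic in positive degrees. For Hochschild
cochains this is currying; for the maps on `Γ` it is the homotopy that moves an arrow from the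
argument of `Hom(A, X)` to the path `γ` (`IsGentle.coindAcyclic_succ`,
`IsGentle.coindAcyclic_zero`). By induction on the degree, restriction is bijective in cohomology
for all unital bimodules (`IsGentle.restr_bijective`), which gives `IsGentle.comparison`.

*The complex of parallel paths.* A pair of paths that are not both trivial has, since the
presentation is gentle, at most one extension `(b γ, b α)` on the left and at most one extension
`(γ a, α a)` on the right, and the differential is the signed sum of these
(`IsGentle.parallelD_pair`). The pairs are thus the vertices and edges of a graph, in which the
edges are the pairs with a common first or last arrow.
* If a pair of paths that are not both trivial has extensions on both sides, and one of these has
  both a common first and a common last arrow, then the pair consists of a cycle and a trivial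
  path (`LeftExt.exists_cycle`, `LeftExt.sameFirst_of_sameLast`). Such pairs and their extensions
  form cyclic graphs, one for each cocomplete or complete circuit; this is the notion of an
  `IsCircuitFamily`. Going around a circuit of complete cycles of length `m`, each step
  contributes the sign `(-1) ^ m`, which is responsible for the condition that `m` is even or the
  characteristic is two; for cocomplete cycles the sign is trivial, as the degree of the vertices
  is zero. The vertices give the generators III and VII, the edges V and VIII.
* The pairs of trivial paths and the pairs `(c, c)` form the graph `Q`. Its cohomology is given by
  the constants, which is I, and the edges outside of the spanning tree, which is IV.
* A pair without extensions that has no common first or last arrow belongs to one of the families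
  II and VI, as its first or its second path is maximal (`isBMaximal_of_not_ext`,
  `IsGentle.isΓMaximal_of_not_ext`).
* All other vertices and edges cancel in the differential.

In order to make the cancellation explicit, certain pairs are called reduced (`IsReduced`). Every
cochain is reduced up to coboundaries (`reduced_sup_coboundaries`). Each generator has a leading
pair, which occurs in it with coefficient one and in no other generator. A reduced cocycle is
determined by its coefficients at the leading pairs (`eq_zero_of_lead`), and these coefficients
vanish for a reduced coboundary (`lead_eq_zero_of_mem_coboundaries`). Hence the generators, which
are reduced cocycles, give a basis of the cohomology (`IsGentle.generatorBasis`).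
-/

namespace GentleHH

universe u v w

section

variable {V : Type v} {E : Type w}

/-! ### Removing the last or the first arrow of a path -/

theorem ArrowQuiver.IsWalk.tgt_unique {Q : ArrowQuiver V E} {l : List E} {x y z : V}
    (h : Q.IsWalk l x y) (h' : Q.IsWalk l x z) : y = z := by
  cases l with
  | nil => exact Eq.trans (Eq.symm h) h'
  | cons c l => exact h.1.symm.trans h'.1

theorem ArrowQuiver.IsWalk.src_unique {Q : ArrowQuiver V E} {l : List E} {x y z : V}
    (h : Q.IsWalk l x z) (h' : Q.IsWalk l y z) : x = y := by
  induction l generalizing z with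
  | nil => exact Eq.trans h (Eq.symm h')
  | cons c l ih => exact ih h.2 h'.2

theorem ArrowQuiver.IsWalk.dropLast {Q : ArrowQuiver V E} {l : List E} {x y : V}
    (h : Q.IsWalk l x y) (hl : l ≠ []) : Q.IsWalk l.dropLast (Q.t (l.getLast hl)) y := by
  induction l generalizing y with
  | nil => exact absurd rfl hl
  | cons c l ih =>
    cases l with
    | nil => exact h.1
    | cons d l => simpa using ⟨h.1, ih h.2 (by simp)⟩

theorem ArrowQuiver.IsWalk.head_tail {Q : ArrowQuiver V E} {l : List E} {x y : V}
    (h : Q.IsWalk l x y) (hl : l ≠ []) : Q.IsWalk l.tail x (Q.s (l.head hl)) := by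
  cases l with
  | nil => exact absurd rfl hl
  | cons c l => exact h.2

namespace Path

variable {Q : ArrowQuiver V E}

theorem ext_src {p q : Path Q} (h : p.src = q.src) (h' : p.arrows = q.arrows) : p = q := by
  have hq := q.isWalk
  rw [← h, ← h'] at hq
  exact Path.ext h (p.isWalk.tgt_unique hq) h'

theorem ext_tgt {p q : Path Q} (h : p.tgt = q.tgt) (h' : p.arrows = q.arrows) : p = q := by
  have hq := q.isWalk
  rw [← h, ← h'] at hq
  exact Path.ext (p.isWalk.src_unique hq) h h'

theorem src_eq_getLast (p : Path Q) {c : E} (h : p.arrows.getLast? = some c) : p.src = Q.s c := by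
  have h₁ : p.arrows ≠ [] := by rintro h'; simp [h'] at h
  rw [List.getLast?_eq_some_getLast h₁] at h
  rw [← Option.some.inj h]
  exact (p.isWalk.source_getLast h₁).symm

theorem tgt_eq_head (p : Path Q) {c : E} (h : p.arrows.head? = some c) : p.tgt = Q.t c := by
  obtain ⟨x, y, l, hl⟩ := p
  cases l with
  | nil => simp at h
  | cons d l => simp at h; subst h; exact hl.1.symm

theorem eq_of_arrows {p q : Path Q} (h : p.arrows = q.arrows) (hp : p.arrows ≠ []) : p = q := by
  refine ext_src ?_ h
  rw [p.src_eq_getLast (List.getLast?_eq_some_getLast hp),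
    q.src_eq_getLast (by rw [← h]; exact List.getLast?_eq_some_getLast hp)]

theorem eq_trivial {p : Path Q} (hp : p.arrows = []) : p = trivial p.src := ext_src rfl hp

theorem src_eq_tgt {p : Path Q} (hp : p.arrows = []) : p.src = p.tgt := by
  have := p.isWalk
  rwa [hp] at this

open Classical in
/-- The path `c_{m-1} ⋯ c_1`, obtained from `c_m ⋯ c_1` by removing the last arrow. A trivial path
is left as it is. -/
noncomputable def tl (p : Path Q) : Path Q :=
  if h : p.arrows = [] then p else ⟨p.src, Q.s (p.arrows.head h), p.arrows.tail,
    p.isWalk.head_tail h⟩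

open Classical in
/-- The path `c_m ⋯ c_2`, obtained from `c_m ⋯ c_1` by removing the first arrow. A trivial path
is left as it is. -/
noncomputable def it (p : Path Q) : Path Q :=
  if h : p.arrows = [] then p else ⟨Q.t (p.arrows.getLast h), p.tgt, p.arrows.dropLast,
    p.isWalk.dropLast h⟩

@[simp] theorem tl_arrows (p : Path Q) : p.tl.arrows = p.arrows.tail := by
  unfold tl; split_ifs with h <;> simp [h]

@[simp] theorem it_arrows (p : Path Q) : p.it.arrows = p.arrows.dropLast := by
  unfold it; split_ifs with h <;> simp [h]

@[simp] theorem tl_src (p : Path Q) : p.tl.src = p.src := by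
  unfold tl; split_ifs with h <;> simp

@[simp] theorem it_tgt (p : Path Q) : p.it.tgt = p.tgt := by
  unfold it; split_ifs with h <;> simp

theorem tl_tgt (p : Path Q) {c : E} (h : p.arrows.head? = some c) : p.tl.tgt = Q.s c := by
  have : p.arrows ≠ [] := by rintro h'; simp [h'] at h
  rw [List.head?_eq_some_head this] at h
  simp only [tl, this, ↓reduceDIte]
  exact congrArg Q.s (Option.some.inj h)

theorem it_src (p : Path Q) {c : E} (h : p.arrows.getLast? = some c) : p.it.src = Q.t c := by
  have : p.arrows ≠ [] := by rintro h'; simp [h'] at h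
  rw [List.getLast?_eq_some_getLast this] at h
  simp only [it, this, ↓reduceDIte]
  exact congrArg Q.t (Option.some.inj h)

@[simp] theorem comp_arrows (p q : Path Q) (h : p.src = q.tgt) :
    (p.comp q h).arrows = p.arrows ++ q.arrows := rfl
@[simp] theorem comp_src (p q : Path Q) (h : p.src = q.tgt) : (p.comp q h).src = q.src := rfl
@[simp] theorem comp_tgt (p q : Path Q) (h : p.src = q.tgt) : (p.comp q h).tgt = p.tgt := rfl
@[simp] theorem ofArrow_arrows (c : E) : (ofArrow c : Path Q).arrows = [c] := rfl
@[simp] theorem ofArrow_src (c : E) : (ofArrow c : Path Q).src = Q.s c := rfl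
@[simp] theorem ofArrow_tgt (c : E) : (ofArrow c : Path Q).tgt = Q.t c := rfl
@[simp] theorem trivial_arrows (x : V) : (trivial x : Path Q).arrows = [] := rfl
@[simp] theorem trivial_src (x : V) : (trivial x : Path Q).src = x := rfl
@[simp] theorem trivial_tgt (x : V) : (trivial x : Path Q).tgt = x := rfl

@[simp] theorem tl_cons (c : E) (p : Path Q) (h : (ofArrow c : Path Q).src = p.tgt) :
    ((ofArrow c).comp p h).tl = p := ext_src (by simp) (by simp)

@[simp] theorem it_concat (c : E) (p : Path Q) (h : p.src = (ofArrow c : Path Q).tgt) :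
    (p.comp (ofArrow c) h).it = p := ext_tgt (by simp) (by simp)

theorem it_cons {γ : Path Q} {b : E} (hb : (ofArrow b : Path Q).src = γ.tgt)
    (hb' : (ofArrow b : Path Q).src = γ.it.tgt) (hγ : γ.arrows ≠ []) :
    ((ofArrow b).comp γ hb).it = (ofArrow b).comp γ.it hb' :=
  ext_tgt (by simp) (by simp [List.dropLast_cons_of_ne_nil hγ])

theorem eq_cons (p : Path Q) {c : E} (h : p.arrows.head? = some c) :
    ∃ h', p = (ofArrow c).comp p.tl h' := by
  have h' : (ofArrow c : Path Q).src = p.tl.tgt := (p.tl_tgt h).symm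
  refine ⟨h', ext_src (by simp) ?_⟩
  simp only [comp_arrows, ofArrow_arrows, tl_arrows, List.singleton_append]
  exact (List.cons_head?_tail h).symm

theorem eq_concat (p : Path Q) {c : E} (h : p.arrows.getLast? = some c) :
    ∃ h', p = p.it.comp (ofArrow c) h' := by
  have h' : p.it.src = (ofArrow c : Path Q).tgt := p.it_src h
  refine ⟨h', ext_tgt (by simp) ?_⟩
  simp only [comp_arrows, ofArrow_arrows, it_arrows]
  exact (List.dropLast_append_getLast? c h).symm

theorem eq_ofArrow {p : Path Q} {c : E} (h : p.arrows = [c]) : p = ofArrow c :=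
  eq_of_arrows h (by simp [h])

theorem it_tl (p : Path Q) (h : 2 ≤ p.arrows.length) : p.tl.it = p.it.tl := by
  refine ext_src ?_ (by simp [List.tail_dropLast])
  have h₁ : p.arrows ≠ [] := by rintro h'; simp [h'] at h
  have h₂ : p.arrows.tail ≠ [] := by
    intro h'; have := congrArg List.length h'; simp at this; omega
  rw [tl_src, it_src _ (List.getLast?_eq_some_getLast h₁), it_src (c := p.arrows.getLast h₁)]
  rw [tl_arrows, List.getLast?_eq_some_getLast h₂, List.getLast_tail]

theorem head_it {γ : Path Q} (h : 2 ≤ γ.length) : γ.it.arrows.head? = γ.arrows.head? := by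
  rw [it_arrows]
  unfold length at h
  generalize γ.arrows = l at h
  match l, h with
  | a :: b :: l, _ => simp

theorem getLast_tl {γ : Path Q} (h : 2 ≤ γ.length) :
    γ.tl.arrows.getLast? = γ.arrows.getLast? := by
  rw [tl_arrows]
  unfold length at h
  generalize γ.arrows = l at h
  match l, h with
  | a :: b :: l, _ => simp [List.getLast?_cons]

end Path

/-! ### The basis of the algebra given by the paths in `B` -/

section Basis

open PathAlgebra

variable {k : Type u} [Field k] [Fintype V] {Q : ArrowQuiver V E}
  (I : TwoSidedIdeal (PathAlgebra k Q))

variable {I} in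
theorem mem_iff_mk_eq_zero (f : PathAlgebra k Q) : f ∈ I ↔ I.ringCon.mk' f = 0 := by
  rw [← TwoSidedIdeal.mem_ker, TwoSidedIdeal.ker_ringCon_mk']

theorem pathClass_mul (p q : Path Q) (h : p.src = q.tgt) :
    pathClass I p * pathClass I q = pathClass I (p.comp q h) := by
  rw [pathClass, pathClass, ← map_mul, ofPath_mul_ofPath, pathMul, dif_pos h, pathClass]

theorem pathClass_mul_of_ne (p q : Path Q) (h : p.src ≠ q.tgt) :
    pathClass I p * pathClass I q = 0 := by
  rw [pathClass, pathClass, ← map_mul, ofPath_mul_ofPath, pathMul, dif_neg h, map_zero]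

theorem one_eq_sum_pathClass : (1 : BoundAlgebra I) = ∑ x : V, pathClass I (Path.trivial x) := by
  rw [← map_one I.ringCon.mk', one_def, map_sum]; rfl

theorem InB.infix {p q : Path Q} (h : InB I q) (h' : p.arrows <:+: q.arrows) : InB I p :=
  List.IsChain.infix h h'

/-- A path outside `B` has a subpath of length two in `I`. -/
theorem pathClass_eq_zero_of_not_inB {p : Path Q} (h : ¬ InB I p) : pathClass I p = 0 := by
  generalize hn : p.arrows = l at h
  induction l generalizing p with
  | nil => exact absurd (by unfold InB; rw [hn]; exact List.IsChain.nil) h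
  | cons b l ih =>
    obtain ⟨hb, he⟩ := p.eq_cons (c := b) (by simp [hn])
    rw [he, ← pathClass_mul]
    by_cases h' : InB I p.tl
    · cases l with
      | nil =>
        exact absurd (by unfold InB; rw [hn]; exact List.IsChain.singleton _) h
      | cons a l =>
        obtain ⟨ha, he'⟩ := p.tl.eq_cons (c := a) (by simp [hn])
        rw [he', ← pathClass_mul, ← mul_assoc]
        have : ofArrow k Q b * ofArrow k Q a ∈ I := by
          by_contra h''
          refine h ?_
          unfold InB at h' ⊢
          rw [Path.tl_arrows] at h'
          rw [hn] at h' ⊢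
          exact List.IsChain.cons_cons h'' h'
        rw [mem_iff_mk_eq_zero, map_mul] at this
        exact (congrArg (· * _) this).trans (zero_mul _)
    · rw [ih h' (by simp [hn]), mul_zero]

/-- The ideal of the elements of the path algebra without component on the paths in `B`. -/
noncomputable def nonBIdeal : TwoSidedIdeal (PathAlgebra k Q) :=
  let J : Submodule k (PathAlgebra k Q) := Submodule.span k (ofPath k '' {p | ¬ InB I p})
  .mk' J J.zero_mem J.add_mem J.neg_mem
    (fun {f g} hg => by
      refine Submodule.span_induction (p := fun g _ => f * g ∈ J) ?_ ?_ ?_ ?_ hg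
      · rintro _ ⟨p, hp, rfl⟩
        induction f using induction_ofPath with
        | zero => rw [zero_mul]; exact J.zero_mem
        | add f₁ f₂ h₁ h₂ => rw [add_mul]; exact J.add_mem h₁ h₂
        | smul c q =>
          rw [smul_mul_assoc, ofPath_mul_ofPath, pathMul]
          refine J.smul_mem _ ?_
          split_ifs with h
          · refine Submodule.subset_span ⟨_, fun h' => hp ?_, rfl⟩
            exact h'.infix I (List.suffix_append _ _).isInfix
          · exact J.zero_mem
      · rw [mul_zero]; exact J.zero_mem
      · intro x y _ _ hx hy; rw [mul_add]; exact J.add_mem hx hy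
      · intro c x _ hx; rw [mul_smul_comm]; exact J.smul_mem _ hx)
    (fun {f g} hf => by
      refine Submodule.span_induction (p := fun f _ => f * g ∈ J) ?_ ?_ ?_ ?_ hf
      · rintro _ ⟨p, hp, rfl⟩
        induction g using induction_ofPath with
        | zero => rw [mul_zero]; exact J.zero_mem
        | add f₁ f₂ h₁ h₂ => rw [mul_add]; exact J.add_mem h₁ h₂
        | smul c q =>
          rw [mul_smul_comm, ofPath_mul_ofPath, pathMul]
          refine J.smul_mem _ ?_
          split_ifs with h
          · refine Submodule.subset_span ⟨_, fun h' => hp ?_, rfl⟩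
            exact h'.infix I (List.prefix_append _ _).isInfix
          · exact J.zero_mem
      · rw [zero_mul]; exact J.zero_mem
      · intro x y _ _ hx hy; rw [add_mul]; exact J.add_mem hx hy
      · intro c x _ hx; rw [smul_mul_assoc]; exact J.smul_mem _ hx)

theorem mem_nonBIdeal (f : PathAlgebra k Q) :
    f ∈ nonBIdeal I ↔ f ∈ Submodule.span k (ofPath k '' {p | ¬ InB I p}) := by
  rw [nonBIdeal, TwoSidedIdeal.mem_mk']; rfl

theorem span_ofPath_not_inB (f : PathAlgebra k Q) :
    f ∈ Submodule.span k (ofPath k '' {p | ¬ InB I p}) ↔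
      ∀ p, InB I p → (show Path Q →₀ k from f) p = 0 := by
  have h : f ∈ Submodule.span k (ofPath k '' {p | ¬ InB I p}) ↔
      (show Path Q →₀ k from f) ∈ Finsupp.supported k k {p | ¬ InB I p} := by
    rw [Finsupp.supported_eq_span_single]; exact Iff.rfl
  rw [h, Finsupp.mem_supported']
  simp

variable {I}

/-- The generators of `I` are paths of length two that lie outside `B`. -/
theorem IsGentle.le_nonBIdeal (hI : IsGentle I) : I ≤ nonBIdeal I := by
  obtain ⟨S, hS, h⟩ := hI.generated
  conv_lhs => rw [h]
  rw [TwoSidedIdeal.span_le]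
  rintro _ ⟨p, hp, rfl⟩
  refine (mem_nonBIdeal I _).2 (Submodule.subset_span ⟨p, fun hB => ?_, rfl⟩)
  have hpI : ofPath k p ∈ I := by rw [h]; exact TwoSidedIdeal.subset_span ⟨p, hp, rfl⟩
  obtain ⟨b, a, hba⟩ : ∃ b a, p.arrows = [b, a] := List.length_eq_two.1 (hS p hp)
  obtain ⟨hb, he⟩ := p.eq_cons (c := b) (by simp [hba])
  have ha : p.tl = Path.ofArrow a := Path.eq_ofArrow (by simp [hba])
  unfold InB at hB
  rw [hba, List.isChain_pair] at hB
  refine hB ?_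
  have hs : (Path.ofArrow b : Path Q).src = (Path.ofArrow a : Path Q).tgt := by rw [hb, ha]
  rw [ofArrow, ofArrow, ofPath_mul_ofPath, pathMul, dif_pos hs]
  convert hpI
  refine Path.eq_of_arrows (by simp [hba]) (by simp)

/-- The ideal of a gentle presentation is spanned by the paths outside `B`. -/
theorem IsGentle.mem_iff (hI : IsGentle I) (f : PathAlgebra k Q) :
    f ∈ I ↔ ∀ p, InB I p → (show Path Q →₀ k from f) p = 0 := by
  rw [← span_ofPath_not_inB]
  refine ⟨fun hf => (mem_nonBIdeal I f).1 (hI.le_nonBIdeal hf), fun hf => ?_⟩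
  have h' : Submodule.span k (ofPath k '' {p : Path Q | ¬ InB I p}) ≤
      (LinearMap.ker (I.ringCon.mkₐ k).toLinearMap) := by
    rw [Submodule.span_le]
    rintro _ ⟨p, hp, rfl⟩
    exact pathClass_eq_zero_of_not_inB I hp
  rw [mem_iff_mk_eq_zero]
  exact h' hf

/-- The classes of the paths in `B` form a basis of `A`. -/
noncomputable def IsGentle.basisB (hI : IsGentle I) :
    Module.Basis {p : Path Q // InB I p} k (BoundAlgebra I) :=
  .mk (v := fun p => pathClass I p.1)
    (by
      rw [linearIndependent_iff]
      intro l hl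
      have h : (I.ringCon.mkₐ k).toLinearMap (show PathAlgebra k Q from
          l.mapDomain Subtype.val) = 0 := by
        rw [← hl, Finsupp.linearCombination_apply, Finsupp.mapDomain, Finsupp.sum, Finsupp.sum]
        refine (map_sum (I.ringCon.mkₐ k).toLinearMap _ _).trans (Finset.sum_congr rfl ?_)
        intro p _
        have : (show PathAlgebra k Q from Finsupp.single p.1 (l p)) = l p • ofPath k p.1 :=
          (show Finsupp.single p.1 (l p) = l p • Finsupp.single p.1 (1 : k) by simp)
        exact (congrArg _ this).trans (map_smul _ _ _)
      have h' := (hI.mem_iff _).1 ((mem_iff_mk_eq_zero _).2 h)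
      ext p
      have := h' p.1 p.2
      exact (Finsupp.mapDomain_apply Subtype.val_injective l p).symm.trans this)
    (by
      rintro x -
      obtain ⟨f, rfl⟩ := I.ringCon.mkₐ_surjective (α := k) x
      induction f using induction_ofPath with
      | zero => rw [map_zero]; exact Submodule.zero_mem _
      | add f g hf hg => rw [map_add]; exact Submodule.add_mem _ hf hg
      | smul c p =>
        rw [map_smul]
        refine Submodule.smul_mem _ _ ?_
        by_cases hp : InB I p
        · exact Submodule.subset_span ⟨⟨p, hp⟩, rfl⟩
        · have : I.ringCon.mkₐ k (ofPath k p) = 0 := pathClass_eq_zero_of_not_inB I hp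
          rw [this]; exact Submodule.zero_mem _)

@[simp] theorem IsGentle.basisB_apply (hI : IsGentle I) (p : {p : Path Q // InB I p}) :
    hI.basisB p = pathClass I p.1 := by simp [basisB]

open Classical in
/-- The coefficient of an element of `A` at a path; zero at the paths outside `B`. -/
noncomputable def IsGentle.coef (hI : IsGentle I) (p : Path Q) : BoundAlgebra I →ₗ[k] k :=
  if h : InB I p then hI.basisB.coord ⟨p, h⟩ else 0

open Classical in
theorem IsGentle.coef_pathClass (hI : IsGentle I) (p q : Path Q) :
    hI.coef p (pathClass I q) = if p = q ∧ InB I p then 1 else 0 := by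
  by_cases hp : InB I p
  · rw [coef, dif_pos hp]
    by_cases hq : InB I q
    · rw [show pathClass I q = hI.basisB ⟨q, hq⟩ by simp, Module.Basis.coord_apply,
        Module.Basis.repr_self, Finsupp.single_apply]
      simp [hp, eq_comm]
    · rw [pathClass_eq_zero_of_not_inB I hq, map_zero, if_neg]
      rintro ⟨rfl, -⟩; exact hq hp
  · simp [coef, hp]

theorem IsGentle.coef_of_not_inB (hI : IsGentle I) {p : Path Q} (hp : ¬ InB I p)
    (x : BoundAlgebra I) : hI.coef p x = 0 := by simp [coef, hp]

theorem IsGentle.ext_coef (hI : IsGentle I) {x y : BoundAlgebra I}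
    (h : ∀ p, hI.coef p x = hI.coef p y) : x = y := by
  refine hI.basisB.ext_elem fun p => ?_
  have := h p.1
  simpa [coef, p.2] using this

theorem IsGentle.finite_coef (hI : IsGentle I) (x : BoundAlgebra I) :
    {p | hI.coef p x ≠ 0}.Finite := by
  refine ((hI.basisB.repr x).support.finite_toSet.image Subtype.val).subset fun p hp => ?_
  by_cases hB : InB I p
  · refine ⟨⟨p, hB⟩, ?_, rfl⟩
    simpa [coef, hB] using hp
  · simp [coef, hB] at hp

theorem IsGentle.linearMap_ext (hI : IsGentle I) {M : Type*} [AddCommGroup M] [Module k M]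
    {f g : BoundAlgebra I →ₗ[k] M} (h : ∀ p, InB I p → f (pathClass I p) = g (pathClass I p)) :
    f = g :=
  hI.basisB.ext fun p => by simpa using h p.1 p.2

end Basis

end

/-! ### Bimodules and their Hochschild cochains -/

/-- A bimodule over the `k`-algebra `A`, given by its left and right actions. The unit of `A` is
not required to act as the identity. -/
structure Bimod (k : Type u) (A : Type v) [Field k] [Ring A] [Algebra k A] where
  M : Type v
  [acg : AddCommGroup M]
  [mod : Module k M]
  l : A →ₗ[k] M →ₗ[k] M
  r : A →ₗ[k] M →ₗ[k] M
  l_mul : ∀ a b m, l (a * b) m = l a (l b m)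
  r_mul : ∀ a b m, r (a * b) m = r b (r a m)
  comm : ∀ a b m, l a (r b m) = r b (l a m)

attribute [instance] Bimod.acg Bimod.mod

namespace Bimod

variable {k : Type u} {A : Type v} [Field k] [Ring A] [Algebra k A] (X Y : Bimod k A)

/-- The unit of `A` acts as the identity on both sides. -/
structure Unital : Prop where
  l_one : ∀ m, X.l 1 m = m
  r_one : ∀ m, X.r 1 m = m

/-- Hochschild cochains with values in a bimodule. -/
abbrev Cochain (m : ℕ) := MultilinearMap k (fun _ : Fin m => A) X.M

variable {X Y}

/-- The cochain `(x_0, …, x_m) ↦ f (x_0, …, x_j x_{j+1}, …, x_m)`. -/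
def Cochain.contract {m : ℕ} (j : Fin m) (f : X.Cochain m) : X.Cochain (m + 1) where
  toFun x := f (Fin.contractNth j.castSucc (· * ·) x)
  map_update_add' := by
    intro inst x i v w
    rw [Subsingleton.elim inst (instDecidableEqFin (m + 1))]
    obtain ⟨i', L, h⟩ := contractNth_update (k := k) j x i
    rw [h, h, h, map_add, f.map_update_add]
  map_update_smul' := by
    intro inst x i c v
    rw [Subsingleton.elim inst (instDecidableEqFin (m + 1))]
    obtain ⟨i', L, h⟩ := contractNth_update (k := k) j x i
    rw [h, h, map_smul, f.map_update_smul]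

/-- The cochain `(x_0, …, x_m) ↦ x_0 f (x_1, …, x_m)`. -/
def Cochain.mulLeft {m : ℕ} (f : X.Cochain m) : X.Cochain (m + 1) :=
  LinearMap.uncurryLeft (M := fun _ : Fin (m + 1) => A)
    { toFun := fun a => (X.l a).compMultilinearMap f
      map_add' := fun a b => by ext x; simp
      map_smul' := fun c a => by ext x; simp }

/-- The cochain `(x_0, …, x_m) ↦ f (x_0, …, x_{m-1}) x_m`. -/
def Cochain.mulRight {m : ℕ} (f : X.Cochain m) : X.Cochain (m + 1) :=
  MultilinearMap.uncurryRight (M := fun _ : Fin (m + 1) => A)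
    (X.r.flip.compMultilinearMap f)

variable (X) in
/-- The Hochschild differential with values in a bimodule. -/
def d (m : ℕ) : X.Cochain m →ₗ[k] X.Cochain (m + 1) where
  toFun f := f.mulLeft + ∑ j : Fin m, (-1 : k) ^ ((j : ℕ) + 1) • f.contract j
    + (-1 : k) ^ (m + 1) • f.mulRight
  map_add' f g := by
    ext x
    simp [Cochain.mulLeft, Cochain.mulRight, Cochain.contract, Finset.sum_add_distrib]
    abel
  map_smul' c f := by
    ext x
    simp [Cochain.mulLeft, Cochain.mulRight, Cochain.contract, Finset.smul_sum, smul_comm c]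

theorem d_apply {m : ℕ} (f : X.Cochain m) (x : Fin (m + 1) → A) :
    X.d m f x = X.l (x 0) (f (fun i => x i.succ))
      + ∑ j : Fin m, (-1 : k) ^ ((j : ℕ) + 1) • f (Fin.contractNth j.castSucc (· * ·) x)
      + (-1 : k) ^ (m + 1) • X.r (x (Fin.last m)) (f (fun i => x i.castSucc)) := by
  simp [d, Cochain.mulLeft, Cochain.mulRight, Cochain.contract]
  rfl

/-- A linear map between bimodules commutes with the actions. -/
structure IsHom (φ : X.M →ₗ[k] Y.M) : Prop where
  l : ∀ a m, φ (X.l a m) = Y.l a (φ m)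
  r : ∀ a m, φ (X.r a m) = Y.r a (φ m)

theorem IsHom.d_comp {φ : X.M →ₗ[k] Y.M} (hφ : IsHom φ) {m : ℕ} (f : X.Cochain m) :
    Y.d m (φ.compMultilinearMap f) = φ.compMultilinearMap (X.d m f) := by
  ext x
  simp only [d_apply, LinearMap.compMultilinearMap_apply, map_add, map_sum, map_smul, hφ.l, hφ.r]

variable (X)

/-- The bimodule of linear maps `A → X` with `(a φ b)(x) = φ(x a) b`. -/
def coind : Bimod k A where
  M := A →ₗ[k] X.M
  l := LinearMap.mk₂ k (fun a φ => φ.comp (LinearMap.mulRight k a))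
    (fun a b φ => by ext x; simp [mul_add]) (fun c a φ => by ext x; simp)
    (fun a φ ψ => by ext x; simp) (fun c a φ => by ext x; simp)
  r := LinearMap.mk₂ k (fun a φ => (X.r a).comp φ)
    (fun a b φ => by ext x; simp) (fun c a φ => by ext x; simp)
    (fun a φ ψ => by ext x; simp) (fun c a φ => by ext x; simp)
  l_mul a b φ := by ext x; simp [mul_assoc]
  r_mul a b φ := by ext x; simp [X.r_mul]
  comm a b φ := by ext x; simp

/-- The bimodule of linear maps `A → X` with `(a φ)(x) = φ(x a) - x φ(a)` and `(φ b)(x) = φ(x) b`,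
on which the unit does not act as the identity. It is made so that Hochschild cochains of degree
`m + 1` with values in `X` are cochains of degree `m` with values in it. -/
def twist : Bimod k A where
  M := A →ₗ[k] X.M
  l := LinearMap.mk₂ k (fun a φ => φ.comp (LinearMap.mulRight k a) - X.l.flip (φ a))
    (fun a b φ => by ext x; simp [mul_add]; abel) (fun c a φ => by ext x; simp [smul_sub])
    (fun a φ ψ => by ext x; simp; abel) (fun c a φ => by ext x; simp [smul_sub])
  r := LinearMap.mk₂ k (fun a φ => (X.r a).comp φ)
    (fun a b φ => by ext x; simp) (fun c a φ => by ext x; simp)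
    (fun a φ ψ => by ext x; simp) (fun c a φ => by ext x; simp)
  l_mul a b φ := by ext x; simp [mul_assoc, X.l_mul]
  r_mul a b φ := by ext x; simp [X.r_mul]
  comm a b φ := by ext x; simp [X.comm]

variable {X}

/-- Evaluation of a member of the coinduced bimodule. -/
def coind.ev (x : A) : X.coind.M →ₗ[k] X.M := LinearMap.applyₗ (R := k) (M₂ := X.M) x

/-- Evaluation of a member of the twisted bimodule. -/
def twist.ev (x : A) : X.twist.M →ₗ[k] X.M := LinearMap.applyₗ (R := k) (M₂ := X.M) x

/-- A linear map, as a member of the coinduced bimodule. -/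
def coind.of (φ : A →ₗ[k] X.M) : X.coind.M := φ

@[simp] theorem coind.ev_of (φ : A →ₗ[k] X.M) (x : A) : ev x (of φ) = φ x := rfl

theorem coind.ext {φ ψ : X.coind.M} (h : ∀ x, ev x φ = ev x ψ) : φ = ψ := LinearMap.ext h
theorem twist.ext {φ ψ : X.twist.M} (h : ∀ x, ev x φ = ev x ψ) : φ = ψ := LinearMap.ext h

theorem coind.ev_zero (φ : X.coind.M) : ev 0 φ = 0 :=
  LinearMap.map_zero (show A →ₗ[k] X.M from φ)

/-- A member of the coinduced bimodule, as a linear map. -/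
def coind.toMap (φ : X.coind.M) : A →ₗ[k] X.M := φ

@[simp] theorem coind.ev_l (a : A) (φ : X.coind.M) (x : A) :
    ev x (X.coind.l a φ) = ev (x * a) φ := rfl
@[simp] theorem coind.ev_r (a : A) (φ : X.coind.M) (x : A) :
    ev x (X.coind.r a φ) = X.r a (ev x φ) := rfl
@[simp] theorem twist.ev_l (a : A) (φ : X.twist.M) (x : A) :
    ev x (X.twist.l a φ) = ev (x * a) φ - X.l x (ev a φ) := rfl
@[simp] theorem twist.ev_r (a : A) (φ : X.twist.M) (x : A) :
    ev x (X.twist.r a φ) = X.r a (ev x φ) := rfl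

theorem Unital.coind (h : X.Unital) : X.coind.Unital where
  l_one φ := coind.ext fun x => by simp
  r_one φ := coind.ext fun x => by simp [h.r_one]

/-- The linear maps `A → X` that vanish at `1`; this is the quotient of `X.coind` by `X`. -/
def quot (h : X.Unital) : Bimod k A :=
  let S : Submodule k X.twist.M := LinearMap.ker (twist.ev 1)
  have hl (a : A) (φ : S) : X.twist.l a φ.1 ∈ S := by
    rw [LinearMap.mem_ker, twist.ev_l, one_mul, h.l_one, sub_self]
  have hr (a : A) (φ : S) : X.twist.r a φ.1 ∈ S := by
    rw [LinearMap.mem_ker, twist.ev_r, LinearMap.mem_ker.1 φ.2, map_zero]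
  { M := S
    l := LinearMap.mk₂ k (fun a φ => ⟨X.twist.l a φ.1, hl a φ⟩)
      (fun a b φ => by ext1; exact LinearMap.congr_fun (map_add _ a b) φ.1)
      (fun c a φ => by ext1; exact LinearMap.congr_fun (map_smul _ c a) φ.1)
      (fun a φ ψ => by ext1; exact map_add _ _ _) (fun c a φ => by ext1; exact map_smul _ _ _)
    r := LinearMap.mk₂ k (fun a φ => ⟨X.twist.r a φ.1, hr a φ⟩)
      (fun a b φ => by ext1; exact LinearMap.congr_fun (map_add _ a b) φ.1)
      (fun c a φ => by ext1; exact LinearMap.congr_fun (map_smul _ c a) φ.1)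
      (fun a φ ψ => by ext1; exact map_add _ _ _) (fun c a φ => by ext1; exact map_smul _ _ _)
    l_mul a b φ := by ext1; exact X.twist.l_mul a b φ.1
    r_mul a b φ := by ext1; exact X.twist.r_mul a b φ.1
    comm a b φ := by ext1; exact X.twist.comm a b φ.1 }

/-- Evaluation of a member of the quotient of the coinduced bimodule. -/
def quot.ev {h : X.Unital} (x : A) : (X.quot h).M →ₗ[k] X.M :=
  twist.ev x ∘ₗ Submodule.subtype (LinearMap.ker (twist.ev 1))

section

variable (h : X.Unital)

theorem quot.ext {φ ψ : (X.quot h).M} (e : ∀ x, ev x φ = ev x ψ) : φ = ψ :=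
  Subtype.ext (twist.ext e)

theorem quot.ev_one (φ : (X.quot h).M) : ev 1 φ = 0 := LinearMap.mem_ker.1 φ.2

theorem quot.ev_l (a : A) (φ : (X.quot h).M) (x : A) :
    ev x ((X.quot h).l a φ) = ev (x * a) φ - X.l x (ev a φ) := rfl
theorem quot.ev_r (a : A) (φ : (X.quot h).M) (x : A) :
    ev x ((X.quot h).r a φ) = X.r a (ev x φ) := rfl

theorem Unital.quot : (X.quot h).Unital where
  l_one φ := quot.ext h fun x => by
    rw [quot.ev_l, quot.ev_one, mul_one, map_zero, sub_zero]
  r_one φ := quot.ext h fun x => by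
    rw [quot.ev_r, h.r_one]

variable (X) in
/-- The embedding of `X` in the coinduced bimodule, `m ↦ (x ↦ x m)`. -/
def toCoind : X.M →ₗ[k] X.coind.M := X.l.flip

@[simp] theorem ev_toCoind (m : X.M) (x : A) : coind.ev x (X.toCoind m) = X.l x m := rfl

/-- The projection of the coinduced bimodule to its quotient by `X`. -/
def toQuot : X.coind.M →ₗ[k] (X.quot h).M :=
  LinearMap.codRestrict (LinearMap.ker (twist.ev 1))
    (LinearMap.id - X.toCoind ∘ₗ coind.ev 1 : X.coind.M →ₗ[k] X.coind.M)
    (fun φ => by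
      have : coind.ev 1 (φ - X.toCoind (coind.ev 1 φ)) = 0 := by
        rw [map_sub, ev_toCoind, h.l_one, sub_self]
      exact this)

theorem ev_toQuot (φ : X.coind.M) (x : A) :
    quot.ev x (toQuot h φ) = coind.ev x φ - X.l x (coind.ev 1 φ) := rfl

variable (X) in
theorem isHom_toCoind : IsHom X.toCoind where
  l a m := coind.ext fun x => by simp [X.l_mul]
  r a m := coind.ext fun x => by simp [X.comm]

theorem isHom_toQuot : IsHom (toQuot h) where
  l a φ := quot.ext h fun x => by
    rw [ev_toQuot, quot.ev_l, ev_toQuot, ev_toQuot]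
    simp only [coind.ev_l, one_mul, map_sub, X.l_mul]
    abel
  r a φ := quot.ext h fun x => by
    rw [ev_toQuot, quot.ev_r, ev_toQuot]
    simp only [coind.ev_r, map_sub, X.comm]

theorem toQuot_toCoind (m : X.M) : toQuot h (X.toCoind m) = 0 :=
  quot.ext h fun x => by
    rw [ev_toQuot, ev_toCoind, ev_toCoind, h.l_one, sub_self, map_zero]

/-- The linear section of the projection to the quotient. -/
def quotLift : (X.quot h).M →ₗ[k] X.coind.M :=
  Submodule.subtype (LinearMap.ker (twist.ev (X := X) 1))

theorem toQuot_quotLift (φ : (X.quot h).M) : toQuot h (quotLift h φ) = φ :=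
  quot.ext h fun x => by
    have h0 : coind.ev 1 (quotLift h φ) = 0 := quot.ev_one h φ
    rw [ev_toQuot, h0, map_zero, sub_zero]
    rfl

theorem toCoind_ev_one {φ : X.coind.M} (hφ : toQuot h φ = 0) :
    X.toCoind (coind.ev 1 φ) = φ := by
  refine coind.ext fun x => ?_
  have := congrArg (quot.ev x) hφ
  rw [ev_toQuot, map_zero] at this
  exact (sub_eq_zero.1 this).symm

end

/-- A cochain of degree `m + 1`, as a cochain of degree `m` whose values are functions of the
leftmost argument. -/
def curry {m : ℕ} (f : X.Cochain (m + 1)) : X.coind.Cochain m :=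
  MultilinearMap.mk' (fun y => coind.of
    { toFun x := f (Fin.cons x y)
      map_add' x x' := f.cons_add y x x'
      map_smul' c x := f.cons_smul y c x })
    (fun y i a b => coind.ext fun x => by
      simp only [map_add, coind.ev_of, LinearMap.coe_mk, AddHom.coe_mk, Fin.cons_update,
        f.map_update_add])
    (fun y i c a => coind.ext fun x => by
      simp only [map_smul, coind.ev_of, LinearMap.coe_mk, AddHom.coe_mk, Fin.cons_update,
        f.map_update_smul])

/-- The same as `curry`, with values in the twisted bimodule. -/
def curryTwist {m : ℕ} (f : X.Cochain (m + 1)) : X.twist.Cochain m := curry f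

@[simp] theorem ev_curry {m : ℕ} (f : X.Cochain (m + 1)) (y : Fin m → A) (x : A) :
    coind.ev x (curry f y) = f (Fin.cons x y) := rfl

@[simp] theorem ev_curryTwist {m : ℕ} (f : X.Cochain (m + 1)) (y : Fin m → A) (x : A) :
    twist.ev x (curryTwist f y) = f (Fin.cons x y) := rfl

theorem contractNth_zero_cons {m : ℕ} (x : A) (y : Fin (m + 1) → A) :
    Fin.contractNth (0 : Fin (m + 2)) (· * ·) (Fin.cons x y : Fin (m + 2) → A) =
      Fin.cons (x * y 0) (fun i => y i.succ) := by
  ext i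
  refine Fin.cases ?_ (fun i => ?_) i
  · simp [Fin.contractNth]
  · simp [Fin.contractNth]

theorem contractNth_succ_cons {m : ℕ} (x : A) (y : Fin (m + 1) → A) (j : Fin m) :
    Fin.contractNth j.succ.castSucc (· * ·) (Fin.cons x y : Fin (m + 2) → A) =
      Fin.cons x (Fin.contractNth j.castSucc (· * ·) y) := by
  ext i
  refine Fin.cases ?_ (fun i => ?_) i
  · simp [Fin.contractNth]
  · simp [Fin.contractNth]

theorem cons_castSucc {S : Type*} {m : ℕ} (x : S) (y : Fin (m + 1) → S) :
    (fun i : Fin (m + 1) => (Fin.cons x y : Fin (m + 2) → S) i.castSucc) =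
      Fin.cons x (fun i : Fin m => y i.castSucc) := by
  ext i
  refine Fin.cases ?_ (fun i => ?_) i
  · simp
  · rw [← Fin.succ_castSucc]; simp

theorem d_cons {m : ℕ} (f : X.Cochain (m + 1)) (x : A) (y : Fin (m + 1) → A) :
    X.d (m + 1) f (Fin.cons x y) = X.l x (f y) - coind.ev x (X.coind.d m (curry f) y) := by
  have hlast : (Fin.cons x y : Fin (m + 2) → A) (Fin.last (m + 1)) = y (Fin.last m) := by
    rw [← Fin.succ_last, Fin.cons_succ]
  rw [d_apply, d_apply, Fin.sum_univ_succ, cons_castSucc, hlast]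
  simp only [Fin.cons_zero, Fin.cons_succ, Fin.castSucc_zero, contractNth_zero_cons,
    contractNth_succ_cons, Fin.val_zero, Fin.val_succ, map_add, map_sum, map_smul, ev_curry,
    coind.ev_l, coind.ev_r, pow_succ _ (_ + 1), mul_neg_one, neg_smul, Finset.sum_neg_distrib,
    zero_add, pow_one, one_smul]
  abel

theorem d_cons_twist {m : ℕ} (f : X.Cochain (m + 1)) (x : A) (y : Fin (m + 1) → A) :
    X.d (m + 1) f (Fin.cons x y) = - twist.ev x (X.twist.d m (curryTwist f) y) := by
  have hf : f y = twist.ev (y 0) (curryTwist f fun i => y i.succ) := by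
    rw [ev_curryTwist]; exact congrArg f (Fin.cons_self_tail y).symm
  rw [d_cons, hf, d_apply, d_apply]
  simp only [map_add, map_sum, map_smul, ev_curry, coind.ev_l, coind.ev_r, twist.ev_l, twist.ev_r,
    ev_curryTwist]
  abel

/-- The square of the Hochschild differential is zero. A cochain of degree `m + 1` is a cochain of
degree `m` with values in the twisted bimodule, up to the sign of the differential, so that only
degree zero has to be checked. -/
theorem d_d {m : ℕ} (f : X.Cochain m) : X.d (m + 1) (X.d m f) = 0 := by
  induction m generalizing X with
  | zero =>
    ext x
    simp only [d_apply, Fin.sum_univ_succ, Fin.sum_univ_zero]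
    have h (y : Fin 0 → A) : f y = f ![] := congrArg f (Subsingleton.elim _ _)
    simp only [h]
    simp [Fin.contractNth, X.l_mul, X.r_mul, X.comm]
    abel
  | succ m ih =>
    ext z
    obtain ⟨x, y, rfl⟩ : ∃ x y, z = Fin.cons x y := ⟨z 0, Fin.tail z, (Fin.cons_self_tail z).symm⟩
    have hc : curryTwist (X.d (m + 1) f) = - X.twist.d m (curryTwist f) := by
      ext y
      refine twist.ext fun x => ?_
      rw [ev_curryTwist, d_cons_twist, neg_apply, map_neg]
    rw [d_cons_twist, hc, map_neg, ih]
    simp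

end Bimod

/-! ### The complex of maps from `Γ` to a bimodule -/

section ParallelMaps

open PathAlgebra

variable {k : Type u} [Field k] {V : Type v} {E : Type w} [Fintype V] {Q : ArrowQuiver V E}
  {I : TwoSidedIdeal (PathAlgebra k Q)}

theorem trivial_mul_pathClass (p : Path Q) :
    pathClass I (Path.trivial p.tgt) * pathClass I p = pathClass I p := by
  have h : (Path.trivial p.tgt : Path Q).src = p.tgt := rfl
  exact (pathClass_mul I _ _ h).trans (congrArg _ (Path.ext_src rfl (by simp)))

theorem pathClass_mul_trivial (p : Path Q) :
    pathClass I p * pathClass I (Path.trivial p.src) = pathClass I p := by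
  have h : p.src = (Path.trivial p.src : Path Q).tgt := rfl
  exact (pathClass_mul I _ _ h).trans (congrArg _ (Path.ext_src rfl (by simp)))

theorem trivial_mul_trivial_of_ne {x y : V} (h : x ≠ y) :
    pathClass I (Path.trivial x) * pathClass I (Path.trivial y) = 0 :=
  pathClass_mul_of_ne I _ _ h

theorem trivial_mul_self (x : V) :
    pathClass I (Path.trivial x) * pathClass I (Path.trivial x) = pathClass I (Path.trivial x) :=
  trivial_mul_pathClass (Path.trivial x)

theorem ofArrow_mul_ofArrow_eq_zero {b a : E} (h : ofArrow k Q b * ofArrow k Q a ∈ I) :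
    pathClass I (Path.ofArrow b) * pathClass I (Path.ofArrow a) = 0 := by
  rw [mem_iff_mk_eq_zero, map_mul] at h; exact h

variable (I) in
/-- The set `Γ_m`. -/
structure InΓm (m : ℕ) (γ : Path Q) : Prop where
  inΓ : InΓ I γ
  length : γ.length = m

theorem InΓm.tl {m : ℕ} {γ : Path Q} (h : InΓm I (m + 1) γ) : InΓm I m γ.tl where
  inΓ := by
    have := h.inΓ
    unfold InΓ at this ⊢
    rw [Path.tl_arrows]
    exact this.tail
  length := by
    have := h.length
    simp only [Path.length, Path.tl_arrows, List.length_tail] at this ⊢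
    omega

theorem InΓm.it {m : ℕ} {γ : Path Q} (h : InΓm I (m + 1) γ) : InΓm I m γ.it where
  inΓ := by
    have := h.inΓ
    unfold InΓ at this ⊢
    rw [Path.it_arrows]
    exact this.infix (List.dropLast_prefix _).isInfix
  length := by
    have := h.length
    simp only [Path.length, Path.it_arrows, List.length_dropLast] at this ⊢
    omega

theorem InΓm.exists_head {m : ℕ} {γ : Path Q} (h : InΓm I (m + 1) γ) :
    ∃ c, γ.arrows.head? = some c := by
  have := h.length
  cases hl : γ.arrows with
  | nil => simp [Path.length, hl] at this
  | cons c l => exact ⟨c, rfl⟩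

theorem InΓm.exists_getLast {m : ℕ} {γ : Path Q} (h : InΓm I (m + 1) γ) :
    ∃ c, γ.arrows.getLast? = some c := by
  have := h.length
  cases hl : γ.arrows with
  | nil => simp [Path.length, hl] at this
  | cons c l => exact ⟨_, List.getLast?_eq_some_getLast (by simp)⟩

theorem inΓm_trivial (x : V) : InΓm I 0 (Path.trivial x) := ⟨List.IsChain.nil, rfl⟩

theorem InΓm.eq_trivial {γ : Path Q} (h : InΓm I 0 γ) : γ = Path.trivial γ.src :=
  Path.eq_trivial (List.length_eq_zero_iff.1 h.length)

theorem inΓm_ofArrow (c : E) : InΓm I 1 (Path.ofArrow c) := ⟨List.IsChain.singleton _, rfl⟩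

theorem InΓ.head_mem {γ : Path Q} (h : InΓ I γ) {b b' : E} (hb : γ.arrows.head? = some b)
    (hb' : γ.tl.arrows.head? = some b') : ofArrow k Q b * ofArrow k Q b' ∈ I := by
  obtain ⟨x, y, l, hl⟩ := γ
  simp only [Path.tl_arrows] at hb'
  match l with
  | [] => simp at hb
  | [c] => simp at hb'
  | c :: c' :: l =>
    simp at hb hb'
    subst hb hb'
    exact (List.isChain_cons_cons.1 h).1

theorem InΓ.getLast_mem {γ : Path Q} (h : InΓ I γ) {a a' : E} (ha : γ.arrows.getLast? = some a)
    (ha' : γ.it.arrows.getLast? = some a') : ofArrow k Q a' * ofArrow k Q a ∈ I := by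
  simp only [Path.it_arrows] at ha'
  have h₁ := List.dropLast_append_getLast? a ha
  have h₂ := List.dropLast_append_getLast? a' ha'
  unfold InΓ at h
  rw [← h₁, ← h₂, List.append_assoc] at h
  exact List.isChain_pair (R := fun b a => ofArrow k Q b * ofArrow k Q a ∈ I).1
    h.right_of_append

variable (X : Bimod k (BoundAlgebra I))

/-- The map `m ↦ e_{t(γ)} m e_{s(γ)}`. -/
noncomputable def corner (γ : Path Q) : X.M →ₗ[k] X.M :=
  X.l (pathClass I (Path.trivial γ.tgt)) ∘ₗ X.r (pathClass I (Path.trivial γ.src))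

theorem corner_apply (γ : Path Q) (m : X.M) : corner X γ m =
    X.l (pathClass I (Path.trivial γ.tgt)) (X.r (pathClass I (Path.trivial γ.src)) m) := rfl

theorem corner_corner (γ : Path Q) (m : X.M) : corner X γ (corner X γ m) = corner X γ m := by
  simp only [corner_apply]
  rw [← X.comm, ← X.r_mul, ← X.l_mul, trivial_mul_self, trivial_mul_self]

/-- Left multiplication by the last arrow of a path; zero for a trivial path. -/
noncomputable def lastAct (γ : Path Q) : X.M →ₗ[k] X.M :=
  match γ.arrows.head? with
  | none => 0
  | some b => X.l (pathClass I (Path.ofArrow b))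

/-- Right multiplication by the first arrow of a path; zero for a trivial path. -/
noncomputable def firstAct (γ : Path Q) : X.M →ₗ[k] X.M :=
  match γ.arrows.getLast? with
  | none => 0
  | some a => X.r (pathClass I (Path.ofArrow a))

theorem lastAct_of_head {γ : Path Q} {b : E} (h : γ.arrows.head? = some b) :
    lastAct X γ = X.l (pathClass I (Path.ofArrow b)) := by rw [lastAct, h]

theorem firstAct_of_getLast {γ : Path Q} {a : E} (h : γ.arrows.getLast? = some a) :
    firstAct X γ = X.r (pathClass I (Path.ofArrow a)) := by rw [firstAct, h]

/-- The map `γ ↦ c_m w(c_{m-1} ⋯ c_1) - (-1)^m w(c_m ⋯ c_2) c_1` for `γ = c_m ⋯ c_1`. -/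
noncomputable def mapD (m : ℕ) (w : Path Q → X.M) (γ : Path Q) : X.M :=
  lastAct X γ (w γ.tl) + (-1 : k) ^ (m + 1) • firstAct X γ (w γ.it)

/-- The value of `z` at a path `γ` is in `e_{t(γ)} X e_{s(γ)}`. -/
def IsCornered (z : Path Q → X.M) : Prop := ∀ γ, corner X γ (z γ) = z γ

variable {X}

theorem corner_lastAct (γ : Path Q) (m : X.M) :
    corner X γ (lastAct X γ m) = lastAct X γ (corner X γ.tl m) := by
  cases h : γ.arrows.head? with
  | none => simp [lastAct, h]
  | some b =>
    have h₁ := trivial_mul_pathClass (I := I) (Path.ofArrow b : Path Q)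
    have h₂ := pathClass_mul_trivial (I := I) (Path.ofArrow b : Path Q)
    simp only [Path.ofArrow_src, Path.ofArrow_tgt] at h₁ h₂
    rw [lastAct_of_head X h, corner_apply, corner_apply, γ.tgt_eq_head h, γ.tl_tgt h, γ.tl_src,
      ← X.comm, ← X.l_mul, ← X.l_mul, h₁, h₂]

theorem corner_firstAct (γ : Path Q) (m : X.M) :
    corner X γ (firstAct X γ m) = firstAct X γ (corner X γ.it m) := by
  cases h : γ.arrows.getLast? with
  | none => simp [firstAct, h]
  | some b =>
    have h₁ := trivial_mul_pathClass (I := I) (Path.ofArrow b : Path Q)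
    have h₂ := pathClass_mul_trivial (I := I) (Path.ofArrow b : Path Q)
    simp only [Path.ofArrow_src, Path.ofArrow_tgt] at h₁ h₂
    rw [firstAct_of_getLast X h, corner_apply, corner_apply, γ.src_eq_getLast h, γ.it_src h,
      γ.it_tgt, ← X.r_mul, h₂, ← X.comm, ← X.r_mul, h₁]

theorem IsCornered.mapD {w : Path Q → X.M} (hw : IsCornered X w) (m : ℕ) :
    IsCornered X (mapD X m w) := fun γ => by
  rw [GentleHH.mapD, map_add, map_smul, corner_lastAct, corner_firstAct, hw, hw]

theorem IsCornered.sub {z w : Path Q → X.M} (hz : IsCornered X z) (hw : IsCornered X w) :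
    IsCornered X (z - w) := fun γ => by rw [Pi.sub_apply, map_sub, hz, hw]

theorem mapD_sub (m : ℕ) (z w : Path Q → X.M) (γ : Path Q) :
    mapD X m (z - w) γ = mapD X m z γ - mapD X m w γ := by
  simp only [mapD, Pi.sub_apply, map_sub, smul_sub]; abel

theorem mapD_congr {m : ℕ} {z w : Path Q → X.M} (h : ∀ γ, InΓm I m γ → z γ = w γ) {γ : Path Q}
    (hγ : InΓm I (m + 1) γ) : mapD X m z γ = mapD X m w γ := by
  rw [mapD, mapD, h _ hγ.tl, h _ hγ.it]

theorem mapD_mapD {m : ℕ} (w : Path Q → X.M) {γ : Path Q} (hγ : InΓm I (m + 2) γ) :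
    mapD X (m + 1) (mapD X m w) γ = 0 := by
  obtain ⟨b, hb⟩ := hγ.exists_head
  obtain ⟨a, ha⟩ := hγ.exists_getLast
  obtain ⟨b', hb'⟩ := hγ.tl.exists_head
  obtain ⟨a', ha'⟩ := hγ.it.exists_getLast
  have hlen : 2 ≤ γ.length := by rw [hγ.length]; omega
  have hbt : γ.it.arrows.head? = some b := by rw [Path.head_it hlen, hb]
  have hat : γ.tl.arrows.getLast? = some a := by rw [Path.getLast_tl hlen, ha]
  simp only [mapD, lastAct_of_head X hb, lastAct_of_head X hb', lastAct_of_head X hbt,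
    firstAct_of_getLast X ha, firstAct_of_getLast X hat, firstAct_of_getLast X ha', map_add,
    map_smul, smul_add, γ.it_tl hlen, X.comm]
  rw [← X.l_mul, ofArrow_mul_ofArrow_eq_zero (hγ.inΓ.head_mem hb hb'), ← X.r_mul,
    ofArrow_mul_ofArrow_eq_zero (hγ.inΓ.getLast_mem ha ha')]
  simp [pow_succ]

variable {Y : Bimod k (BoundAlgebra I)}

theorem Bimod.IsHom.corner {φ : X.M →ₗ[k] Y.M} (hφ : Bimod.IsHom φ) (γ : Path Q) (m : X.M) :
    φ (corner X γ m) = GentleHH.corner Y γ (φ m) := by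
  rw [corner_apply, hφ.l, hφ.r, corner_apply]

theorem Bimod.IsHom.mapD {φ : X.M →ₗ[k] Y.M} (hφ : Bimod.IsHom φ) (m : ℕ) (w : Path Q → X.M)
    (γ : Path Q) : φ (mapD X m w γ) = GentleHH.mapD Y m (φ ∘ w) γ := by
  have h₁ (x) : φ (lastAct X γ x) = lastAct Y γ (φ x) := by
    unfold lastAct; split <;> simp [hφ.l]
  have h₂ (x) : φ (firstAct X γ x) = firstAct Y γ (φ x) := by
    unfold firstAct; split <;> simp [hφ.r]
  rw [GentleHH.mapD, map_add, map_smul, h₁, h₂]; rfl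

theorem IsCornered.comp {φ : X.M →ₗ[k] Y.M} (hφ : Bimod.IsHom φ) {z : Path Q → X.M}
    (hz : IsCornered X z) : IsCornered Y (φ ∘ z) := fun γ => by
  rw [Function.comp_apply, ← hφ.corner, hz]

/-! ### Restriction of Hochschild cochains -/

open Classical in
/-- The restriction of a Hochschild cochain `f` to the paths of length `m`,
`c_m ⋯ c_1 ↦ e_t f(c_m, …, c_1) e_s`. -/
noncomputable def restr {m : ℕ} (f : X.Cochain m) (γ : Path Q) : X.M :=
  if h : γ.length = m then
    corner X γ (f fun i => pathClass I (Path.ofArrow (γ.arrows.get (i.cast h.symm)))) else 0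

theorem isCornered_restr {m : ℕ} (f : X.Cochain m) : IsCornered X (restr f) := fun γ => by
  unfold restr
  split_ifs
  · rw [corner_corner]
  · rw [map_zero]

theorem restr_sub {m : ℕ} (f g : X.Cochain m) : restr (f - g) = restr f - restr g := by
  ext γ
  simp only [restr, Pi.sub_apply, sub_apply, map_sub]
  split_ifs <;> simp

theorem Bimod.IsHom.restr {φ : X.M →ₗ[k] Y.M} (hφ : Bimod.IsHom φ) {m : ℕ} (f : X.Cochain m) :
    restr (φ.compMultilinearMap f) = φ ∘ (GentleHH.restr f) := by
  ext γ
  simp only [GentleHH.restr, Function.comp_apply]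
  split_ifs
  · rw [hφ.corner]; rfl
  · rw [map_zero]

/-- Restriction is a map of complexes: consecutive arrows of a path in `Γ` have product zero in `A`,
so that only the two outer terms of the Hochschild differential remain. -/
theorem restr_d {m : ℕ} (f : X.Cochain m) {γ : Path Q} (hγ : InΓm I (m + 1) γ) :
    restr (X.d m f) γ = mapD X m (restr f) γ := by
  have hmid (j : Fin m) : f (Fin.contractNth j.castSucc (· * ·) fun i =>
      pathClass I (Path.ofArrow (γ.arrows.get (i.cast hγ.length.symm)))) = 0 := by
    refine f.map_coord_zero j ?_
    have hj : (j : ℕ) + 1 < γ.arrows.length := by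
      have := hγ.length; unfold Path.length at this; omega
    have := List.isChain_iff_getElem.1 hγ.inΓ j hj
    refine Eq.trans ?_ (ofArrow_mul_ofArrow_eq_zero this)
    simp [Fin.contractNth]
    rfl
  obtain ⟨b, hb⟩ := hγ.exists_head
  obtain ⟨a, ha⟩ := hγ.exists_getLast
  rw [restr, dif_pos hγ.length, Bimod.d_apply]
  simp only [hmid, smul_zero, Finset.sum_const_zero, add_zero, map_add, map_smul]
  rw [mapD, restr, restr, dif_pos hγ.tl.length, dif_pos hγ.it.length, ← corner_lastAct,
    ← corner_firstAct, lastAct_of_head X hb, firstAct_of_getLast X ha]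
  have h0 : γ.arrows.get (Fin.cast hγ.length.symm 0) = b := by
    rw [List.head?_eq_getElem?] at hb
    exact (List.getElem?_eq_some_iff.1 hb).2
  have hl : γ.arrows.get (Fin.cast hγ.length.symm (Fin.last m)) = a := by
    rw [List.getLast?_eq_getElem?] at ha
    rw [← (List.getElem?_eq_some_iff.1 ha).2]
    have := hγ.length
    unfold Path.length at this
    simp [this]
    rfl
  rw [h0, hl]
  congr 4
  · ext i; simp; rfl
  · congr 2; ext i; simp; rfl

end ParallelMaps

/-! ### Restriction is a quasi-isomorphism: dimension shifting -/

section Shift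

open PathAlgebra

variable {k : Type u} [Field k] {V : Type v} {E : Type w} [Fintype V] {Q : ArrowQuiver V E}
  {I : TwoSidedIdeal (PathAlgebra k Q)}

variable (X : Bimod k (BoundAlgebra I))

/-- `u` is a coboundary on `Γ_m`. -/
def IsMapCobound : ∀ (_ : ℕ) (_ : Path Q → X.M), Prop
  | 0, u => ∀ γ, InΓm I 0 γ → u γ = 0
  | m + 1, u => ∃ w, IsCornered X w ∧ ∀ γ, InΓm I (m + 1) γ → u γ = mapD X m w γ

/-- `f` is a Hochschild coboundary. -/
def IsHochCobound : ∀ {m : ℕ} (_ : X.Cochain m), Prop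
  | 0, f => f = 0
  | m + 1, f => ∃ g, X.d m g = f

/-- Restriction is surjective on the cohomology of degree `m`, for all unital bimodules. -/
def RestrSurjective (I : TwoSidedIdeal (PathAlgebra k Q)) (m : ℕ) : Prop :=
  ∀ X : Bimod k (BoundAlgebra I), X.Unital → ∀ z : Path Q → X.M, IsCornered X z →
    (∀ γ, InΓm I (m + 1) γ → mapD X m z γ = 0) →
    ∃ f : X.Cochain m, X.d m f = 0 ∧ IsMapCobound X m (restr f - z)

/-- Restriction is injective on the cohomology of degree `m`, for all unital bimodules. -/
def RestrInjective (I : TwoSidedIdeal (PathAlgebra k Q)) (m : ℕ) : Prop :=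
  ∀ X : Bimod k (BoundAlgebra I), X.Unital → ∀ f : X.Cochain m, X.d m f = 0 →
    IsMapCobound X m (restr f) → IsHochCobound X f

variable {X} {Y : Bimod k (BoundAlgebra I)}

theorem IsMapCobound.comp {φ : X.M →ₗ[k] Y.M} (hφ : Bimod.IsHom φ) {m : ℕ} {u : Path Q → X.M}
    (h : IsMapCobound X m u) : IsMapCobound Y m (φ ∘ u) := by
  cases m with
  | zero => intro γ hγ; rw [Function.comp_apply, h γ hγ, map_zero]
  | succ m =>
    obtain ⟨w, hw, e⟩ := h
    refine ⟨φ ∘ w, hw.comp hφ, fun γ hγ => ?_⟩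
    rw [Function.comp_apply, e γ hγ, hφ.mapD]

theorem IsMapCobound.congr {m : ℕ} {u u' : Path Q → X.M} (h : IsMapCobound X m u)
    (e : ∀ γ, InΓm I m γ → u' γ = u γ) : IsMapCobound X m u' := by
  cases m with
  | zero => exact fun γ hγ => (e γ hγ).trans (h γ hγ)
  | succ m =>
    obtain ⟨w, hw, h⟩ := h
    exact ⟨w, hw, fun γ hγ => (e γ hγ).trans (h γ hγ)⟩

/-- A cornered map that vanishes in the quotient of the coinduced bimodule comes from a cornered map
with values in `X`. -/
theorem exists_toCoind_eq (hX : X.Unital) {m : ℕ} {u : Path Q → X.coind.M}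
    (hu : IsCornered X.coind u) (h : ∀ γ, InΓm I m γ → Bimod.toQuot hX (u γ) = 0) :
    ∃ n : Path Q → X.M, IsCornered X n ∧ ∀ γ, InΓm I m γ → X.toCoind (n γ) = u γ := by
  classical
  refine ⟨fun γ => if InΓm I m γ then Bimod.coind.ev 1 (u γ) else 0, fun γ => ?_, fun γ hγ => ?_⟩
  · dsimp only
    split_ifs with hγ
    · have h₁ := Bimod.toCoind_ev_one hX (h γ hγ)
      have h₂ := hu γ
      rw [← h₁, ← (Bimod.isHom_toCoind X).corner] at h₂
      have h₃ := congrArg (Bimod.coind.ev 1) h₂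
      rwa [Bimod.ev_toCoind, Bimod.ev_toCoind, hX.l_one, hX.l_one] at h₃
    · rw [map_zero]
  · dsimp only
    rw [if_pos hγ, Bimod.toCoind_ev_one hX (h γ hγ)]

theorem exists_toCoind_eq_cochain (hX : X.Unital) {m : ℕ} {f : X.coind.Cochain m}
    (h : (Bimod.toQuot hX).compMultilinearMap f = 0) :
    ∃ g : X.Cochain m, X.toCoind.compMultilinearMap g = f := by
  refine ⟨(Bimod.coind.ev 1).compMultilinearMap f, ?_⟩
  ext x
  exact Bimod.toCoind_ev_one hX (congrFun (congrArg DFunLike.coe h) x)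

theorem toCoind_injective (hX : X.Unital) : Function.Injective X.toCoind := fun m n e => by
  have := congrArg (Bimod.coind.ev 1) e
  rwa [Bimod.ev_toCoind, Bimod.ev_toCoind, hX.l_one, hX.l_one] at this

/-- A coboundary with values in the quotient of the coinduced bimodule lifts to a coboundary. -/
theorem IsMapCobound.exists_lift (hX : X.Unital) {m : ℕ} {u : Path Q → (X.quot hX).M}
    (h : IsMapCobound (X.quot hX) m u) :
    ∃ w : Path Q → X.coind.M, IsCornered X.coind w ∧
      (∀ γ, InΓm I m γ → Bimod.toQuot hX (w γ) = u γ) ∧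
      ∀ γ, InΓm I (m + 1) γ → mapD X.coind m w γ = 0 := by
  cases m with
  | zero =>
    refine ⟨0, fun γ => by simp, fun γ hγ => ?_, fun γ hγ => ?_⟩
    · rw [h γ hγ]; simp
    · simp [mapD]
  | succ m =>
    obtain ⟨w, hw, e⟩ := h
    let w' : Path Q → X.coind.M := fun γ => corner X.coind γ (Bimod.quotLift hX (w γ))
    have hw' : IsCornered X.coind w' := fun γ => corner_corner _ _ _
    have hq : Bimod.toQuot hX ∘ w' = w := by
      ext γ
      rw [Function.comp_apply, (Bimod.isHom_toQuot hX).corner, Bimod.toQuot_quotLift, hw]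
    refine ⟨mapD X.coind m w', hw'.mapD m, fun γ hγ => ?_, fun γ hγ => mapD_mapD _ hγ⟩
    rw [(Bimod.isHom_toQuot hX).mapD, hq, e γ hγ]

/-- On `Γ`, the cocycles of degree `m + 1` with values in a coinduced bimodule are coboundaries. -/
def CoindAcyclic (I : TwoSidedIdeal (PathAlgebra k Q)) (m : ℕ) : Prop :=
  ∀ X : Bimod k (BoundAlgebra I), X.Unital → ∀ z : Path Q → X.coind.M, IsCornered X.coind z →
    (∀ γ, InΓm I (m + 2) γ → mapD X.coind (m + 1) z γ = 0) → IsMapCobound X.coind (m + 1) z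

/-- The coinduced bimodule is acyclic, so that every class in degree `m + 1` on `Γ` comes from a
class in degree `m` with values in its quotient by `X`, which by hypothesis is a restriction. -/
theorem RestrSurjective.succ {m : ℕ} (h : RestrSurjective I m) (hac : CoindAcyclic I m) :
    RestrSurjective I (m + 1) := by
  intro X hX z hz hd
  have hc := Bimod.isHom_toCoind X
  have hq := Bimod.isHom_toQuot hX
  -- in the coinduced bimodule, `z` is the coboundary of `y`, which is a cocycle in the quotient
  obtain ⟨y, hy, hyz⟩ := hac X hX (X.toCoind ∘ z) (hz.comp hc) (fun γ hγ => by
    rw [← hc.mapD, hd γ hγ, map_zero])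
  obtain ⟨f', hf', hb⟩ := h (X.quot hX) hX.quot (Bimod.toQuot hX ∘ y) (hy.comp hq) (fun γ hγ => by
    rw [← hq.mapD, ← hyz γ hγ, Function.comp_apply, Bimod.toQuot_toCoind])
  -- `e` is the image of the class of `f'` under the connecting homomorphism
  let f := (Bimod.quotLift hX).compMultilinearMap f'
  have hf : (Bimod.toQuot hX).compMultilinearMap f = f' := by
    ext x; exact Bimod.toQuot_quotLift hX _
  obtain ⟨e, he⟩ := exists_toCoind_eq_cochain hX (f := X.coind.d m f) (by
    rw [← hq.d_comp, hf, hf'])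
  obtain ⟨v', hv', hv'q, hv'd⟩ := hb.exists_lift
  -- `v` takes its values in `X`, and its differential is that of `restr f - y`
  let v := restr f - y - v'
  have hv : IsCornered X.coind v := ((isCornered_restr f).sub hy).sub hv'
  obtain ⟨n, hn, hnv⟩ := exists_toCoind_eq (m := m) hX hv (fun γ hγ => by
    simp only [v, Pi.sub_apply, map_sub, hv'q γ hγ]
    have := congrFun (hq.restr f) γ
    rw [hf, Function.comp_apply] at this
    rw [← this, Function.comp_apply, sub_self])
  refine ⟨e, ?_, n, hn, fun γ hγ => ?_⟩
  · have : X.toCoind.compMultilinearMap (X.d (m + 1) e) = 0 := by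
      rw [← hc.d_comp, he, Bimod.d_d]
    ext x
    refine toCoind_injective hX ?_
    rw [zero_apply, map_zero]
    exact congrFun (congrArg DFunLike.coe this) x
  · refine toCoind_injective hX ?_
    rw [hc.mapD, mapD_congr (z := X.toCoind ∘ n) (w := v) hnv hγ, mapD_sub, mapD_sub, hv'd γ hγ,
      ← hyz γ hγ, ← restr_d f hγ, ← he, hc.restr]
    simp

/-- A diagram chase in the long exact sequences of `0 → X → X.coind → X.quot → 0`. -/
theorem RestrInjective.succ {m : ℕ} (h : RestrInjective I m) (hs : RestrSurjective I m) :
    RestrInjective I (m + 1) := by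
  rintro X hX f hf ⟨w, hw, hwf⟩
  have hc := Bimod.isHom_toCoind X
  have hq := Bimod.isHom_toQuot hX
  -- in the coinduced bimodule, the Hochschild cocycle `f` is the coboundary of `g`
  let g : X.coind.Cochain m := Bimod.curry f
  have hg : X.coind.d m g = X.toCoind.compMultilinearMap f := by
    ext y
    refine Bimod.coind.ext fun x => ?_
    have := Bimod.d_cons f x y
    rw [hf, zero_apply] at this
    exact (sub_eq_zero.1 this.symm).symm
  -- the cocycle `restr g - w` is, up to coboundaries, the restriction of a Hochschild cocycle `n`
  obtain ⟨n, hn, hb⟩ := hs X.coind hX.coind (restr g - X.toCoind ∘ w)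
    ((isCornered_restr g).sub (hw.comp hc)) (fun γ hγ => by
      rw [mapD_sub, ← restr_d g hγ, hg, hc.restr, ← hc.mapD, ← hwf γ hγ, Function.comp_apply,
        sub_self])
  have hgq : (Bimod.toQuot hX).compMultilinearMap (X.toCoind.compMultilinearMap f) = 0 := by
    ext x; exact Bimod.toQuot_toCoind hX _
  -- in the quotient `n - g` is a cocycle whose restriction is a coboundary, hence a coboundary
  have hcb := h (X.quot hX) hX.quot ((Bimod.toQuot hX).compMultilinearMap (n - g))
    (by rw [hq.d_comp, map_sub, hn, zero_sub, hg, ← neg_eq_zero, ← hgq]; ext x; simp)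
    ((hb.comp hq).congr fun γ _ => by
      rw [hq.restr, restr_sub]
      simp [Bimod.toQuot_toCoind])
  obtain ⟨q, hqd, hqe⟩ : ∃ q : X.coind.Cochain m, X.coind.d m q = 0 ∧
      (Bimod.toQuot hX).compMultilinearMap q =
        (Bimod.toQuot hX).compMultilinearMap (n - g) := by
    cases m with
    | zero => exact ⟨0, map_zero _, by
        rw [show (Bimod.toQuot hX).compMultilinearMap (n - g) = 0 from hcb]; ext x; simp⟩
    | succ m =>
      obtain ⟨q, hq'⟩ := hcb
      refine ⟨X.coind.d m ((Bimod.quotLift hX).compMultilinearMap q), Bimod.d_d _, ?_⟩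
      rw [← hq.d_comp, ← hq']
      congr 1
      ext x; exact Bimod.toQuot_quotLift hX _
  -- the difference of `n - g` and a cocycle `q` that lifts its image takes its values in `X`
  obtain ⟨e, he⟩ := exists_toCoind_eq_cochain hX (f := q - (n - g)) (by
    rw [← sub_eq_zero] at hqe
    rw [← hqe]; ext x; simp)
  refine ⟨e, ?_⟩
  have : X.toCoind.compMultilinearMap (X.d m e) = X.toCoind.compMultilinearMap f := by
    rw [← hc.d_comp, he, map_sub, map_sub, hqd, hn, hg]
    simp
  ext x
  exact toCoind_injective hX (congrFun (congrArg DFunLike.coe this) x)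

/-! ### Degree zero -/

theorem Bimod.Unital.sum_l {X : Bimod k (BoundAlgebra I)} (hX : X.Unital) (m : X.M) :
    ∑ x : V, X.l (pathClass I (Path.trivial x)) m = m := by
  rw [← LinearMap.sum_apply, ← map_sum, ← one_eq_sum_pathClass, hX.l_one]

/-- The components of a central element at the vertices determine it. -/
theorem restrInjective_zero : RestrInjective I 0 := by
  intro X hX f hf h
  ext x
  have hc (a : BoundAlgebra I) : X.l a (f ![]) = X.r a (f ![]) := by
    have := congrFun (congrArg DFunLike.coe hf) ![a]
    rw [Bimod.d_apply] at this
    simp only [Finset.univ_eq_empty, Finset.sum_empty, add_zero, zero_apply] at this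
    have h (y : Fin 0 → BoundAlgebra I) : f y = f ![] := congrArg f (Subsingleton.elim _ _)
    simp only [h] at this
    simpa [← sub_eq_add_neg, sub_eq_zero] using this
  have h0 : f x = f ![] := congrArg f (Subsingleton.elim _ _)
  rw [h0, ← hX.sum_l (f ![])]
  refine Finset.sum_eq_zero fun y _ => ?_
  have := h (Path.trivial y) (inΓm_trivial y)
  rw [restr, dif_pos (inΓm_trivial (I := I) y).length, corner_apply] at this
  rw [← trivial_mul_self, X.l_mul, hc]
  refine Eq.trans ?_ this
  congr 3
  exact Subsingleton.elim _ _

theorem pathClass_eq_ofArrow_mul {p : Path Q} {c : E} (h : p.arrows.head? = some c) :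
    pathClass I p = pathClass I (Path.ofArrow c) * pathClass I p.tl := by
  obtain ⟨hs, e⟩ := p.eq_cons h
  rw [pathClass_mul I _ _ hs, ← e]

theorem pathClass_eq_mul_ofArrow {p : Path Q} {c : E} (h : p.arrows.getLast? = some c) :
    pathClass I p = pathClass I p.it * pathClass I (Path.ofArrow c) := by
  obtain ⟨hs, e⟩ := p.eq_concat h
  rw [pathClass_mul I _ _ hs, ← e]

/-- An element of a bimodule commutes with `A` if it commutes with the vertices and the arrows. -/
theorem IsGentle.commutes (hI : IsGentle I) {X : Bimod k (BoundAlgebra I)} {m : X.M}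
    (h₀ : ∀ x : V, X.l (pathClass I (Path.trivial x)) m = X.r (pathClass I (Path.trivial x)) m)
    (h₁ : ∀ c : E, X.l (pathClass I (Path.ofArrow c)) m = X.r (pathClass I (Path.ofArrow c)) m)
    (a : BoundAlgebra I) : X.l a m = X.r a m := by
  refine LinearMap.congr_fun (f := X.l.flip m) (g := X.r.flip m) (hI.linearMap_ext ?_) a
  rintro p -
  simp only [LinearMap.flip_apply]
  generalize hl : p.arrows = l
  induction l generalizing p with
  | nil => rw [Path.eq_trivial hl, h₀]
  | cons c l ih =>
    rw [pathClass_eq_ofArrow_mul (c := c) (by simp [hl]), X.l_mul, X.r_mul,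
      ih p.tl (by simp [hl]), X.comm, h₁]

theorem IsGentle.restrSurjective_zero (hI : IsGentle I) : RestrSurjective I 0 := by
  intro X hX z hz hd
  classical
  have hl (x y : V) : X.l (pathClass I (Path.trivial x)) (z (Path.trivial y)) =
      if x = y then z (Path.trivial y) else 0 := by
    rw [← hz (Path.trivial y), corner_apply, Path.trivial_tgt, ← X.l_mul]
    split_ifs with h
    · rw [h, trivial_mul_self]
    · rw [trivial_mul_trivial_of_ne h, map_zero, LinearMap.zero_apply]
  have hr (x y : V) : X.r (pathClass I (Path.trivial x)) (z (Path.trivial y)) =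
      if x = y then z (Path.trivial y) else 0 := by
    rw [← hz (Path.trivial y), corner_apply, Path.trivial_src, ← X.comm, ← X.r_mul]
    split_ifs with h
    · rw [h, trivial_mul_self]
    · rw [trivial_mul_trivial_of_ne (Ne.symm h), map_zero, LinearMap.zero_apply, map_zero]
  -- the cocycle condition at the arrows says that the sum of the values commutes with the arrows
  let F : X.M := ∑ y : V, z (Path.trivial y)
  have hF : ∀ a, X.l a F = X.r a F := by
    refine fun a => hI.commutes (fun x => ?_) (fun c => ?_) a
    · simp only [F, map_sum, hl, hr]
    · have h₁ := pathClass_mul_trivial (I := I) (Path.ofArrow c : Path Q)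
      have h₂ := trivial_mul_pathClass (I := I) (Path.ofArrow c : Path Q)
      have hlF (x : V) : X.l (pathClass I (Path.trivial x)) F = z (Path.trivial x) := by
        simp [F, map_sum, hl]
      have hrF (x : V) : X.r (pathClass I (Path.trivial x)) F = z (Path.trivial x) := by
        simp [F, map_sum, hr]
      have h := hd _ (inΓm_ofArrow c)
      have e₁ : (Path.ofArrow c : Path Q).tl = Path.trivial (Q.s c) := Path.ext_tgt
        (by rw [Path.tl_tgt (c := c)]; rfl; rfl) (by simp)
      have e₂ : (Path.ofArrow c : Path Q).it = Path.trivial (Q.t c) := Path.ext_src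
        (by rw [Path.it_src (c := c)]; rfl; rfl) (by simp)
      rw [mapD, lastAct_of_head X (b := c) rfl, firstAct_of_getLast X (a := c) rfl, e₁, e₂] at h
      have hlc : X.l (pathClass I (Path.ofArrow c)) F =
          X.l (pathClass I (Path.ofArrow c)) (z (Path.trivial (Q.s c))) := by
        conv_lhs => rw [← h₁, X.l_mul, Path.ofArrow_src, hlF]
      have hrc : X.r (pathClass I (Path.ofArrow c)) F =
          X.r (pathClass I (Path.ofArrow c)) (z (Path.trivial (Q.t c))) := by
        conv_lhs => rw [← h₂, X.r_mul, Path.ofArrow_tgt, hrF]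
      rw [hlc, hrc]
      simpa [← sub_eq_add_neg, sub_eq_zero] using h
  refine ⟨MultilinearMap.constOfIsEmpty k _ F, ?_, fun γ hγ => ?_⟩
  · ext x
    rw [Bimod.d_apply]
    simp [hF, Fin.last]
  · obtain ⟨x, rfl⟩ : ∃ x, γ = Path.trivial x := ⟨_, hγ.eq_trivial⟩
    rw [Pi.sub_apply, restr, dif_pos hγ.length, MultilinearMap.constOfIsEmpty_apply,
      sub_eq_zero, corner_apply, X.comm]
    simp [F, map_sum, hl, hr]

end Shift

/-! ### Coinduced bimodules are acyclic for the complex of maps from `Γ` -/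

section Acyclic

open PathAlgebra

variable {k : Type u} [Field k] {V : Type v} {E : Type w} [Fintype V] {Q : ArrowQuiver V E}
  {I : TwoSidedIdeal (PathAlgebra k Q)} {X : Bimod k (BoundAlgebra I)}

/-- The map `γ ↦ (p ↦ val γ p)` with values in the coinduced bimodule, made cornered. -/
noncomputable def coindOfVal (hI : IsGentle I) (val : Path Q → Path Q → X.M) (γ : Path Q) :
    X.coind.M :=
  corner X.coind γ (Bimod.coind.of (hI.basisB.constr k fun p => val γ p.1))

theorem isCornered_coindOfVal (hI : IsGentle I) (val : Path Q → Path Q → X.M) :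
    IsCornered X.coind (coindOfVal hI val) := fun _ => corner_corner _ _ _

theorem ev_coindOfVal (hI : IsGentle I) (val : Path Q → Path Q → X.M) {γ p : Path Q}
    (hp : InB I p) (h : p.src = γ.tgt) : Bimod.coind.ev (pathClass I p) (coindOfVal hI val γ) =
      X.r (pathClass I (Path.trivial γ.src)) (val γ p) := by
  rw [coindOfVal, corner_apply, Bimod.coind.ev_l, ← h, pathClass_mul_trivial, Bimod.coind.ev_r,
    Bimod.coind.ev_of, ← hI.basisB_apply ⟨p, hp⟩, Module.Basis.constr_basis]

theorem IsCornered.ev_eq_zero {w : Path Q → X.coind.M} (hw : IsCornered X.coind w) {γ p : Path Q}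
    (h : p.src ≠ γ.tgt) : Bimod.coind.ev (pathClass I p) (w γ) = 0 := by
  rw [← hw, corner_apply, Bimod.coind.ev_l, pathClass_mul_of_ne, Bimod.coind.ev_zero]
  exact h

theorem IsCornered.r_ev {w : Path Q → X.coind.M} (hw : IsCornered X.coind w) (γ : Path Q)
    (x : BoundAlgebra I) : X.r (pathClass I (Path.trivial γ.src)) (Bimod.coind.ev x (w γ)) =
      Bimod.coind.ev x (w γ) := by
  conv_rhs => rw [← hw, corner_apply, X.coind.comm, Bimod.coind.ev_r]
  conv_lhs => rw [← hw, corner_apply, X.coind.comm, Bimod.coind.ev_r, ← X.r_mul, trivial_mul_self]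

theorem coind_ext_pathClass (hI : IsGentle I) {φ ψ : X.coind.M}
    (h : ∀ p, InB I p → Bimod.coind.ev (pathClass I p) φ = Bimod.coind.ev (pathClass I p) ψ) :
    φ = ψ := by
  refine Bimod.coind.ext fun x => ?_
  have : Bimod.coind.toMap φ = Bimod.coind.toMap ψ := hI.linearMap_ext h
  exact LinearMap.congr_fun this x

theorem InΓm.cons {m : ℕ} {γ : Path Q} (h : InΓm I (m + 1) γ) {b c : E}
    (hc : γ.arrows.head? = some c) (hbc : ofArrow k Q b * ofArrow k Q c ∈ I)
    (hb : (Path.ofArrow b : Path Q).src = γ.tgt) :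
    InΓm I (m + 2) ((Path.ofArrow b).comp γ hb) where
  inΓ := by
    unfold InΓ
    rw [Path.comp_arrows, Path.ofArrow_arrows, List.singleton_append, List.isChain_cons]
    refine ⟨fun y hy => ?_, h.inΓ⟩
    rw [hc] at hy
    cases hy
    exact hbc
  length := by
    have := h.length
    simp only [Path.length, Path.comp_arrows, List.length_append, Path.ofArrow_arrows,
      List.length_singleton] at this ⊢
    omega

theorem InB.concat {p : Path Q} (h : InB I p) {c : E} (hc : p.src = (Path.ofArrow c : Path Q).tgt)
    (h' : ∀ b, p.arrows.getLast? = some b → ofArrow k Q b * ofArrow k Q c ∉ I) :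
    InB I (p.comp (Path.ofArrow c) hc) := by
  unfold InB
  rw [Path.comp_arrows, Path.ofArrow_arrows, List.isChain_append]
  refine ⟨h, List.isChain_singleton _, fun b hb d hd => ?_⟩
  simp only [List.head?_cons, Option.mem_def, Option.some.injEq] at hd
  subst hd
  exact h' b hb

theorem InB.getLast_notMem {p : Path Q} {c : E} {hc : p.src = (Path.ofArrow c : Path Q).tgt}
    (h : InB I (p.comp (Path.ofArrow c) hc)) {b : E} (hb : p.arrows.getLast? = some b) :
    ofArrow k Q b * ofArrow k Q c ∉ I := by
  unfold InB at h
  rw [Path.comp_arrows, Path.ofArrow_arrows, List.isChain_append] at h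
  exact h.2.2 b hb c rfl

theorem InB.it {p : Path Q} (h : InB I p) : InB I p.it :=
  h.infix I (by rw [Path.it_arrows]; exact (List.dropLast_prefix _).isInfix)

theorem InB.tl {p : Path Q} (h : InB I p) : InB I p.tl :=
  h.infix I (by rw [Path.tl_arrows]; exact (List.tail_suffix _).isInfix)

open Classical in
/-- The values of the contraction in positive degrees: a factor `b` is moved from the path `p`,
an element of the coinduced bimodule being evaluated at it, to `γ`. -/
noncomputable def contrVal (z : Path Q → X.coind.M) (γ p : Path Q) : X.M :=
  match p.arrows.getLast? with
  | none => 0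
  | some b => if h : (Path.ofArrow b : Path Q).src = γ.tgt ∧
      ∀ c, γ.arrows.head? = some c → ofArrow k Q b * ofArrow k Q c ∈ I then
    Bimod.coind.ev (pathClass I p.it) (z ((Path.ofArrow b).comp γ h.1)) else 0

/-- The map `contrVal` is a contracting homotopy in positive degrees. -/
theorem IsGentle.coindAcyclic_succ (hI : IsGentle I) (m : ℕ) : CoindAcyclic I (m + 1) := by
  intro X hX z hz hd
  let y := coindOfVal hI (contrVal z)
  have hy : IsCornered X.coind y := isCornered_coindOfVal hI _
  refine ⟨y, hy, fun γ hγ => coind_ext_pathClass hI fun p hp => ?_⟩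
  by_cases hpγ : p.src = γ.tgt
  swap
  · rw [hz.ev_eq_zero hpγ, (hy.mapD _).ev_eq_zero hpγ]
  obtain ⟨c, hc⟩ := hγ.exists_head
  obtain ⟨a, ha⟩ := hγ.exists_getLast
  have hlen : 2 ≤ γ.length := by rw [hγ.length]; omega
  have hci : γ.it.arrows.head? = some c := by rw [Path.head_it hlen, hc]
  have hpc : p.src = (Path.ofArrow c : Path Q).tgt := hpγ.trans (γ.tgt_eq_head hc)
  have hpit : p.src = γ.it.tgt := by rw [hpγ, γ.it_tgt]
  rw [mapD, lastAct_of_head _ hc, firstAct_of_getLast _ ha, map_add, map_smul, Bimod.coind.ev_l,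
    Bimod.coind.ev_r, pathClass_mul _ _ _ hpc]
  have hsrc := γ.it_src ha
  have hra (x : X.M) : X.r (pathClass I (Path.ofArrow a))
      (X.r (pathClass I (Path.trivial γ.it.src)) x) = X.r (pathClass I (Path.ofArrow a)) x := by
    rw [← X.r_mul, hsrc]
    have := trivial_mul_pathClass (I := I) (Path.ofArrow a : Path Q)
    rw [Path.ofArrow_tgt] at this
    rw [this]
  rw [ev_coindOfVal hI _ hp hpit, hra]
  -- either `p c` is in `B`, and then the term of the last arrow gives the value of `z`, or `p` ends
  -- in an arrow `b` with `b γ` in `Γ`, and the cocycle condition at `b γ` gives it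
  by_cases hB : InB I (p.comp (Path.ofArrow c) hpc)
  · have hcs : (Path.ofArrow c : Path Q).src = γ.tl.tgt := (γ.tl_tgt hc).symm
    have h₂ : contrVal z γ.it p = 0 := by
      unfold contrVal
      split
      · rfl
      · next b hb =>
        rw [dif_neg]
        rintro ⟨h₁, h₂⟩
        exact hB.getLast_notMem hb (h₂ c hci)
    have h₁ : contrVal z γ.tl (p.comp (Path.ofArrow c) hpc) =
        Bimod.coind.ev (pathClass I p) (z γ) := by
      unfold contrVal
      have hl : (p.comp (Path.ofArrow c) hpc).arrows.getLast? = some c := by simp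
      rw [hl]
      dsimp only
      rw [dif_pos ⟨hcs, fun c' hc' => hγ.inΓ.head_mem hc hc'⟩, Path.it_concat]
      obtain ⟨_, he⟩ := γ.eq_cons hc
      rw [← he]
    rw [h₂, map_zero, smul_zero, add_zero,
      ev_coindOfVal hI _ hB (by rw [← hcs]; rfl), h₁, γ.tl_src, hz.r_ev]
  · rw [pathClass_eq_zero_of_not_inB I hB, Bimod.coind.ev_zero, zero_add]
    obtain ⟨b, hb, hbc⟩ : ∃ b, p.arrows.getLast? = some b ∧
        ofArrow k Q b * ofArrow k Q c ∈ I := by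
      by_contra! h
      exact hB (hp.concat hpc h)
    have hbγ : (Path.ofArrow b : Path Q).src = γ.tgt := (p.src_eq_getLast hb).symm.trans hpγ
    have hbγ' : (Path.ofArrow b : Path Q).src = γ.it.tgt := by rw [hbγ, γ.it_tgt]
    have hne : γ.arrows ≠ [] := by rintro h; simp [h] at hc
    have h := congrArg (Bimod.coind.ev (pathClass I p.it)) (hd _ (hγ.cons hc hbc hbγ))
    rw [mapD, lastAct_of_head _ (b := b) rfl, firstAct_of_getLast _ (a := a) (by
        rw [Path.comp_arrows, List.getLast?_append_of_ne_nil _ hne, ha]), map_add, map_smul,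
      Bimod.coind.ev_l, Bimod.coind.ev_r, ← pathClass_eq_mul_ofArrow hb, Path.tl_cons,
      Path.it_cons hbγ hbγ' hne, map_zero] at h
    have h₁ : contrVal z γ.it p =
        Bimod.coind.ev (pathClass I p.it) (z ((Path.ofArrow b).comp γ.it hbγ')) := by
      unfold contrVal
      rw [hb]
      dsimp only
      rw [dif_pos ⟨hbγ', fun c' hc' => by rw [hci] at hc'; cases hc'; exact hbc⟩]
    rw [h₁, eq_neg_of_add_eq_zero_left h, ← neg_smul]
    congr 1
    ring

/-- The contraction in degree zero, on the trivial path at `s(p)`: the sum of the terms obtained by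
splitting off an arrow of `p`. -/
noncomputable def contrValZero (z : Path Q → X.coind.M) : ∀ (_ : ℕ) (_ : Path Q), X.M
  | 0, _ => 0
  | n + 1, p => match p.arrows.getLast? with
    | none => 0
    | some b => Bimod.coind.ev (pathClass I p.it) (z (Path.ofArrow b)) +
        X.r (pathClass I (Path.ofArrow b)) (contrValZero z n p.it)

/-- The map `contrValZero` is a contracting homotopy from degree one to degree zero. -/
theorem IsGentle.coindAcyclic_zero (hI : IsGentle I) : CoindAcyclic I 0 := by
  intro X hX z hz hd
  let val : Path Q → X.M := fun p => contrValZero z p.length p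
  let y := coindOfVal hI fun _ => val
  have hy : IsCornered X.coind y := isCornered_coindOfVal hI _
  have hval {p : Path Q} {b : E} (hb : p.arrows.getLast? = some b) : val p =
      Bimod.coind.ev (pathClass I p.it) (z (Path.ofArrow b)) +
        X.r (pathClass I (Path.ofArrow b)) (val p.it) := by
    have : p.length = p.it.length + 1 := by
      simp only [Path.length, Path.it_arrows, List.length_dropLast]
      cases h : p.arrows with
      | nil => simp [h] at hb
      | cons c l => simp
    simp only [val]
    rw [this, contrValZero, hb]
  refine ⟨y, hy, fun γ hγ => coind_ext_pathClass hI fun p hp => ?_⟩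
  by_cases hpγ : p.src = γ.tgt
  swap
  · rw [hz.ev_eq_zero hpγ, (hy.mapD _).ev_eq_zero hpγ]
  obtain ⟨c, rfl⟩ : ∃ c, γ = Path.ofArrow c := by
    obtain ⟨c, hc⟩ := List.length_eq_one_iff.1 hγ.length
    exact ⟨c, Path.eq_ofArrow hc⟩
  have hpit : p.src = (Path.ofArrow c : Path Q).it.tgt := by rw [hpγ, Path.it_tgt]
  rw [mapD, lastAct_of_head _ (b := c) rfl, firstAct_of_getLast _ (a := c) rfl, map_add, map_smul,
    Bimod.coind.ev_l, Bimod.coind.ev_r, pathClass_mul _ _ _ hpγ]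
  have hra (x : X.M) : X.r (pathClass I (Path.ofArrow c))
      (X.r (pathClass I (Path.trivial (Path.ofArrow c : Path Q).it.src)) x) =
        X.r (pathClass I (Path.ofArrow c)) x := by
    rw [← X.r_mul, Path.it_src (c := c) _ rfl]
    have := trivial_mul_pathClass (I := I) (Path.ofArrow c : Path Q)
    rw [Path.ofArrow_tgt] at this
    rw [this]
  rw [ev_coindOfVal hI _ hp hpit, hra]
  -- if `p c` is in `B`, the two sums differ in the term for the arrow `c` only; otherwise
  -- `p = p' b` with `b c` in `Γ`, and the cocycle condition at `b c` applies
  by_cases hB : InB I (p.comp (Path.ofArrow c) hpγ)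
  · have hl : (p.comp (Path.ofArrow c) hpγ).arrows.getLast? = some c := by simp
    have hs : (p.comp (Path.ofArrow c) hpγ).src = (Path.ofArrow c : Path Q).tl.tgt :=
      (Path.tl_tgt (c := c) _ rfl).symm
    rw [ev_coindOfVal hI _ hB hs, hval hl, Path.it_concat, Path.tl_src, map_add, hz.r_ev, ← X.r_mul,
      pathClass_mul_trivial]
    simp
  · rw [pathClass_eq_zero_of_not_inB I hB, Bimod.coind.ev_zero, zero_add]
    obtain ⟨b, hb, hbc⟩ : ∃ b, p.arrows.getLast? = some b ∧
        ofArrow k Q b * ofArrow k Q c ∈ I := by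
      by_contra! h
      exact hB (hp.concat hpγ h)
    have hbγ : (Path.ofArrow b : Path Q).src = (Path.ofArrow c : Path Q).tgt :=
      (p.src_eq_getLast hb).symm.trans hpγ
    have h := congrArg (Bimod.coind.ev (pathClass I p.it)) (hd _ (hγ.cons rfl hbc hbγ))
    rw [mapD, lastAct_of_head _ (b := b) rfl, firstAct_of_getLast _ (a := c) rfl, map_add, map_smul,
      Bimod.coind.ev_l, Bimod.coind.ev_r, ← pathClass_eq_mul_ofArrow hb, Path.tl_cons,
      Path.it_concat, map_zero] at h
    rw [hval hb, map_add, ← X.r_mul, ofArrow_mul_ofArrow_eq_zero hbc, map_zero,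
      LinearMap.zero_apply, add_zero, eq_neg_of_add_eq_zero_left h]
    simp

/-- Restriction to `Γ` induces a bijection in cohomology, for all unital bimodules. -/
theorem IsGentle.restr_bijective (hI : IsGentle I) (m : ℕ) :
    RestrSurjective I m ∧ RestrInjective I m := by
  induction m with
  | zero => exact ⟨hI.restrSurjective_zero, restrInjective_zero⟩
  | succ m ih =>
    refine ⟨ih.1.succ ?_, ih.2.succ ih.1⟩
    cases m with
    | zero => exact hI.coindAcyclic_zero
    | succ m => exact hI.coindAcyclic_succ m

end Acyclic

/-! ### The complex of parallel paths as a complex of maps from `Γ` to `A` -/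

section CohomologyEquiv

variable {k : Type u} [Field k] {C D : ℕ → Type*} [∀ m, AddCommGroup (C m)] [∀ m, Module k (C m)]
  [∀ m, AddCommGroup (D m)] [∀ m, Module k (D m)]

/-- A linear map between the spaces of cochains of degree `m` of two complexes, which maps cocycles
to cocycles, under which exactly the coboundaries are mapped to coboundaries, and which hits all
cocycles up to coboundaries, induces an isomorphism of cohomology spaces. -/
noncomputable def cohomologyEquiv (d : ∀ m, C m →ₗ[k] C (m + 1)) (d' : ∀ m, D m →ₗ[k] D (m + 1))
    {m : ℕ} (R : C m →ₗ[k] D m) (hR : ∀ f ∈ LinearMap.ker (d m), R f ∈ LinearMap.ker (d' m))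
    (hmem : ∀ f, d m f = 0 → (R f ∈ coboundaries d' m ↔ f ∈ coboundaries d m))
    (hsurj : ∀ z, d' m z = 0 → ∃ f, d m f = 0 ∧ R f - z ∈ coboundaries d' m) :
    Cohomology d m ≃ₗ[k] Cohomology d' m :=
  LinearEquiv.ofBijective
    (Submodule.mapQ ((coboundaries d m).submoduleOf _) ((coboundaries d' m).submoduleOf _)
      (R.restrict (p := LinearMap.ker (d m)) (q := LinearMap.ker (d' m)) hR)
      fun f hf => (hmem f.1 f.2).2 hf) (by
    constructor
    · refine (injective_iff_map_eq_zero _).2 fun x => ?_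
      obtain ⟨f, rfl⟩ := Submodule.Quotient.mk_surjective _ x
      intro h
      exact (Submodule.Quotient.mk_eq_zero _).2 ((hmem f.1 f.2).1
        ((Submodule.Quotient.mk_eq_zero ((coboundaries d' m).submoduleOf _)).1 h))
    · intro x
      obtain ⟨z, rfl⟩ := Submodule.Quotient.mk_surjective _ x
      obtain ⟨f, hf, h⟩ := hsurj z.1 z.2
      refine ⟨Submodule.Quotient.mk ⟨f, hf⟩, ?_⟩
      exact (Submodule.Quotient.eq ((coboundaries d' m).submoduleOf _)).2 h)

end CohomologyEquiv

section Coordinates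

open PathAlgebra

variable {k : Type u} [Field k] {V : Type v} {E : Type w} [Fintype V] {Q : ArrowQuiver V E}
  {I : TwoSidedIdeal (PathAlgebra k Q)}

open Classical in
theorem IsGentle.coef_ofArrow_mul (hI : IsGentle I) {α : Path Q} (hα : InB I α) (c : E)
    (a : BoundAlgebra I) : hI.coef α (pathClass I (Path.ofArrow c) * a) =
      if α.arrows.head? = some c then hI.coef α.tl a else 0 := by
  have : hI.coef α ∘ₗ LinearMap.mulLeft k (pathClass I (Path.ofArrow c)) =
      if α.arrows.head? = some c then hI.coef α.tl else 0 := by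
    refine hI.linearMap_ext fun p hp => ?_
    rw [LinearMap.comp_apply, LinearMap.mulLeft_apply]
    by_cases h : (Path.ofArrow c : Path Q).src = p.tgt
    · rw [pathClass_mul _ _ _ h, hI.coef_pathClass]
      by_cases hc : α.arrows.head? = some c
      · rw [if_pos hc, hI.coef_pathClass]
        obtain ⟨h', e⟩ := α.eq_cons hc
        have : α = (Path.ofArrow c).comp p h ↔ α.tl = p :=
          ⟨fun e' => by rw [e', Path.tl_cons], fun e' => by subst e'; exact e⟩
        simp only [this, hα, hα.tl]
      · rw [if_neg hc, if_neg, LinearMap.zero_apply]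
        rintro ⟨rfl, -⟩
        exact hc rfl
    · rw [pathClass_mul_of_ne _ _ _ h, map_zero]
      split_ifs with hc
      · rw [hI.coef_pathClass, if_neg]
        rintro ⟨rfl, -⟩
        exact h (α.tl_tgt hc).symm
      · rfl
  have h := LinearMap.congr_fun this a
  rw [LinearMap.comp_apply, LinearMap.mulLeft_apply] at h
  rw [h]
  split_ifs <;> rfl

open Classical in
theorem IsGentle.coef_mul_ofArrow (hI : IsGentle I) {α : Path Q} (hα : InB I α) (c : E)
    (a : BoundAlgebra I) : hI.coef α (a * pathClass I (Path.ofArrow c)) =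
      if α.arrows.getLast? = some c then hI.coef α.it a else 0 := by
  have : hI.coef α ∘ₗ LinearMap.mulRight k (pathClass I (Path.ofArrow c)) =
      if α.arrows.getLast? = some c then hI.coef α.it else 0 := by
    refine hI.linearMap_ext fun p hp => ?_
    rw [LinearMap.comp_apply, LinearMap.mulRight_apply]
    by_cases h : p.src = (Path.ofArrow c : Path Q).tgt
    · rw [pathClass_mul _ _ _ h, hI.coef_pathClass]
      by_cases hc : α.arrows.getLast? = some c
      · rw [if_pos hc, hI.coef_pathClass]
        obtain ⟨h', e⟩ := α.eq_concat hc
        have : α = p.comp (Path.ofArrow c) h ↔ α.it = p :=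
          ⟨fun e' => by rw [e', Path.it_concat], fun e' => by subst e'; exact e⟩
        simp only [this, hα, hα.it]
      · rw [if_neg hc, if_neg, LinearMap.zero_apply]
        rintro ⟨rfl, -⟩
        exact hc (by simp)
    · rw [pathClass_mul_of_ne _ _ _ h, map_zero]
      split_ifs with hc
      · rw [hI.coef_pathClass, if_neg]
        rintro ⟨rfl, -⟩
        exact h (α.it_src hc)
      · rfl
  have h := LinearMap.congr_fun this a
  rw [LinearMap.comp_apply, LinearMap.mulRight_apply] at h
  rw [h]
  split_ifs <;> rfl

theorem IsGentle.coef_trivial_mul (hI : IsGentle I) {α : Path Q} {x : V} (h : α.tgt ≠ x)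
    (a : BoundAlgebra I) : hI.coef α (pathClass I (Path.trivial x) * a) = 0 := by
  have : hI.coef α ∘ₗ LinearMap.mulLeft k (pathClass I (Path.trivial x)) = 0 := by
    refine hI.linearMap_ext fun p hp => ?_
    rw [LinearMap.comp_apply, LinearMap.mulLeft_apply, LinearMap.zero_apply]
    by_cases hx : x = p.tgt
    · rw [hx, trivial_mul_pathClass, hI.coef_pathClass, if_neg]
      rintro ⟨rfl, -⟩; exact h hx.symm
    · rw [pathClass_mul_of_ne, map_zero]; exact hx
  exact LinearMap.congr_fun this a

theorem IsGentle.coef_mul_trivial (hI : IsGentle I) {α : Path Q} {x : V} (h : α.src ≠ x)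
    (a : BoundAlgebra I) : hI.coef α (a * pathClass I (Path.trivial x)) = 0 := by
  have : hI.coef α ∘ₗ LinearMap.mulRight k (pathClass I (Path.trivial x)) = 0 := by
    refine hI.linearMap_ext fun p hp => ?_
    rw [LinearMap.comp_apply, LinearMap.mulRight_apply, LinearMap.zero_apply]
    by_cases hx : p.src = x
    · rw [← hx, pathClass_mul_trivial, hI.coef_pathClass, if_neg]
      rintro ⟨rfl, -⟩; exact h hx
    · rw [pathClass_mul_of_ne, map_zero]; exact hx
  exact LinearMap.congr_fun this a

variable (I) in
open Classical in
/-- The coefficient of an element of `k (Γ_m ∥ B)` at a pair of paths; zero at the pairs outside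
`Γ_m ∥ B`. -/
noncomputable def pcoef (m : ℕ) (γ α : Path Q) : ParallelCochain I m →ₗ[k] k :=
  if h : IsParallelPair I m (γ, α) then Finsupp.lapply ⟨(γ, α), h⟩ else 0

theorem pcoef_of {m : ℕ} {γ α : Path Q} (h : IsParallelPair I m (γ, α))
    (z : ParallelCochain I m) : pcoef I m γ α z = z ⟨(γ, α), h⟩ := by simp [pcoef, h]

theorem pcoef_of_not {m : ℕ} {γ α : Path Q} (h : ¬ IsParallelPair I m (γ, α))
    (z : ParallelCochain I m) : pcoef I m γ α z = 0 := by simp [pcoef, h]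

theorem ext_pcoef {m : ℕ} {z w : ParallelCochain I m}
    (h : ∀ γ α, IsParallelPair I m (γ, α) → pcoef I m γ α z = pcoef I m γ α w) : z = w := by
  ext ⟨⟨γ, α⟩, hx⟩
  rw [← pcoef_of, ← pcoef_of, h γ α hx]

open Classical in
theorem pcoef_single {m : ℕ} (x : {x : Path Q × Path Q // IsParallelPair I m x}) (c : k)
    (γ α : Path Q) : pcoef I m γ α (Finsupp.single x c) = if x.1 = (γ, α) then c else 0 := by
  by_cases h : IsParallelPair I m (γ, α)
  · rw [pcoef_of h, Finsupp.single_apply]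
    simp only [Subtype.ext_iff]
  · rw [pcoef_of_not h, if_neg]
    rintro e
    exact h (e ▸ x.2)

open Classical in
theorem pcoef_pair {m : ℕ} {γ' α' : Path Q} (γ α : Path Q) (h : IsParallelPair I m (γ', α')) :
    pcoef I m γ α (pair I m γ' α') = if γ' = γ ∧ α' = α then 1 else 0 := by
  rw [pair, dif_pos h, pcoef_single]
  simp only [Prod.mk.injEq]

theorem single_eq_smul_pair {m : ℕ} (x : {x : Path Q × Path Q // IsParallelPair I m x}) (c : k) :
    (Finsupp.single x c : ParallelCochain I m) = c • pair I m x.1.1 x.1.2 := by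
  rw [pair, dif_pos x.2]; simp

theorem IsParallelPair.inΓm {m : ℕ} {γ α : Path Q} (h : IsParallelPair I m (γ, α)) :
    InΓm I m γ := ⟨h.fst_mem, h.length_fst⟩

theorem IsParallelPair.tl {m : ℕ} {γ α : Path Q} (h : IsParallelPair I (m + 1) (γ, α))
    (hs : γ.SameLast α) : IsParallelPair I m (γ.tl, α.tl) := by
  obtain ⟨c, h₁, h₂⟩ := hs
  exact ⟨h.inΓm.tl.inΓ, h.inΓm.tl.length, h.snd_mem.tl, by simpa using h.src_eq,
    by simp only [γ.tl_tgt h₁, α.tl_tgt h₂]⟩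

theorem IsParallelPair.it {m : ℕ} {γ α : Path Q} (h : IsParallelPair I (m + 1) (γ, α))
    (hs : γ.SameFirst α) : IsParallelPair I m (γ.it, α.it) := by
  obtain ⟨c, h₁, h₂⟩ := hs
  exact ⟨h.inΓm.it.inΓ, h.inΓm.it.length, h.snd_mem.it,
    by simp only [γ.it_src h₁, α.it_src h₂], by simpa using h.tgt_eq⟩

open Classical in
theorem pcoef_pair_ofArrow_comp {m : ℕ} {x : Path Q × Path Q} (hx : IsParallelPair I m x)
    {γ α : Path Q} (hγ : InΓm I (m + 1) γ) (hα : InB I α) (b : E) :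
    pcoef I (m + 1) γ α (if h : Q.s b = x.1.tgt then
        pair I (m + 1) ((Path.ofArrow b).comp x.1 h)
          ((Path.ofArrow b).comp x.2 (h.trans hx.tgt_eq)) else 0) =
      if γ.arrows.head? = some b ∧ α.arrows.head? = some b ∧ γ.tl = x.1 ∧ α.tl = x.2
        then 1 else 0 := by
  obtain ⟨γ', α'⟩ := x
  by_cases h : Q.s b = γ'.tgt
  · have e : ((Path.ofArrow b).comp γ' h = γ ∧
        (Path.ofArrow b).comp α' (h.trans hx.tgt_eq) = α) ↔
        (γ.arrows.head? = some b ∧ α.arrows.head? = some b ∧ γ.tl = γ' ∧ α.tl = α') := by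
      constructor
      · rintro ⟨rfl, rfl⟩
        exact ⟨rfl, rfl, Path.tl_cons _ _ _, Path.tl_cons _ _ _⟩
      · rintro ⟨h₁, h₂, rfl, rfl⟩
        obtain ⟨_, e₁⟩ := γ.eq_cons h₁
        obtain ⟨_, e₂⟩ := α.eq_cons h₂
        exact ⟨e₁.symm, e₂.symm⟩
    rw [dif_pos h]
    by_cases hp : IsParallelPair I (m + 1) ((Path.ofArrow b).comp γ' h,
        (Path.ofArrow b).comp α' (h.trans hx.tgt_eq))
    · rw [pcoef_pair _ _ hp]
      simp only [e]
    · rw [pair, dif_neg hp, map_zero, if_neg]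
      intro h'
      obtain ⟨e₁, e₂⟩ := e.2 h'
      refine hp ⟨e₁ ▸ hγ.inΓ, e₁ ▸ hγ.length, e₂ ▸ hα, hx.src_eq, rfl⟩
  · rw [dif_neg h, map_zero, if_neg]
    rintro ⟨h₁, -, rfl, -⟩
    exact h (γ.tl_tgt h₁).symm

open Classical in
theorem pcoef_pair_comp_ofArrow {m : ℕ} {x : Path Q × Path Q} (hx : IsParallelPair I m x)
    {γ α : Path Q} (hγ : InΓm I (m + 1) γ) (hα : InB I α) (a : E) :
    pcoef I (m + 1) γ α (if h : x.1.src = Q.t a then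
        pair I (m + 1) (x.1.comp (Path.ofArrow a) h)
          (x.2.comp (Path.ofArrow a) (hx.src_eq.symm.trans h)) else 0) =
      if γ.arrows.getLast? = some a ∧ α.arrows.getLast? = some a ∧ γ.it = x.1 ∧ α.it = x.2
        then 1 else 0 := by
  obtain ⟨γ', α'⟩ := x
  by_cases h : γ'.src = Q.t a
  · have e : (γ'.comp (Path.ofArrow a) h = γ ∧
        α'.comp (Path.ofArrow a) (hx.src_eq.symm.trans h) = α) ↔
        (γ.arrows.getLast? = some a ∧ α.arrows.getLast? = some a ∧ γ.it = γ' ∧ α.it = α') := by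
      constructor
      · rintro ⟨rfl, rfl⟩
        exact ⟨List.getLast?_concat, List.getLast?_concat, Path.it_concat _ _ _,
          Path.it_concat _ _ _⟩
      · rintro ⟨h₁, h₂, rfl, rfl⟩
        obtain ⟨_, e₁⟩ := γ.eq_concat h₁
        obtain ⟨_, e₂⟩ := α.eq_concat h₂
        exact ⟨e₁.symm, e₂.symm⟩
    rw [dif_pos h]
    by_cases hp : IsParallelPair I (m + 1) (γ'.comp (Path.ofArrow a) h,
        α'.comp (Path.ofArrow a) (hx.src_eq.symm.trans h))
    · rw [pcoef_pair _ _ hp]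
      simp only [e]
    · rw [pair, dif_neg hp, map_zero, if_neg]
      intro h'
      obtain ⟨e₁, e₂⟩ := e.2 h'
      refine hp ⟨e₁ ▸ hγ.inΓ, e₁ ▸ hγ.length, e₂ ▸ hα, rfl, hx.tgt_eq⟩
  · rw [dif_neg h, map_zero, if_neg]
    rintro ⟨h₁, -, rfl, -⟩
    exact h (γ.it_src h₁)

/-! ### Evaluation -/

theorem parallelEval_add {m : ℕ} (z w : ParallelCochain I m) (γ : Path Q) :
    parallelEval I (z + w) γ = parallelEval I z γ + parallelEval I w γ := by
  classical
  unfold parallelEval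
  refine Finsupp.sum_add_index' (fun x => ?_) (fun x c d => ?_)
  · split_ifs <;> simp
  · split_ifs <;> simp [add_smul]

open Classical in
theorem parallelEval_single {m : ℕ} (x : {x : Path Q × Path Q // IsParallelPair I m x}) (c : k)
    (γ : Path Q) : parallelEval I (Finsupp.single x c : ParallelCochain I m) γ =
      if x.1.1 = γ then c • pathClass I x.1.2 else 0 := by
  unfold parallelEval
  rw [Finsupp.sum_single_index]
  split_ifs <;> simp

theorem IsGentle.coef_parallelEval (hI : IsGentle I) {m : ℕ} (z : ParallelCochain I m)
    (γ α : Path Q) : hI.coef α (parallelEval I z γ) = pcoef I m γ α z := by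
  classical
  induction z using Finsupp.induction_linear with
  | zero => simp [parallelEval]
  | add z w hz hw => rw [parallelEval_add, map_add, map_add, hz, hw]
  | single x c =>
    rw [parallelEval_single, pcoef_single]
    have := x.2.snd_mem
    by_cases h₁ : x.1.1 = γ <;> by_cases h₂ : x.1.2 = α <;>
      simp [Prod.ext_iff, h₁, h₂, hI.coef_pathClass]
    · intro h; subst h₂; exact absurd this h
    · intro h; exact absurd h.symm h₂

theorem IsGentle.parallelEval_smul (hI : IsGentle I) {m : ℕ} (c : k) (z : ParallelCochain I m)
    (γ : Path Q) : parallelEval I (c • z) γ = c • parallelEval I z γ :=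
  hI.ext_coef fun α => by
    rw [hI.coef_parallelEval, map_smul, map_smul, hI.coef_parallelEval]

theorem parallelEval_sub {m : ℕ} (z w : ParallelCochain I m) (γ : Path Q) :
    parallelEval I (z - w) γ = parallelEval I z γ - parallelEval I w γ := by
  rw [eq_sub_iff_add_eq, ← parallelEval_add, sub_add_cancel]

theorem IsGentle.eq_of_parallelEval (hI : IsGentle I) {m : ℕ} {z w : ParallelCochain I m}
    (h : ∀ γ, InΓm I m γ → parallelEval I z γ = parallelEval I w γ) : z = w :=
  ext_pcoef fun γ α hp => by
    rw [← hI.coef_parallelEval, ← hI.coef_parallelEval, h γ hp.inΓm]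

variable (I) in
/-- The algebra `A` as a bimodule over itself. -/
noncomputable def regular : Bimod k (BoundAlgebra I) where
  M := BoundAlgebra I
  l := LinearMap.mul k _
  r := (LinearMap.mul k _).flip
  l_mul a b m := mul_assoc a b m
  r_mul a b m := (mul_assoc m a b).symm
  comm a b m := (mul_assoc a m b).symm

theorem unital_regular : (regular I).Unital := ⟨one_mul (M := BoundAlgebra I),
  mul_one (M := BoundAlgebra I)⟩

theorem regular_corner (γ : Path Q) (a : BoundAlgebra I) : corner (regular I) γ a =
    pathClass I (Path.trivial γ.tgt) * (a * pathClass I (Path.trivial γ.src)) := rfl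

theorem regular_d {m : ℕ} (f : HochschildCochain k (BoundAlgebra I) m) :
    (regular I).d m f = hochschildD k (BoundAlgebra I) m f :=
  MultilinearMap.ext fun x => ((regular I).d_apply f x).trans (hochschildD_apply f x).symm

theorem mem_coboundaries_iff_isHochCobound {m : ℕ} (f : HochschildCochain k (BoundAlgebra I) m) :
    f ∈ coboundaries (hochschildD k (BoundAlgebra I)) m ↔ IsHochCobound (X := regular I) f := by
  cases m with
  | zero => exact Submodule.mem_bot k
  | succ m =>
    constructor
    · rintro ⟨g, rfl⟩; exact ⟨g, regular_d g⟩
    · rintro ⟨g, hg⟩; exact ⟨g, (regular_d g).symm.trans hg⟩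

theorem hochschildEval_eq_restr {m : ℕ} (f : HochschildCochain k (BoundAlgebra I) m)
    (γ : Path Q) (h : γ.length = m) :
    hochschildEval I f γ h = restr (X := regular I) f γ := by
  have h₁ : restr (X := regular I) f γ = _ := dif_pos h
  exact (mul_assoc _ _ _).trans h₁.symm

theorem isCornered_parallelEval {m : ℕ} (z : ParallelCochain I m) :
    IsCornered (regular I) (parallelEval I z) := fun γ => by
  classical
  induction z using Finsupp.induction_linear with
  | zero => exact map_zero _
  | add z w hz hw => rw [parallelEval_add]; exact (map_add _ _ _).trans (congrArg₂ _ hz hw)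
  | single x c =>
    rw [parallelEval_single]
    split_ifs with h
    · refine (map_smul _ _ _).trans (congrArg (c • ·) ?_)
      refine (regular_corner _ _).trans ?_
      rw [← h, x.2.src_eq, x.2.tgt_eq, pathClass_mul_trivial, trivial_mul_pathClass]
    · exact map_zero _

theorem regular_mapD {m : ℕ} (u : Path Q → BoundAlgebra I) {γ : Path Q} {a b : E}
    (hb : γ.arrows.head? = some b) (ha : γ.arrows.getLast? = some a) :
    mapD (regular I) m u γ = pathClass I (Path.ofArrow b) * u γ.tl +
      (-1 : k) ^ (m + 1) • (u γ.it * pathClass I (Path.ofArrow a)) := by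
  unfold mapD
  rw [lastAct_of_head _ hb, firstAct_of_getLast _ ha]
  rfl

variable [Fintype E]

open Classical in
/-- The coefficients of the differential: a pair `(γ, α)` is hit by the pairs obtained by removing
a common last arrow, respectively a common first arrow, of `γ` and `α`. -/
theorem pcoef_parallelD {m : ℕ} (z : ParallelCochain I m) {γ α : Path Q}
    (hγ : InΓm I (m + 1) γ) (hα : InB I α) :
    pcoef I (m + 1) γ α (parallelD I m z) =
      (if γ.SameLast α then pcoef I m γ.tl α.tl z else 0) -
        (-1) ^ m * if γ.SameFirst α then pcoef I m γ.it α.it z else 0 := by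
  induction z using Finsupp.induction_linear with
  | zero => simp
  | add z w hz hw =>
    simp only [map_add, hz, hw]
    split_ifs <;> ring
  | single x c =>
    have h₁ : (∑ b : E, pcoef I (m + 1) γ α (if h : Q.s b = x.1.1.tgt then
        pair I (m + 1) ((Path.ofArrow b).comp x.1.1 h)
          ((Path.ofArrow b).comp x.1.2 (h.trans x.2.tgt_eq)) else 0)) =
        if γ.SameLast α ∧ γ.tl = x.1.1 ∧ α.tl = x.1.2 then 1 else 0 := by
      refine (Finset.sum_congr rfl fun b _ => pcoef_pair_ofArrow_comp x.2 hγ hα b).trans ?_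
      by_cases hs : γ.SameLast α
      · obtain ⟨c, hc₁, hc₂⟩ := id hs
        rw [Finset.sum_eq_single c]
        · simp [hs, hc₁, hc₂]
        · intro b _ hb
          rw [if_neg]
          rintro ⟨h, -⟩
          exact hb (Option.some.inj (h.symm.trans hc₁))
        · simp
      · rw [if_neg (fun h => hs h.1), Finset.sum_eq_zero]
        intro b _
        rw [if_neg]
        rintro ⟨h, h', -⟩
        exact hs ⟨b, h, h'⟩
    have h₂ : (∑ a : E, pcoef I (m + 1) γ α (if h : x.1.1.src = Q.t a then
        pair I (m + 1) (x.1.1.comp (Path.ofArrow a) h)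
          (x.1.2.comp (Path.ofArrow a) (x.2.src_eq.symm.trans h)) else 0)) =
        if γ.SameFirst α ∧ γ.it = x.1.1 ∧ α.it = x.1.2 then 1 else 0 := by
      refine (Finset.sum_congr rfl fun b _ => pcoef_pair_comp_ofArrow x.2 hγ hα b).trans ?_
      by_cases hs : γ.SameFirst α
      · obtain ⟨c, hc₁, hc₂⟩ := id hs
        rw [Finset.sum_eq_single c]
        · simp [hs, hc₁, hc₂]
        · intro b _ hb
          rw [if_neg]
          rintro ⟨h, -⟩
          exact hb (Option.some.inj (h.symm.trans hc₁))
        · simp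
      · rw [if_neg (fun h => hs h.1), Finset.sum_eq_zero]
        intro b _
        rw [if_neg]
        rintro ⟨h, h', -⟩
        exact hs ⟨b, h, h'⟩
    rw [parallelD, Finsupp.linearCombination_single, map_smul, map_sub, map_smul, map_sum, map_sum,
      h₁, h₂, pcoef_single, pcoef_single]
    have e₁ : (x.1 = (γ.tl, α.tl)) ↔ γ.tl = x.1.1 ∧ α.tl = x.1.2 := by
      rw [Prod.ext_iff, eq_comm (a := x.1.1), eq_comm (a := x.1.2)]
    have e₂ : (x.1 = (γ.it, α.it)) ↔ γ.it = x.1.1 ∧ α.it = x.1.2 := by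
      rw [Prod.ext_iff, eq_comm (a := x.1.1), eq_comm (a := x.1.2)]
    simp only [e₁, e₂, smul_eq_mul, ite_and]
    split_ifs <;> ring

/-- Under evaluation, the differential of `k (Γ ∥ B)` is that of the maps from `Γ` to `A`. -/
theorem IsGentle.parallelEval_parallelD (hI : IsGentle I) {m : ℕ} (z : ParallelCochain I m)
    {γ : Path Q} (hγ : InΓm I (m + 1) γ) :
    parallelEval I (parallelD I m z) γ = mapD (regular I) m (parallelEval I z) γ := by
  classical
  refine hI.ext_coef fun α => ?_
  by_cases hα : InB I α
  swap
  · exact (hI.coef_of_not_inB hα _).trans (hI.coef_of_not_inB hα _).symm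
  obtain ⟨b, hb⟩ := hγ.exists_head
  obtain ⟨a, ha⟩ := hγ.exists_getLast
  have h₁ : γ.SameLast α ↔ α.arrows.head? = some b := by simp [Path.SameLast, hb]
  have h₂ : γ.SameFirst α ↔ α.arrows.getLast? = some a := by simp [Path.SameFirst, ha]
  rw [hI.coef_parallelEval, pcoef_parallelD z hγ hα, regular_mapD _ hb ha, map_add, map_smul,
    hI.coef_ofArrow_mul hα, hI.coef_mul_ofArrow hα, hI.coef_parallelEval, hI.coef_parallelEval,
    pow_succ, smul_eq_mul]
  simp only [h₁, h₂]
  ring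

theorem finite_length_eq (m : ℕ) : {p : Path Q | p.length = m}.Finite := by
  have h : (Set.univ ×ˢ {l : List E | l.length = m} : Set (V × List E)).Finite :=
    Set.finite_univ.prod (List.finite_length_eq E m)
  refine Set.Finite.of_finite_image (f := fun p : Path Q => (p.src, p.arrows))
    (h.subset ?_) ?_
  · rintro _ ⟨p, hp, rfl⟩
    exact ⟨trivial, hp⟩
  · intro p _ q _ e
    exact Path.ext_src (congrArg Prod.fst e) (congrArg Prod.snd e)

/-- The element of `k (Γ_m ∥ B)` with given values at the elements of `Γ_m`. -/
noncomputable def IsGentle.ofMap (hI : IsGentle I) (m : ℕ) (u : Path Q → BoundAlgebra I) :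
    ParallelCochain I m :=
  Finsupp.ofSupportFinite (fun x => hI.coef x.1.2 (u x.1.1)) (by
    have h : (⋃ γ ∈ {p : Path Q | p.length = m}, {γ} ×ˢ {α | hI.coef α (u γ) ≠ 0}).Finite :=
      (finite_length_eq m).biUnion fun γ _ => (Set.finite_singleton γ).prod (hI.finite_coef _)
    refine Set.Finite.of_finite_image (f := Subtype.val) (h.subset ?_)
      Subtype.val_injective.injOn
    rintro _ ⟨x, hx, rfl⟩
    exact Set.mem_biUnion x.2.length_fst ⟨rfl, hx⟩)

theorem IsGentle.parallelEval_ofMap (hI : IsGentle I) {m : ℕ} {u : Path Q → BoundAlgebra I}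
    (hu : IsCornered (regular I) u) {γ : Path Q} (hγ : InΓm I m γ) :
    parallelEval I (hI.ofMap m u) γ = u γ := by
  refine hI.ext_coef fun α => ?_
  rw [hI.coef_parallelEval]
  by_cases h : IsParallelPair I m (γ, α)
  · rw [pcoef_of h]; rfl
  · rw [pcoef_of_not h]
    by_cases hα : InB I α
    swap
    · rw [hI.coef_of_not_inB hα]
    have e := (regular_corner γ (u γ)).symm.trans (hu γ)
    by_cases hs : γ.src = α.src
    · by_cases ht : γ.tgt = α.tgt
      · exact absurd ⟨hγ.inΓ, hγ.length, hα, hs, ht⟩ h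
      · rw [← e, hI.coef_trivial_mul (Ne.symm ht)]
    · rw [← e, ← mul_assoc, hI.coef_mul_trivial (Ne.symm hs)]

theorem IsGentle.parallelD_comp_parallelD (hI : IsGentle I) (m : ℕ) :
    parallelD I (m + 1) ∘ₗ parallelD I m = 0 := by
  refine LinearMap.ext fun z => hI.eq_of_parallelEval fun γ hγ => ?_
  rw [LinearMap.comp_apply, hI.parallelEval_parallelD _ hγ]
  refine (mapD_congr (X := regular I) (fun γ' h => hI.parallelEval_parallelD z h) hγ).trans ?_
  exact (mapD_mapD (X := regular I) _ hγ).trans (by simp [parallelEval]; rfl)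

theorem IsGentle.mem_coboundaries_iff (hI : IsGentle I) {m : ℕ} (z : ParallelCochain I m) :
    z ∈ coboundaries (parallelD I) m ↔ IsMapCobound (regular I) m (parallelEval I z) := by
  cases m with
  | zero =>
    refine (Submodule.mem_bot k).trans ⟨?_, fun h => ?_⟩
    · rintro rfl γ -
      exact Finsupp.sum_zero_index
    · exact hI.eq_of_parallelEval fun γ hγ => (h γ hγ).trans Finsupp.sum_zero_index.symm
  | succ m =>
    constructor
    · rintro ⟨w, rfl⟩
      exact ⟨_, isCornered_parallelEval w, fun γ hγ => hI.parallelEval_parallelD w hγ⟩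
    · rintro ⟨w, hw, h⟩
      refine ⟨hI.ofMap m w, hI.eq_of_parallelEval fun γ hγ => ?_⟩
      rw [hI.parallelEval_parallelD _ hγ]
      exact (mapD_congr (X := regular I) (fun γ' h' => hI.parallelEval_ofMap hw h') hγ).trans
        (h γ hγ).symm

/-! ### The comparison with Hochschild cohomology -/

/-- The restriction of Hochschild cochains to `Γ`. -/
noncomputable def IsGentle.restriction (hI : IsGentle I) (m : ℕ) :
    HochschildCochain k (BoundAlgebra I) m →ₗ[k] ParallelCochain I m where
  toFun f := hI.ofMap m (restr (X := regular I) f)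
  map_add' f g := hI.eq_of_parallelEval fun γ hγ => by
    have h : restr (X := regular I) (f + g) γ =
        restr (X := regular I) f γ + restr (X := regular I) g γ := by
      unfold restr
      rw [dif_pos hγ.length, dif_pos hγ.length, dif_pos hγ.length]
      exact map_add _ _ _
    rw [parallelEval_add]
    refine (hI.parallelEval_ofMap (isCornered_restr _) hγ).trans (h.trans ?_)
    exact (congrArg₂ (fun a b : BoundAlgebra I => a + b)
      (hI.parallelEval_ofMap (isCornered_restr _) hγ)
      (hI.parallelEval_ofMap (isCornered_restr _) hγ)).symm
  map_smul' c f := hI.eq_of_parallelEval fun γ hγ => by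
    have h : restr (X := regular I) (c • f) γ = c • restr (X := regular I) f γ := by
      unfold restr
      rw [dif_pos hγ.length, dif_pos hγ.length]
      exact map_smul _ _ _
    rw [RingHom.id_apply, hI.parallelEval_smul]
    refine (hI.parallelEval_ofMap (isCornered_restr _) hγ).trans (h.trans ?_)
    exact (congrArg (fun a : BoundAlgebra I => c • a)
      (hI.parallelEval_ofMap (isCornered_restr _) hγ)).symm

theorem IsGentle.parallelEval_restriction (hI : IsGentle I) {m : ℕ}
    (f : HochschildCochain k (BoundAlgebra I) m) {γ : Path Q} (hγ : InΓm I m γ) :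
    parallelEval I (hI.restriction m f) γ = restr (X := regular I) f γ :=
  hI.parallelEval_ofMap (isCornered_restr _) hγ

theorem IsGentle.restricts_restriction (hI : IsGentle I) {m : ℕ}
    (f : HochschildCochain k (BoundAlgebra I) m) : Restricts I f (hI.restriction m f) :=
  fun γ h hγ => (hochschildEval_eq_restr f γ h).trans (hI.parallelEval_restriction f ⟨hγ, h⟩).symm

theorem IsGentle.parallelD_restriction (hI : IsGentle I) {m : ℕ}
    (f : HochschildCochain k (BoundAlgebra I) m) :
    parallelD I m (hI.restriction m f) = hI.restriction (m + 1) (hochschildD k _ m f) :=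
  hI.eq_of_parallelEval fun γ hγ => by
    rw [hI.parallelEval_parallelD _ hγ, hI.parallelEval_restriction _ hγ]
    refine (mapD_congr (X := regular I) (fun γ' h => hI.parallelEval_restriction f h) hγ).trans ?_
    refine (restr_d (X := regular I) f hγ).symm.trans ?_
    rw [regular_d]

/-- A Hochschild cocycle is a coboundary if and only if its restriction to `Γ` is. -/
theorem IsGentle.restriction_mem_coboundaries (hI : IsGentle I) {m : ℕ}
    {f : HochschildCochain k (BoundAlgebra I) m} (hf : hochschildD k _ m f = 0) :
    hI.restriction m f ∈ coboundaries (parallelD I) m ↔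
      f ∈ coboundaries (hochschildD k (BoundAlgebra I)) m := by
  refine ⟨fun h => ?_, fun h => ?_⟩
  · rw [mem_coboundaries_iff_isHochCobound]
    refine (hI.restr_bijective m).2 (regular I) unital_regular f ((regular_d f).trans hf) ?_
    exact ((hI.mem_coboundaries_iff _).1 h).congr fun γ hγ =>
      (hI.parallelEval_restriction f hγ).symm
  · cases m with
    | zero =>
      obtain rfl := (Submodule.mem_bot k).1 h
      rw [map_zero]; exact Submodule.zero_mem _
    | succ m =>
      obtain ⟨g, rfl⟩ := h
      exact ⟨hI.restriction m g, hI.parallelD_restriction g⟩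

/-- Every cocycle of the complex of parallel paths is, up to a coboundary, the restriction of a
Hochschild cocycle. -/
theorem IsGentle.exists_restriction_sub_mem (hI : IsGentle I) {m : ℕ} {z : ParallelCochain I m}
    (hz : parallelD I m z = 0) : ∃ f, hochschildD k (BoundAlgebra I) m f = 0 ∧
      hI.restriction m f - z ∈ coboundaries (parallelD I) m := by
  have hz : ∀ γ, InΓm I (m + 1) γ → mapD (regular I) m (parallelEval I z) γ = 0 := by
    intro γ hγ
    refine (hI.parallelEval_parallelD z hγ).symm.trans ?_
    rw [hz]
    exact Finsupp.sum_zero_index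
  obtain ⟨f, hf, h⟩ := (hI.restr_bijective m).1 (regular I) unital_regular
    (parallelEval I z) (isCornered_parallelEval z) hz
  refine ⟨f, (regular_d f).symm.trans hf, ?_⟩
  refine (hI.mem_coboundaries_iff _).2 (h.congr fun γ hγ => ?_)
  refine (parallelEval_sub _ _ _).trans ?_
  exact congrArg (fun a : BoundAlgebra I => a - parallelEval I z γ)
    (hI.parallelEval_restriction f hγ)

/-- Restriction to `Γ`, as an isomorphism from Hochschild cohomology to the cohomology of the
complex of parallel paths. -/
noncomputable def IsGentle.comparison (hI : IsGentle I) (m : ℕ) :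
    HH k (BoundAlgebra I) m ≃ₗ[k] ParallelCohomology I m :=
  cohomologyEquiv (hochschildD k (BoundAlgebra I)) (parallelD I) (hI.restriction m)
    (fun f hf => by
      rw [LinearMap.mem_ker, hI.parallelD_restriction, LinearMap.mem_ker.1 hf, map_zero])
    (fun _ hf => hI.restriction_mem_coboundaries hf) fun _ hz => hI.exists_restriction_sub_mem hz

theorem IsGentle.comparison_class (hI : IsGentle I) {m : ℕ}
    (f : LinearMap.ker (hochschildD k (BoundAlgebra I) m)) :
    ∃ z : LinearMap.ker (parallelD I m), Restricts I f.1 z.1 ∧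
      hI.comparison m (cohomologyClass (hochschildD k (BoundAlgebra I)) f) =
        cohomologyClass (parallelD I) z :=
  ⟨⟨hI.restriction m f.1, by
    rw [LinearMap.mem_ker, hI.parallelD_restriction, LinearMap.mem_ker.1 f.2, map_zero]⟩,
    hI.restricts_restriction f.1, rfl⟩

end Coordinates

/-! ### Extending and shortening pairs of parallel paths -/

section Extension

open PathAlgebra

variable {k : Type u} [Field k] {V : Type v} {E : Type w} [Fintype V] {Q : ArrowQuiver V E}
  {I : TwoSidedIdeal (PathAlgebra k Q)}

variable (I) in
/-- The pair of paths `y` is obtained from the pair `x` by composing both paths with the arrow `b`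
on the left, and is an element of `Γ_{m+1} ∥ B`. -/
structure LeftExt (m : ℕ) (b : E) (x y : Path Q × Path Q) : Prop where
  par : IsParallelPair I (m + 1) y
  fst_arrows : y.1.arrows = b :: x.1.arrows
  snd_arrows : y.2.arrows = b :: x.2.arrows
  fst_tl : y.1.tl = x.1
  snd_tl : y.2.tl = x.2

variable (I) in
/-- The pair of paths `y` is obtained from the pair `x` by composing both paths with the arrow `a`
on the right, and is an element of `Γ_{m+1} ∥ B`. -/
structure RightExt (m : ℕ) (a : E) (x y : Path Q × Path Q) : Prop where
  par : IsParallelPair I (m + 1) y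
  fst_arrows : y.1.arrows = x.1.arrows ++ [a]
  snd_arrows : y.2.arrows = x.2.arrows ++ [a]
  fst_it : y.1.it = x.1
  snd_it : y.2.it = x.2

variable {m : ℕ} {a b a' b' : E} {x y y' : Path Q × Path Q}

theorem exists_leftExt_of_sameLast (hy : IsParallelPair I (m + 1) y) (h : y.1.SameLast y.2) :
    ∃ b, LeftExt I m b (y.1.tl, y.2.tl) y := by
  obtain ⟨b, h₁, h₂⟩ := h
  exact ⟨b, hy, by rw [Path.tl_arrows]; exact (List.cons_head?_tail h₁).symm,
    by rw [Path.tl_arrows]; exact (List.cons_head?_tail h₂).symm, rfl, rfl⟩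

theorem exists_rightExt_of_sameFirst (hy : IsParallelPair I (m + 1) y) (h : y.1.SameFirst y.2) :
    ∃ a, RightExt I m a (y.1.it, y.2.it) y := by
  obtain ⟨a, h₁, h₂⟩ := h
  exact ⟨a, hy, by rw [Path.it_arrows]; exact (List.dropLast_append_getLast? a h₁).symm,
    by rw [Path.it_arrows]; exact (List.dropLast_append_getLast? a h₂).symm, rfl, rfl⟩

namespace LeftExt

theorem head_fst (h : LeftExt I m b x y) : y.1.arrows.head? = some b := by rw [h.fst_arrows]; rfl

theorem head_snd (h : LeftExt I m b x y) : y.2.arrows.head? = some b := by rw [h.snd_arrows]; rfl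

theorem sameLast (h : LeftExt I m b x y) : y.1.SameLast y.2 := ⟨b, h.head_fst, h.head_snd⟩

theorem parallel (h : LeftExt I m b x y) : IsParallelPair I m x := by
  have := h.par.tl h.sameLast
  rwa [h.fst_tl, h.snd_tl] at this

theorem mem (h : LeftExt I m b x y) {c : E} (hc : x.1.arrows.head? = some c) :
    ofArrow k Q b * ofArrow k Q c ∈ I := by
  have := h.par.fst_mem
  unfold InΓ at this
  rw [h.fst_arrows, List.isChain_cons] at this
  exact this.1 c hc

theorem notMem (h : LeftExt I m b x y) {c : E} (hc : x.2.arrows.head? = some c) :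
    ofArrow k Q b * ofArrow k Q c ∉ I := by
  have := h.par.snd_mem
  unfold InB at this
  rw [h.snd_arrows, List.isChain_cons] at this
  exact this.1 c hc

theorem source_eq (h : LeftExt I m b x y) : Q.s b = x.1.tgt := by
  rw [← h.fst_tl, y.1.tl_tgt h.head_fst]

theorem not_sameLast (h : LeftExt I m b x y) : ¬ x.1.SameLast x.2 := by
  rintro ⟨c, h₁, h₂⟩
  exact h.notMem h₂ (h.mem h₁)

theorem eq_of_arrow_eq (h : LeftExt I m b x y) (h' : LeftExt I m b x y') : y = y' :=
  Prod.ext (Path.eq_of_arrows (h.fst_arrows.trans h'.fst_arrows.symm) (by simp [h.fst_arrows]))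
    (Path.eq_of_arrows (h.snd_arrows.trans h'.snd_arrows.symm) (by simp [h.snd_arrows]))

end LeftExt

namespace RightExt

theorem getLast_fst (h : RightExt I m a x y) : y.1.arrows.getLast? = some a := by
  rw [h.fst_arrows, List.getLast?_concat]

theorem getLast_snd (h : RightExt I m a x y) : y.2.arrows.getLast? = some a := by
  rw [h.snd_arrows, List.getLast?_concat]

theorem sameFirst (h : RightExt I m a x y) : y.1.SameFirst y.2 :=
  ⟨a, h.getLast_fst, h.getLast_snd⟩

theorem parallel (h : RightExt I m a x y) : IsParallelPair I m x := by
  have := h.par.it h.sameFirst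
  rwa [h.fst_it, h.snd_it] at this

theorem mem (h : RightExt I m a x y) {c : E} (hc : x.1.arrows.getLast? = some c) :
    ofArrow k Q c * ofArrow k Q a ∈ I := by
  have := h.par.fst_mem
  unfold InΓ at this
  rw [h.fst_arrows, List.isChain_append] at this
  exact this.2.2 c hc a rfl

theorem notMem (h : RightExt I m a x y) {c : E} (hc : x.2.arrows.getLast? = some c) :
    ofArrow k Q c * ofArrow k Q a ∉ I := by
  have := h.par.snd_mem
  unfold InB at this
  rw [h.snd_arrows, List.isChain_append] at this
  exact this.2.2 c hc a rfl

theorem target_eq (h : RightExt I m a x y) : x.1.src = Q.t a := by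
  rw [← h.fst_it, y.1.it_src h.getLast_fst]

theorem not_sameFirst (h : RightExt I m a x y) : ¬ x.1.SameFirst x.2 := by
  rintro ⟨c, h₁, h₂⟩
  exact h.notMem h₂ (h.mem h₁)

theorem eq_of_arrow_eq (h : RightExt I m a x y) (h' : RightExt I m a x y') : y = y' :=
  Prod.ext (Path.eq_of_arrows (h.fst_arrows.trans h'.fst_arrows.symm) (by simp [h.fst_arrows]))
    (Path.eq_of_arrows (h.snd_arrows.trans h'.snd_arrows.symm) (by simp [h.snd_arrows]))

end RightExt

theorem exists_leftExt (hx : IsParallelPair I m x) (hs : Q.s b = x.1.tgt)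
    (h₁ : ∀ c, x.1.arrows.head? = some c → ofArrow k Q b * ofArrow k Q c ∈ I)
    (h₂ : ∀ c, x.2.arrows.head? = some c → ofArrow k Q b * ofArrow k Q c ∉ I) :
    ∃ y, LeftExt I m b x y := by
  have e₁ : (Path.ofArrow b : Path Q).src = x.1.tgt := hs
  have e₂ : (Path.ofArrow b : Path Q).src = x.2.tgt := hs.trans hx.tgt_eq
  refine ⟨((Path.ofArrow b).comp x.1 e₁, (Path.ofArrow b).comp x.2 e₂), ⟨?_, ?_, ?_, ?_, ?_⟩,
    rfl, rfl, Path.tl_cons _ _ e₁, Path.tl_cons _ _ e₂⟩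
  · exact List.isChain_cons.2 ⟨h₁, hx.fst_mem⟩
  · simpa [Path.length] using hx.length_fst
  · exact List.isChain_cons.2 ⟨h₂, hx.snd_mem⟩
  · exact hx.src_eq
  · rfl

theorem exists_rightExt (hx : IsParallelPair I m x) (hs : x.1.src = Q.t a)
    (h₁ : ∀ c, x.1.arrows.getLast? = some c → ofArrow k Q c * ofArrow k Q a ∈ I)
    (h₂ : ∀ c, x.2.arrows.getLast? = some c → ofArrow k Q c * ofArrow k Q a ∉ I) :
    ∃ y, RightExt I m a x y := by
  have e₁ : x.1.src = (Path.ofArrow a : Path Q).tgt := hs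
  have e₂ : x.2.src = (Path.ofArrow a : Path Q).tgt := hx.src_eq.symm.trans hs
  refine ⟨(x.1.comp (Path.ofArrow a) e₁, x.2.comp (Path.ofArrow a) e₂), ⟨?_, ?_, ?_, ?_, ?_⟩,
    rfl, rfl, Path.it_concat _ _ e₁, Path.it_concat _ _ e₂⟩
  · refine List.isChain_append.2 ⟨hx.fst_mem, List.isChain_singleton _, fun c hc d hd => ?_⟩
    obtain rfl : a = d := Option.some.inj hd
    exact h₁ c hc
  · simpa [Path.length] using hx.length_fst
  · refine List.isChain_append.2 ⟨hx.snd_mem, List.isChain_singleton _, fun c hc d hd => ?_⟩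
    obtain rfl : a = d := Option.some.inj hd
    exact h₂ c hc
  · rfl
  · exact hx.tgt_eq

/-- Apart from the pairs `(e_i, e_i)`, all pairs have at most one extension on the left. -/
theorem LeftExt.unique (hI : IsGentle I) (hx : x.1.arrows ≠ [] ∨ x.2.arrows ≠ [])
    (h : LeftExt I m b x y) (h' : LeftExt I m b' x y') : y = y' := by
  have : b = b' := by
    rcases hx with hx | hx
    · have hc := List.head?_eq_some_head hx
      have e := (x.1.tgt_eq_head hc).symm
      exact hI.left_mem _ ⟨e.trans h.source_eq.symm, h.mem hc⟩
        ⟨e.trans h'.source_eq.symm, h'.mem hc⟩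
    · have hc := List.head?_eq_some_head hx
      exact hI.left_notMem _ (h.notMem hc) (h'.notMem hc)
  subst this
  exact h.eq_of_arrow_eq h'

/-- Apart from the pairs `(e_i, e_i)`, all pairs have at most one extension on the right. -/
theorem RightExt.unique (hI : IsGentle I) (hx : x.1.arrows ≠ [] ∨ x.2.arrows ≠ [])
    (h : RightExt I m a x y) (h' : RightExt I m a' x y') : y = y' := by
  have : a = a' := by
    rcases hx with hx | hx
    · have hc := List.getLast?_eq_some_getLast hx
      have e := (x.1.src_eq_getLast hc)
      exact hI.right_mem _ ⟨h.target_eq.symm.trans e, h.mem hc⟩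
        ⟨h'.target_eq.symm.trans e, h'.mem hc⟩
    · have hc := List.getLast?_eq_some_getLast hx
      exact hI.right_notMem _ (h.notMem hc) (h'.notMem hc)
  subst this
  exact h.eq_of_arrow_eq h'

variable [Fintype E]

/-- The differential of a pair other than the `(e_i, e_i)` is the difference of its extension on
the left and its extension on the right, where missing extensions are replaced by zero. -/
theorem IsGentle.parallelD_pair (hI : IsGentle I) (hx : IsParallelPair I m x)
    (hne : x.1.arrows ≠ [] ∨ x.2.arrows ≠ []) {u v : ParallelCochain I (m + 1)}
    (hu : (∃ b y, LeftExt I m b x y ∧ u = pair I (m + 1) y.1 y.2) ∨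
      ((∀ b y, ¬ LeftExt I m b x y) ∧ u = 0))
    (hv : (∃ a y, RightExt I m a x y ∧ v = pair I (m + 1) y.1 y.2) ∨
      ((∀ a y, ¬ RightExt I m a x y) ∧ v = 0)) :
    parallelD I m (pair I m x.1 x.2) = u - (-1 : k) ^ m • v := by
  classical
  refine ext_pcoef fun γ α hp => ?_
  rw [pcoef_parallelD _ hp.inΓm hp.snd_mem, pcoef_pair _ _ hx, pcoef_pair _ _ hx, map_sub, map_smul,
    smul_eq_mul]
  congr 1
  · rw [← ite_and]
    rcases hu with ⟨b, y, hy, rfl⟩ | ⟨hy, rfl⟩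
    · rw [pcoef_pair _ _ hy.par]
      refine if_congr ⟨fun ⟨h₁, h₂, h₃⟩ => ?_, fun ⟨h₁, h₂⟩ => ?_⟩ rfl rfl
      · obtain ⟨b', h⟩ := exists_leftExt_of_sameLast hp h₁
        have e : x = (γ.tl, α.tl) := Prod.ext h₂ h₃
        rw [← e] at h
        have := hy.unique hI hne h
        rw [this]; exact ⟨rfl, rfl⟩
      · subst h₁ h₂
        exact ⟨hy.sameLast, hy.fst_tl.symm, hy.snd_tl.symm⟩
    · rw [map_zero, if_neg]
      rintro ⟨h₁, h₂, h₃⟩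
      obtain ⟨b', h⟩ := exists_leftExt_of_sameLast hp h₁
      have e : x = (γ.tl, α.tl) := Prod.ext h₂ h₃
      exact hy b' _ (e ▸ h)
  · congr 1
    rw [← ite_and]
    rcases hv with ⟨b, y, hy, rfl⟩ | ⟨hy, rfl⟩
    · rw [pcoef_pair _ _ hy.par]
      refine if_congr ⟨fun ⟨h₁, h₂, h₃⟩ => ?_, fun ⟨h₁, h₂⟩ => ?_⟩ rfl rfl
      · obtain ⟨b', h⟩ := exists_rightExt_of_sameFirst hp h₁
        have e : x = (γ.it, α.it) := Prod.ext h₂ h₃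
        rw [← e] at h
        have := hy.unique hI hne h
        rw [this]; exact ⟨rfl, rfl⟩
      · subst h₁ h₂
        exact ⟨hy.sameFirst, hy.fst_it.symm, hy.snd_it.symm⟩
    · rw [map_zero, if_neg]
      rintro ⟨h₁, h₂, h₃⟩
      obtain ⟨b', h⟩ := exists_rightExt_of_sameFirst hp h₁
      have e : x = (γ.it, α.it) := Prod.ext h₂ h₃
      exact hy b' _ (e ▸ h)

/-- A pair without extensions is a cocycle. -/
theorem parallelD_pair_eq_zero (hx : IsParallelPair I m x) (hl : ∀ b y, ¬ LeftExt I m b x y)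
    (hr : ∀ a y, ¬ RightExt I m a x y) : parallelD I m (pair I m x.1 x.2) = 0 := by
  classical
  refine ext_pcoef fun γ α hp => ?_
  rw [pcoef_parallelD _ hp.inΓm hp.snd_mem, pcoef_pair _ _ hx, pcoef_pair _ _ hx, map_zero,
    ← ite_and, ← ite_and, if_neg, if_neg]
  · simp
  · rintro ⟨h₁, h₂, h₃⟩
    obtain ⟨b', h⟩ := exists_rightExt_of_sameFirst hp h₁
    have e : x = (γ.it, α.it) := Prod.ext h₂ h₃
    exact hr b' _ (e ▸ h)
  · rintro ⟨h₁, h₂, h₃⟩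
    obtain ⟨b', h⟩ := exists_leftExt_of_sameLast hp h₁
    have e : x = (γ.tl, α.tl) := Prod.ext h₂ h₃
    exact hl b' _ (e ▸ h)

/-- The coefficient of a differential at a pair that is an extension both on the left and on the
right. -/
theorem pcoef_parallelD_of_ext {x' : Path Q × Path Q} (z : ParallelCochain I m)
    (h : LeftExt I m b x y) (h' : RightExt I m a x' y) :
    pcoef I (m + 1) y.1 y.2 (parallelD I m z) =
      pcoef I m x.1 x.2 z - (-1) ^ m * pcoef I m x'.1 x'.2 z := by
  rw [pcoef_parallelD _ h.par.inΓm h.par.snd_mem, if_pos h.sameLast, if_pos h'.sameFirst,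
    h.fst_tl, h.snd_tl, h'.fst_it, h'.snd_it]

theorem pcoef_parallelD_of_leftExt (z : ParallelCochain I m) (h : LeftExt I m b x y)
    (h' : ¬ y.1.SameFirst y.2) :
    pcoef I (m + 1) y.1 y.2 (parallelD I m z) = pcoef I m x.1 x.2 z := by
  rw [pcoef_parallelD _ h.par.inΓm h.par.snd_mem, if_pos h.sameLast, if_neg h', h.fst_tl, h.snd_tl]
  simp

theorem pcoef_parallelD_of_rightExt (z : ParallelCochain I m) (h : RightExt I m a x y)
    (h' : ¬ y.1.SameLast y.2) :
    pcoef I (m + 1) y.1 y.2 (parallelD I m z) = - ((-1) ^ m * pcoef I m x.1 x.2 z) := by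
  rw [pcoef_parallelD _ h.par.inΓm h.par.snd_mem, if_neg h', if_pos h.sameFirst, h.fst_it, h.snd_it]
  simp

theorem pcoef_parallelD_eq_zero (z : ParallelCochain I m) {γ α : Path Q}
    (h : ¬ γ.SameFirst α) (h' : ¬ γ.SameLast α) :
    pcoef I (m + 1) γ α (parallelD I m z) = 0 := by
  by_cases hp : IsParallelPair I (m + 1) (γ, α)
  · rw [pcoef_parallelD _ hp.inΓm hp.snd_mem, if_neg h, if_neg h']
    simp
  · exact pcoef_of_not hp _

end Extension

/-! ### Pairs with extensions on both sides, and pairs without extensions -/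

/-- A path whose consecutive arrows are related by `R` is maximal if it cannot be extended by an
arrow at either end. -/
theorem Path.eq_of_isSubpath {V : Type v} {E : Type w} {Q : ArrowQuiver V E} {R : E → E → Prop}
    {p q : Path Q} (hq : q.arrows.IsChain R)
    (hl : ∀ b, Q.s b = p.tgt → ¬ ∀ c, p.arrows.head? = some c → R b c)
    (hr : ∀ a, Q.t a = p.src → ¬ ∀ c, p.arrows.getLast? = some c → R c a)
    (h : p.IsSubpath q) : p = q := by
  obtain ⟨x, y, h₁, h₂, rfl⟩ := h
  have hy : y.arrows = [] := by
    by_contra hne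
    have hc := List.head?_eq_some_head hne
    refine hr (y.arrows.head hne) ?_ fun c hc' => ?_
    · rw [h₁, y.tgt_eq_head hc]
    · have := hq.right_of_append
      rw [Path.comp_arrows] at this
      exact (List.isChain_append.1 this).2.2 c hc' _ hc
  have hx : x.arrows = [] := by
    by_contra hne
    have hc := List.getLast?_eq_some_getLast hne
    refine hl (x.arrows.getLast hne) ?_ fun c hc' => ?_
    · rw [← x.src_eq_getLast hc, h₂, Path.comp_tgt]
    · refine (List.isChain_append.1 hq).2.2 _ hc c ?_
      rw [Path.comp_arrows, hy, List.append_nil]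
      exact hc'
  refine Path.ext_src ?_ (by simp [hx, hy])
  rw [Path.comp_src, Path.comp_src, h₁, y.src_eq_tgt hy]

section Squares

open PathAlgebra

variable {k : Type u} [Field k] {V : Type v} {E : Type w} [Fintype V] {Q : ArrowQuiver V E}
  {I : TwoSidedIdeal (PathAlgebra k Q)} {m : ℕ} {a b : E} {x y y' : Path Q × Path Q}

/-- If the extensions `y` and `y'` of `x` on the left and on the right exist, then so does the
extension of `x` on both sides, unless `x` belongs to a circuit. -/
theorem LeftExt.exists_square (hI : IsGentle I) (hx : x.1.arrows ≠ [] ∨ x.2.arrows ≠ [])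
    (h : LeftExt I m b x y) (h' : RightExt I m a x y') (hs : ¬ y'.1.SameLast y'.2) :
    ∃ w, LeftExt I (m + 1) b y' w ∧ RightExt I (m + 1) a y w := by
  have hp := h.parallel
  have hw : ∃ w, LeftExt I (m + 1) b y' w := by
    refine exists_leftExt h'.par ?_ (fun c hc => ?_) (fun c hc => ?_)
    · rw [h.source_eq, ← h'.fst_it, Path.it_tgt]
    · by_cases h₁ : x.1.arrows = []
      · obtain ⟨d, hd⟩ := (List.ne_nil_iff_exists_cons.1 (hx.resolve_left (not_not.2 h₁)))
        obtain ⟨l, hd⟩ := hd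
        have hd' : x.2.arrows.head? = some d := by rw [hd]; rfl
        rw [h'.fst_arrows, h₁] at hc
        obtain rfl : a = c := Option.some.inj hc
        by_contra hba
        obtain rfl := hI.right_notMem _ hba (h.notMem hd')
        exact hs ⟨a, by rw [h'.fst_arrows, h₁]; rfl, by rw [h'.snd_arrows, hd]; rfl⟩
      · rw [h'.fst_arrows, List.head?_append_of_ne_nil _ h₁] at hc
        exact h.mem hc
    · by_cases h₂ : x.2.arrows = []
      · obtain ⟨d, hd⟩ := (List.ne_nil_iff_exists_cons.1 (hx.resolve_right (not_not.2 h₂)))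
        obtain ⟨l, hd⟩ := hd
        have hd' : x.1.arrows.head? = some d := by rw [hd]; rfl
        rw [h'.snd_arrows, h₂] at hc
        obtain rfl : a = c := Option.some.inj hc
        intro hba
        have e : Q.t a = Q.s b := by
          rw [← h'.target_eq, h.source_eq, hp.src_eq, x.2.src_eq_tgt h₂, hp.tgt_eq]
        have e' : Q.t d = Q.s b := by rw [h.source_eq, x.1.tgt_eq_head hd']
        obtain rfl := hI.right_mem _ ⟨e, hba⟩ ⟨e', h.mem hd'⟩
        exact hs ⟨a, by rw [h'.fst_arrows, hd]; rfl, by rw [h'.snd_arrows, h₂]; rfl⟩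
      · rw [h'.snd_arrows, List.head?_append_of_ne_nil _ h₂] at hc
        exact h.notMem hc
  obtain ⟨w, hw⟩ := hw
  refine ⟨w, hw, hw.par, ?_, ?_, ?_, ?_⟩
  · rw [hw.fst_arrows, h'.fst_arrows, h.fst_arrows]; rfl
  · rw [hw.snd_arrows, h'.snd_arrows, h.snd_arrows]; rfl
  · refine (Path.eq_of_arrows ?_ (by rw [h.fst_arrows]; simp)).symm
    rw [Path.it_arrows, hw.fst_arrows, h'.fst_arrows, h.fst_arrows, ← List.cons_append,
      List.dropLast_concat]
  · refine (Path.eq_of_arrows ?_ (by rw [h.snd_arrows]; simp)).symm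
    rw [Path.it_arrows, hw.snd_arrows, h'.snd_arrows, h.snd_arrows, ← List.cons_append,
      List.dropLast_concat]

/-- If the extension of `x` on the right is also an extension of some pair on the left, then the
extension of `x` on the left is also an extension of some pair on the right; this is the case
that `x` belongs to a circuit. -/
theorem LeftExt.sameFirst_of_sameLast (hI : IsGentle I) (hx : x.1.arrows ≠ [] ∨ x.2.arrows ≠ [])
    (h : LeftExt I m b x y) (h' : RightExt I m a x y') (hs : y'.1.SameLast y'.2) :
    y.1.SameFirst y.2 := by
  obtain ⟨d, hd₁, hd₂⟩ := hs
  rw [h'.fst_arrows] at hd₁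
  rw [h'.snd_arrows] at hd₂
  by_cases h₁ : x.1.arrows = []
  · have h₂ := hx.resolve_left (not_not.2 h₁)
    rw [h₁] at hd₁
    obtain rfl : a = d := Option.some.inj hd₁
    rw [List.head?_append_of_ne_nil _ h₂] at hd₂
    have hc := List.getLast?_eq_some_getLast h₂
    refine ⟨b, by rw [h.fst_arrows, h₁]; rfl, ?_⟩
    rw [h.snd_arrows, List.getLast?_cons_of_ne_nil h₂, hc,
      hI.left_notMem _ (h.notMem hd₂) (h'.notMem hc)]
  · rw [List.head?_append_of_ne_nil _ h₁] at hd₁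
    by_cases h₂ : x.2.arrows = []
    · rw [h₂] at hd₂
      obtain rfl : a = d := Option.some.inj hd₂
      have hc := List.getLast?_eq_some_getLast h₁
      refine ⟨b, ?_, by rw [h.snd_arrows, h₂]; rfl⟩
      have e : Q.t a = Q.s b := by rw [h.source_eq, x.1.tgt_eq_head hd₁]
      have e' : Q.t a = Q.s (x.1.arrows.getLast h₁) := by
        rw [← h'.target_eq, x.1.src_eq_getLast hc]
      rw [h.fst_arrows, List.getLast?_cons_of_ne_nil h₁, hc,
        hI.left_mem _ ⟨e, h.mem hd₁⟩ ⟨e', h'.mem hc⟩]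
    · rw [List.head?_append_of_ne_nil _ h₂] at hd₂
      exact absurd ⟨d, hd₁, hd₂⟩ h.not_sameLast

/-- A pair whose extension on the right is also an extension of some pair on the left has an
extension on the left. -/
theorem RightExt.exists_leftExt (hx : x.1.arrows ≠ [] ∨ x.2.arrows ≠ [])
    (h' : RightExt I m a x y') (hs : y'.1.SameLast y'.2) (hs' : ¬ x.1.SameLast x.2) :
    ∃ b y, LeftExt I m b x y := by
  have hp := h'.parallel
  obtain ⟨d, hd₁, hd₂⟩ := hs
  rw [h'.fst_arrows] at hd₁
  rw [h'.snd_arrows] at hd₂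
  by_cases h₁ : x.1.arrows = []
  · have h₂ := hx.resolve_left (not_not.2 h₁)
    rw [h₁] at hd₁
    obtain rfl : a = d := Option.some.inj hd₁
    rw [List.head?_append_of_ne_nil _ h₂] at hd₂
    have hc := List.getLast?_eq_some_getLast h₂
    refine ⟨x.2.arrows.getLast h₂, GentleHH.exists_leftExt hp ?_ (by simp [h₁]) fun c hc' => ?_⟩
    · rw [← x.1.src_eq_tgt h₁, hp.src_eq, x.2.src_eq_getLast hc]
    · obtain rfl := Option.some.inj (hd₂.symm.trans hc')
      exact h'.notMem hc
  · rw [List.head?_append_of_ne_nil _ h₁] at hd₁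
    by_cases h₂ : x.2.arrows = []
    · rw [h₂] at hd₂
      obtain rfl : a = d := Option.some.inj hd₂
      have hc := List.getLast?_eq_some_getLast h₁
      refine ⟨x.1.arrows.getLast h₁, GentleHH.exists_leftExt hp ?_ (fun c hc' => ?_) (by simp [h₂])⟩
      · rw [hp.tgt_eq, ← x.2.src_eq_tgt h₂, ← hp.src_eq, x.1.src_eq_getLast hc]
      · obtain rfl := Option.some.inj (hd₁.symm.trans hc')
        exact h'.mem hc
    · rw [List.head?_append_of_ne_nil _ h₂] at hd₂
      exact absurd ⟨d, hd₁, hd₂⟩ hs'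

/-- A pair of one trivial and one nontrivial closed path, for which the latter is a cocomplete or
complete cycle. -/
theorem LeftExt.exists_cycle (hx : x.1.arrows ≠ [] ∨ x.2.arrows ≠ [])
    (h : LeftExt I m b x y) (hs : y.1.SameFirst y.2) (hs' : ¬ x.1.SameFirst x.2) :
    (∃ C : Cycle Q, IsCocomplete I C ∧ x = (Path.trivial C.src, C.toPath)) ∨
    (∃ C : Cycle Q, IsComplete I C ∧ x = (C.toPath, Path.trivial C.src)) := by
  have hp := h.parallel
  obtain ⟨d, hd₁, hd₂⟩ := hs
  rw [h.fst_arrows] at hd₁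
  rw [h.snd_arrows] at hd₂
  by_cases h₁ : x.1.arrows = []
  · have h₂ := hx.resolve_left (not_not.2 h₁)
    rw [h₁] at hd₁
    obtain rfl : b = d := Option.some.inj hd₁
    rw [List.getLast?_cons_of_ne_nil h₂] at hd₂
    let C : Cycle Q := ⟨x.2, hp.src_eq.symm.trans ((x.1.src_eq_tgt h₁).trans hp.tgt_eq), h₂⟩
    refine Or.inl ⟨C, ?_, Prod.ext ?_ rfl⟩
    · unfold IsCocomplete InB Path.power
      simp only [List.replicate_succ, List.replicate_zero, List.flatten_cons, List.flatten_nil,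
        List.append_nil]
      refine List.isChain_append.2 ⟨hp.snd_mem, hp.snd_mem, fun c hc d hd => ?_⟩
      obtain rfl := Option.some.inj (hd₂.symm.trans hc)
      exact h.notMem hd
    · exact (Path.eq_trivial h₁).trans (congrArg Path.trivial hp.src_eq)
  · rw [List.getLast?_cons_of_ne_nil h₁] at hd₁
    by_cases h₂ : x.2.arrows = []
    · rw [h₂] at hd₂
      obtain rfl : b = d := Option.some.inj hd₂
      let C : Cycle Q := ⟨x.1, hp.src_eq.trans ((x.2.src_eq_tgt h₂).trans hp.tgt_eq.symm), h₁⟩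
      refine Or.inr ⟨C, ?_, Prod.ext rfl ?_⟩
      · unfold IsComplete InΓ Path.power
        simp only [List.replicate_succ, List.replicate_zero, List.flatten_cons, List.flatten_nil,
          List.append_nil]
        refine List.isChain_append.2 ⟨hp.fst_mem, hp.fst_mem, fun c hc d hd => ?_⟩
        obtain rfl := Option.some.inj (hd₁.symm.trans hc)
        exact h.mem hd
      · exact (Path.eq_trivial h₂).trans (congrArg Path.trivial hp.src_eq.symm)
    · rw [List.getLast?_cons_of_ne_nil h₂] at hd₂
      exact absurd ⟨d, hd₁, hd₂⟩ hs'

/-- If a pair `(γ, α)` with `γ` nontrivial has no extensions, and `γ` and `α` neither begin nor end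
with the same arrow, then `γ` is `Γ`-maximal. -/
theorem IsGentle.isΓMaximal_of_not_ext (hI : IsGentle I) (hx : IsParallelPair I m x)
    (h₁ : x.1.arrows ≠ []) (hl : ∀ b y, ¬ LeftExt I m b x y) (hr : ∀ a y, ¬ RightExt I m a x y)
    (hsl : ¬ x.1.SameLast x.2) (hsf : ¬ x.1.SameFirst x.2) : IsΓMaximal I x.1 := by
  refine ⟨hx.fst_mem, fun q hq hs => Path.eq_of_isSubpath hq (fun b hb h => ?_)
    (fun a ha h => ?_) hs⟩
  · obtain ⟨y, hy⟩ := exists_leftExt hx hb h fun d hd hbd => by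
      have hc := List.head?_eq_some_head h₁
      have e := (x.1.tgt_eq_head hc).symm.trans hb.symm
      have e' := (x.2.tgt_eq_head hd).symm.trans (hx.tgt_eq.symm.trans hb.symm)
      obtain rfl := hI.right_mem _ ⟨e, h _ hc⟩ ⟨e', hbd⟩
      exact hsl ⟨_, hc, hd⟩
    exact hl _ _ hy
  · obtain ⟨y, hy⟩ := exists_rightExt hx ha.symm h fun d hd hbd => by
      have hc := List.getLast?_eq_some_getLast h₁
      have e := ha.trans (x.1.src_eq_getLast hc)
      have e' := ha.trans (hx.src_eq.trans (x.2.src_eq_getLast hd))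
      obtain rfl := hI.left_mem _ ⟨e, h _ hc⟩ ⟨e', hbd⟩
      exact hsf ⟨_, hc, hd⟩
    exact hr _ _ hy

/-- If a pair `(e_i, α)` with `α` nontrivial has no extensions, then `α` is `B`-maximal. -/
theorem isBMaximal_of_not_ext (hx : IsParallelPair I m x) (h₁ : x.1.arrows = [])
    (hl : ∀ b y, ¬ LeftExt I m b x y) (hr : ∀ a y, ¬ RightExt I m a x y) : IsBMaximal I x.2 := by
  refine ⟨hx.snd_mem, fun q hq hs => Path.eq_of_isSubpath hq (fun b hb h => ?_)
    (fun a ha h => ?_) hs⟩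
  · obtain ⟨y, hy⟩ := exists_leftExt hx (hb.trans hx.tgt_eq.symm) (by simp [h₁]) h
    exact hl _ _ hy
  · obtain ⟨y, hy⟩ := exists_rightExt hx (hx.src_eq.trans ha.symm) (by simp [h₁]) h
    exact hr _ _ hy

theorem LeftExt.isSubpath_fst (h : LeftExt I m b x y) : x.1.IsSubpath y.1 := by
  have e : x.1.src = (Path.trivial x.1.src : Path Q).tgt := rfl
  have e' : (Path.ofArrow b : Path Q).src = (x.1.comp _ e).tgt := h.source_eq
  refine ⟨_, _, e, e', Path.eq_of_arrows ?_ (by simp [h.fst_arrows])⟩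
  simp [h.fst_arrows]

theorem LeftExt.isSubpath_snd (h : LeftExt I m b x y) : x.2.IsSubpath y.2 := by
  have e : x.2.src = (Path.trivial x.2.src : Path Q).tgt := rfl
  have e' : (Path.ofArrow b : Path Q).src = (x.2.comp _ e).tgt :=
    h.source_eq.trans h.parallel.tgt_eq
  refine ⟨_, _, e, e', Path.eq_of_arrows ?_ (by simp [h.snd_arrows])⟩
  simp [h.snd_arrows]

theorem RightExt.isSubpath_fst (h : RightExt I m a x y) : x.1.IsSubpath y.1 := by
  have e : x.1.src = (Path.ofArrow a : Path Q).tgt := h.target_eq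
  have e' : (Path.trivial x.1.tgt : Path Q).src = (x.1.comp _ e).tgt := rfl
  refine ⟨_, _, e, e', Path.eq_of_arrows ?_ (by simp [h.fst_arrows])⟩
  simp [h.fst_arrows]

theorem RightExt.isSubpath_snd (h : RightExt I m a x y) : x.2.IsSubpath y.2 := by
  have e : x.2.src = (Path.ofArrow a : Path Q).tgt := h.parallel.src_eq.symm.trans h.target_eq
  have e' : (Path.trivial x.2.tgt : Path Q).src = (x.2.comp _ e).tgt := rfl
  refine ⟨_, _, e, e', Path.eq_of_arrows ?_ (by simp [h.snd_arrows])⟩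
  simp [h.snd_arrows]

theorem not_leftExt_of_isΓMaximal (hx : IsΓMaximal I x.1) : ¬ LeftExt I m b x y := fun h => by
  have := h.fst_arrows
  rw [← hx.2 y.1 h.par.fst_mem h.isSubpath_fst] at this
  simp at this

theorem not_rightExt_of_isΓMaximal (hx : IsΓMaximal I x.1) : ¬ RightExt I m a x y := fun h => by
  have := h.fst_arrows
  rw [← hx.2 y.1 h.par.fst_mem h.isSubpath_fst] at this
  simp at this

theorem not_leftExt_of_isBMaximal (hx : IsBMaximal I x.2) : ¬ LeftExt I m b x y := fun h => by
  have := h.snd_arrows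
  rw [← hx.2 y.2 h.par.snd_mem h.isSubpath_snd] at this
  simp at this

theorem not_rightExt_of_isBMaximal (hx : IsBMaximal I x.2) : ¬ RightExt I m a x y := fun h => by
  have := h.snd_arrows
  rw [← hx.2 y.2 h.par.snd_mem h.isSubpath_snd] at this
  simp at this

end Squares

/-! ### Circuits -/

section Circuits

variable {V : Type v} {E : Type w} {Q : ArrowQuiver V E}

theorem isChain_append_self_rotate {R : E → E → Prop} {l : List E} (h : (l ++ l).IsChain R) :
    (l.rotate 1 ++ l.rotate 1).IsChain R := by
  cases l with
  | nil => simp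
  | cons c t =>
    have h₁ : ((c :: t) ++ ((c :: t) ++ (c :: t))).IsChain R := by
      refine List.isChain_append.2 ⟨h.left_of_append, h, fun b hb d hd => ?_⟩
      exact (List.isChain_append.1 h).2.2 b hb d hd
    refine h₁.infix ⟨[c], t, ?_⟩
    simp

/-- If a closed word can be traversed twice, it can be traversed any number of times. -/
theorem isChain_flatten_replicate {R : E → E → Prop} {l : List E} (h : (l ++ l).IsChain R) (n : ℕ) :
    (List.replicate n l).flatten.IsChain R := by
  induction n with
  | zero => exact List.IsChain.nil
  | succ n ih =>
    rw [List.replicate_succ, List.flatten_cons]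
    refine List.isChain_append.2 ⟨h.left_of_append, ih, fun b hb d hd => ?_⟩
    refine (List.isChain_append.1 h).2.2 b hb d ?_
    cases n with
    | zero => simp at hd
    | succ n =>
      rw [List.replicate_succ, List.flatten_cons] at hd
      cases l with
      | nil => simp at hb
      | cons c l => exact hd

theorem flatten_replicate_concat (n : ℕ) (c : E) (l : List E) :
    (List.replicate n (c :: l)).flatten ++ [c] = c :: (List.replicate n (l ++ [c])).flatten := by
  induction n with
  | zero => rfl
  | succ n ih =>
    rw [List.replicate_succ, List.flatten_cons, List.append_assoc, ih, List.replicate_succ,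
      List.flatten_cons]
    simp

theorem rotate_flatten_replicate (n : ℕ) (l : List E) :
    (List.replicate n l).flatten.rotate 1 = (List.replicate n (l.rotate 1)).flatten := by
  cases l with
  | nil => simp
  | cons c l =>
    cases n with
    | zero => rfl
    | succ n =>
      have h := flatten_replicate_concat (n + 1) c l
      rw [List.replicate_succ, List.flatten_cons, List.cons_append, List.cons_append,
        List.cons.injEq] at h
      rw [List.replicate_succ, List.flatten_cons, List.cons_append, List.rotate_cons_succ,
        List.rotate_zero, List.rotate_cons_succ, List.rotate_zero]
      exact h.2

/-- A list of length `g n` that agrees with its shift by `g` is a power of a list of length `g`. -/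
theorem eq_flatten_replicate_take {g : ℕ} (n : ℕ) {l : List E} (hl : l.length = g * n)
    (h : ∀ i, i + g < l.length → l[i]? = l[i + g]?) :
    l = (List.replicate n (l.take g)).flatten := by
  induction n generalizing l with
  | zero => simpa using hl
  | succ n ih =>
    rw [List.replicate_succ, List.flatten_cons]
    have h₁ := ih (l := l.drop g) (by rw [List.length_drop, hl, Nat.mul_succ]; omega) fun i hi => by
      rw [List.length_drop] at hi
      rw [List.getElem?_drop, List.getElem?_drop, ← add_assoc, add_comm g i, add_right_comm i g g]
      exact h (i + g) (by omega)
    cases n with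
    | zero =>
      simp only [List.replicate_zero, List.flatten_nil, List.append_nil]
      exact (List.take_of_length_le (by omega)).symm
    | succ n =>
      have h₂ : (l.drop g).take g = l.take g := by
        refine List.ext_getElem? fun i => ?_
        rw [List.getElem?_take, List.getElem?_take]
        split_ifs with hi
        · rw [List.getElem?_drop, add_comm]
          refine (h i ?_).symm
          rw [hl]; nlinarith
        · rfl
      rw [h₂] at h₁
      rw [← h₁, List.take_append_drop]

namespace Cycle

theorem ext_arrows {C D : Cycle Q} (h : C.arrows = D.arrows) : C = D := by
  have e : C.toPath = D.toPath := Path.eq_of_arrows h C.pos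
  obtain ⟨p, hp, hp'⟩ := C
  obtain ⟨q, hq, hq'⟩ := D
  obtain rfl : p = q := e
  rfl

theorem toPath_injective : Function.Injective (Cycle.toPath (Q := Q)) := fun _ _ h =>
  ext_arrows (congrArg Path.arrows h)

theorem rot_arrows (C : Cycle Q) : C.rot.arrows = C.arrows.rotate 1 := by
  have h : C.arrows = C.arrows.head C.pos :: C.arrows.tail := (List.cons_head_tail C.pos).symm
  conv_rhs => rw [h, List.rotate_cons_succ, List.rotate_zero]
  rfl

theorem rot_iterate_arrows (C : Cycle Q) (n : ℕ) : (rot^[n] C).arrows = C.arrows.rotate n := by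
  induction n with
  | zero => simp
  | succ n ih => rw [Function.iterate_succ_apply', rot_arrows, ih, List.rotate_rotate]

theorem rot_iterate_length_self (C : Cycle Q) : rot^[C.length] C = C :=
  ext_arrows (by rw [rot_iterate_arrows]; exact List.rotate_length _)

theorem length_pos (C : Cycle Q) : 0 < C.length := List.length_pos_iff.2 C.pos

theorem period_pos (C : Cycle Q) : 0 < C.period :=
  Function.minimalPeriod_pos_of_mem_periodicPts ⟨_, C.length_pos, C.rot_iterate_length_self⟩

theorem rot_iterate_period (C : Cycle Q) : rot^[C.period] C = C :=
  Function.iterate_minimalPeriod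

theorem rot_length (C : Cycle Q) : C.rot.length = C.length := by
  rw [Path.length, rot_arrows, List.length_rotate]; rfl

theorem rot_iterate_length (C : Cycle Q) (n : ℕ) : (rot^[n] C).length = C.length := by
  rw [Path.length, rot_iterate_arrows, List.length_rotate]; rfl

theorem IsConj.refl (C : Cycle Q) : C.IsConj C := ⟨0, rfl⟩

/-- The positive powers of a cycle. -/
def pow (C : Cycle Q) (n : ℕ) (hn : n ≠ 0) : Cycle Q where
  toPath := C.power C.closed n
  closed := rfl
  pos := by
    obtain ⟨n, rfl⟩ := Nat.exists_eq_succ_of_ne_zero hn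
    simp [Path.power, C.pos]

theorem pow_arrows (C : Cycle Q) {n : ℕ} (hn : n ≠ 0) :
    (C.pow n hn).arrows = (List.replicate n C.arrows).flatten := rfl

theorem rot_pow (C : Cycle Q) {n : ℕ} (hn : n ≠ 0) : (C.pow n hn).rot = C.rot.pow n hn :=
  ext_arrows (by
    rw [rot_arrows, pow_arrows, pow_arrows, rotate_flatten_replicate, ← rot_arrows])

theorem rot_iterate_pow (C : Cycle Q) {n : ℕ} (hn : n ≠ 0) (j : ℕ) :
    rot^[j] (C.pow n hn) = (rot^[j] C).pow n hn := by
  induction j with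
  | zero => rfl
  | succ j ih => rw [Function.iterate_succ_apply', ih, rot_pow, Function.iterate_succ_apply']

theorem length_pow (C : Cycle Q) {n : ℕ} (hn : n ≠ 0) : (C.pow n hn).length = n * C.length := by
  rw [Path.length, pow_arrows]; simp [Path.length]

theorem pow_left_injective {C D : Cycle Q} {n : ℕ} (hn : n ≠ 0) (h : C.pow n hn = D.pow n hn) :
    C = D := by
  have hl : C.length = D.length := by
    have := congrArg (fun F : Cycle Q => F.length) h
    simp only [length_pow] at this
    exact Nat.eq_of_mul_eq_mul_left (Nat.pos_of_ne_zero hn) this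
  obtain ⟨n, rfl⟩ := Nat.exists_eq_succ_of_ne_zero hn
  have := congrArg (fun F : Cycle Q => F.arrows) h
  simp only [pow_arrows, Nat.succ_eq_add_one, List.replicate_succ, List.flatten_cons] at this
  exact ext_arrows (List.append_inj_left this hl)

theorem period_pow (C : Cycle Q) {n : ℕ} (hn : n ≠ 0) : (C.pow n hn).period = C.period := by
  refine Nat.dvd_antisymm (Function.IsPeriodicPt.minimalPeriod_dvd ?_)
    (Function.IsPeriodicPt.minimalPeriod_dvd ?_)
  · show rot^[C.period] _ = _
    rw [rot_iterate_pow, rot_iterate_period]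
  · have h := rot_iterate_period (C.pow n hn)
    rw [rot_iterate_pow] at h
    exact pow_left_injective hn h

/-- Every cycle is a power of a cycle whose length is its period. -/
theorem exists_eq_pow (C : Cycle Q) :
    ∃ (D : Cycle Q) (n : ℕ) (hn : n ≠ 0), C = D.pow n hn ∧ D.length = C.period := by
  obtain ⟨n, hn⟩ : C.period ∣ C.length :=
    Function.IsPeriodicPt.minimalPeriod_dvd C.rot_iterate_length_self
  have hn0 : n ≠ 0 := by rintro rfl; exact C.length_pos.ne' (by simpa using hn)
  have hle : C.period ≤ C.length := hn ▸ Nat.le_mul_of_pos_right _ (Nat.pos_of_ne_zero hn0)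
  have e := eq_flatten_replicate_take (g := C.period) n (l := C.arrows) hn fun i hi => by
    have h := C.rot_iterate_arrows C.period
    rw [rot_iterate_period] at h
    conv_lhs => rw [h]
    rw [List.getElem?_rotate (by omega), Nat.mod_eq_of_lt hi]
  set d := C.arrows.take C.period with hd
  have hdl : d.length = C.period := by rw [hd, List.length_take]; exact min_eq_left hle
  have hdne : d ≠ [] := by
    intro h; rw [h] at hdl; exact C.period_pos.ne' hdl.symm
  have hlast : C.arrows.getLast C.pos = d.getLast hdne := by
    obtain ⟨n, rfl⟩ := Nat.exists_eq_succ_of_ne_zero hn0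
    have : C.arrows = (List.replicate n d).flatten ++ d := by
      rw [e, Nat.succ_eq_add_one, List.replicate_succ']; simp
    rw [List.getLast_congr _ (by simp [hdne]) this, List.getLast_append_of_ne_nil _ hdne]
  -- the walk `d` starts at the source of its first arrow, which is the first arrow of `C`
  have hw : Q.IsWalk d C.src C.src := by
    have h₁ : ∃ y, Q.IsWalk d y C.tgt := by
      have hC := C.isWalk
      rw [← List.take_append_drop C.period C.arrows, ← hd] at hC
      clear_value d
      generalize C.tgt = z at hC
      clear hd hdl hdne hlast e
      induction d generalizing z with
      | nil => exact ⟨z, rfl⟩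
      | cons c d ih =>
        obtain ⟨y, hy⟩ := ih _ hC.2
        exact ⟨y, hC.1, hy⟩
    obtain ⟨y, hy⟩ := h₁
    have hs := hy.source_getLast hdne
    rw [← hlast, C.isWalk.source_getLast C.pos] at hs
    rw [← hs, ← C.closed] at hy
    exact hy
  exact ⟨⟨⟨C.src, C.src, d, hw⟩, rfl, hdne⟩, n, hn0, ext_arrows e, hdl⟩

theorem IsPrimitive.period_eq {C : Cycle Q} (h : C.IsPrimitive) : C.period = C.length := by
  obtain ⟨D, n, hn, e, hD⟩ := C.exists_eq_pow
  have := h D n (congrArg Cycle.toPath e)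
  subst this
  rw [← hD]
  have h₁ : C.length = (D.pow 1 hn).length := congrArg (fun F : Cycle Q => F.length) e
  rw [h₁, length_pow, one_mul]

theorem isPrimitive_of_period {C : Cycle Q} (h : C.period = C.length) : C.IsPrimitive := by
  intro D n e
  have hn : n ≠ 0 := by
    rintro rfl
    exact C.pos (congrArg Path.arrows e)
  obtain rfl : C = D.pow n hn := toPath_injective e
  rw [period_pow, length_pow] at h
  have h₁ : D.period ≤ D.length := Nat.le_of_dvd D.length_pos
    (Function.IsPeriodicPt.minimalPeriod_dvd D.rot_iterate_length_self)
  have := D.length_pos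
  by_contra h'
  have : 2 ≤ n := by omega
  nlinarith

theorem firstArrow_eq (C : Cycle Q) : C.arrows.getLast? = some C.firstArrow :=
  List.getLast?_eq_some_getLast C.pos

theorem firstArrow_rot (C : Cycle Q) : C.arrows.head? = some C.rot.firstArrow := by
  rw [List.head?_eq_some_head C.pos]
  simp [firstArrow, rot]

theorem firstMul_arrows (C : Cycle Q) : C.firstMul.arrows = C.firstArrow :: C.arrows := rfl

theorem firstMul_tl (C : Cycle Q) : C.firstMul.tl = C.toPath := Path.tl_cons _ _ _

theorem firstMul_rot_arrows (C : Cycle Q) :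
    C.rot.firstMul.arrows = C.arrows ++ [C.rot.firstArrow] := by
  rw [firstMul_arrows]
  have h := List.cons_head?_tail C.firstArrow_rot
  conv_rhs => rw [← h]
  simp only [List.cons_append, List.cons.injEq, true_and]
  have := C.firstArrow_rot
  rw [List.head?_eq_some_head C.pos] at this
  rw [← Option.some.inj this]
  rfl

theorem firstMul_rot_it (C : Cycle Q) : C.rot.firstMul.it = C.toPath :=
  (Path.eq_of_arrows (by rw [Path.it_arrows, firstMul_rot_arrows, List.dropLast_concat]) C.pos).symm

theorem firstMul_injective : Function.Injective (firstMul (Q := Q)) := fun C D h =>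
  toPath_injective ((C.firstMul_tl).symm.trans ((congrArg Path.tl h).trans D.firstMul_tl))

theorem firstMul_getLast (C : Cycle Q) : C.firstMul.arrows.getLast? = some C.firstArrow := by
  rw [C.firstMul_arrows, List.getLast?_cons_of_ne_nil C.pos, C.firstArrow_eq]

theorem ofArrow_ne_firstMul (c : E) (C : Cycle Q) : Path.ofArrow c ≠ C.firstMul := fun h => by
  have := congrArg Path.arrows h
  rw [C.firstMul_arrows] at this
  exact C.pos (List.cons.inj this).2.symm

end Cycle

theorem Path.ofArrow_tl (c : E) : (Path.ofArrow c : Path Q).tl = Path.trivial (Q.s c) :=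
  Path.ext_src (by simp) (by simp)

theorem Path.ofArrow_it (c : E) : (Path.ofArrow c : Path Q).it = Path.trivial (Q.t c) :=
  Path.ext_tgt (by simp) (by simp)

end Circuits

section CircuitFamilies

open PathAlgebra

variable {k : Type u} [Field k] {V : Type v} {E : Type w} [Fintype V] {Q : ArrowQuiver V E}
  {I : TwoSidedIdeal (PathAlgebra k Q)}

theorem isCocomplete_iff {C : Cycle Q} : IsCocomplete I C ↔
    (C.arrows ++ C.arrows).IsChain fun b a => ofArrow k Q b * ofArrow k Q a ∉ I := by
  unfold IsCocomplete InB Path.power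
  simp [List.replicate_succ]

theorem isComplete_iff {C : Cycle Q} : IsComplete I C ↔
    (C.arrows ++ C.arrows).IsChain fun b a => ofArrow k Q b * ofArrow k Q a ∈ I := by
  unfold IsComplete InΓ Path.power
  simp [List.replicate_succ]

theorem IsCocomplete.rot {C : Cycle Q} (h : IsCocomplete I C) : IsCocomplete I C.rot := by
  rw [isCocomplete_iff] at h ⊢
  rw [Cycle.rot_arrows]
  exact isChain_append_self_rotate h

theorem IsComplete.rot {C : Cycle Q} (h : IsComplete I C) : IsComplete I C.rot := by
  rw [isComplete_iff] at h ⊢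
  rw [Cycle.rot_arrows]
  exact isChain_append_self_rotate h

variable (I) in
/-- A set `Z` of cycles, closed under rotation, with pairs of paths `x C` and `y C` for all `C` in
`Z`, such that the extensions of `x C` on the left and on the right are `y C` and `y (rot C)`. The
pairs `x C` and `y C`, for `C` in one circuit, thus are the vertices and the edges of a cyclic
graph. -/
structure IsCircuitFamily (m : ℕ) (Z : Set (Cycle Q)) (x y : Cycle Q → Path Q × Path Q) :
    Prop where
  rot : ∀ C ∈ Z, C.rot ∈ Z
  left : ∀ C ∈ Z, ∃ b, LeftExt I m b (x C) (y C)
  right : ∀ C ∈ Z, ∃ a, RightExt I m a (x C) (y C.rot)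
  ne : ∀ C ∈ Z, (x C).1.arrows ≠ [] ∨ (x C).2.arrows ≠ []
  injective_x : Function.Injective x

theorem IsCircuitFamily.rot_iterate {m : ℕ} {Z : Set (Cycle Q)} {x y : Cycle Q → Path Q × Path Q}
    {C : Cycle Q} (hF : IsCircuitFamily I m Z x y) (hC : C ∈ Z) (n : ℕ) :
    Cycle.rot^[n] C ∈ Z := by
  induction n with
  | zero => exact hC
  | succ n ih => rw [Function.iterate_succ_apply']; exact hF.rot _ ih

/-- The pairs `(e, C)` and `(c, c C)` of a cocomplete cycle `C` with first arrow `c`. -/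
theorem isCircuitFamily_isCocomplete : IsCircuitFamily I 0 {C | IsCocomplete I C}
    (fun C => (Path.trivial C.src, C.toPath))
    (fun C => (Path.ofArrow C.firstArrow, C.firstMul)) := by
  have hpar : ∀ C : Cycle Q, IsCocomplete I C →
      IsParallelPair I 1 (Path.ofArrow C.firstArrow, C.firstMul) := by
    intro C hC
    refine ⟨List.isChain_singleton _, rfl, List.isChain_cons.2 ⟨fun d hd => ?_, ?_⟩, ?_, rfl⟩
    · exact (List.isChain_append.1 (isCocomplete_iff.1 hC)).2.2 _ C.firstArrow_eq d hd
    · exact (isCocomplete_iff.1 hC).left_of_append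
    · exact (C.src_eq_getLast C.firstArrow_eq).symm
  refine ⟨fun C hC => hC.rot, fun C hC => ⟨C.firstArrow, hpar C hC, rfl, rfl, ?_, C.firstMul_tl⟩,
    fun C hC => ⟨C.rot.firstArrow, hpar _ hC.rot, rfl, C.firstMul_rot_arrows, ?_,
      C.firstMul_rot_it⟩, fun C _ => Or.inr C.pos, fun C D h => ?_⟩
  · refine (Path.ofArrow_tl _).trans (congrArg _ ?_)
    exact (C.src_eq_getLast C.firstArrow_eq).symm
  · refine (Path.ofArrow_it _).trans (congrArg _ ?_)
    exact (C.tgt_eq_head C.firstArrow_rot).symm.trans C.closed.symm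
  · exact Cycle.toPath_injective (congrArg Prod.snd h)

/-- The pairs `(C, e)` and `(c C, c)` of a complete cycle `C` with first arrow `c`. -/
theorem isCircuitFamily_isComplete (m : ℕ) : IsCircuitFamily I m {C | IsComplete I C ∧ C.length = m}
    (fun C => (C.toPath, Path.trivial C.src))
    (fun C => (C.firstMul, Path.ofArrow C.firstArrow)) := by
  have hpar : ∀ C : Cycle Q, IsComplete I C → C.length = m →
      IsParallelPair I (m + 1) (C.firstMul, Path.ofArrow C.firstArrow) := by
    intro C hC hm
    refine ⟨List.isChain_cons.2 ⟨fun d hd => ?_, ?_⟩, congrArg (· + 1) hm,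
      List.isChain_singleton _, ?_, rfl⟩
    · exact (List.isChain_append.1 (isComplete_iff.1 hC)).2.2 _ C.firstArrow_eq d hd
    · exact (isComplete_iff.1 hC).left_of_append
    · exact C.src_eq_getLast C.firstArrow_eq
  refine ⟨fun C hC => ⟨hC.1.rot, C.rot_length.trans hC.2⟩,
    fun C hC => ⟨C.firstArrow, hpar C hC.1 hC.2, rfl, rfl, C.firstMul_tl, ?_⟩,
    fun C hC => ⟨C.rot.firstArrow, hpar _ hC.1.rot (C.rot_length.trans hC.2),
      C.firstMul_rot_arrows, rfl, C.firstMul_rot_it, ?_⟩,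
    fun C _ => Or.inl C.pos, fun C D h => ?_⟩
  · refine (Path.ofArrow_tl _).trans (congrArg _ ?_)
    exact (C.src_eq_getLast C.firstArrow_eq).symm
  · refine (Path.ofArrow_it _).trans (congrArg _ ?_)
    exact (C.tgt_eq_head C.firstArrow_rot).symm.trans C.closed.symm
  · exact Cycle.toPath_injective (congrArg Prod.fst h)

/-- `X` is a set of representatives of the circuits contained in `Z`. -/
def IsCircuitReps (Z X : Set (Cycle Q)) : Prop :=
  (∀ C ∈ X, C ∈ Z) ∧ ∀ C ∈ Z, ∃! D, D ∈ X ∧ C.IsConj D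

theorem IsCompleteReps.isCircuitReps {X : Set (Cycle Q)} (h : IsCompleteReps I X) :
    IsCircuitReps {C | IsComplete I C} X := ⟨h.1, h.2.1⟩

/-- The powers of the chosen primitive cocomplete cycles represent all cocomplete circuits, since
every cycle is a power of exactly one primitive cycle, whose length is the period. -/
theorem IsCocompleteReps.isCircuitReps {X : Set (Cycle Q)} (h : IsCocompleteReps I X) :
    IsCircuitReps {C | IsCocomplete I C} X := by
  obtain ⟨P, hP, hex, rfl⟩ := h
  have hX : ∀ D n (hn : n ≠ 0), D ∈ P →
      (D.pow n hn) ∈ {C : Cycle Q | ∃ D ∈ P, ∃ n : ℕ, 1 ≤ n ∧ C.toPath = D.power D.closed n} :=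
    fun D n hn hD => ⟨D, hD, n, Nat.one_le_iff_ne_zero.2 hn, rfl⟩
  refine ⟨?_, fun C hC => ?_⟩
  · rintro C ⟨D, hD, n, hn, e⟩
    obtain rfl : C = D.pow n (Nat.one_le_iff_ne_zero.1 hn) := Cycle.toPath_injective e
    refine isCocomplete_iff.2 ?_
    rw [Cycle.pow_arrows, ← List.flatten_append, List.replicate_append_replicate]
    exact isChain_flatten_replicate (isCocomplete_iff.1 (hP D hD).2) _
  obtain ⟨D, n, hn, rfl, hl⟩ := C.exists_eq_pow
  have hDp : D.IsPrimitive := Cycle.isPrimitive_of_period (by rw [hl, Cycle.period_pow])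
  have hDc : IsCocomplete I D := by
    refine isCocomplete_iff.2 ((isCocomplete_iff.1 hC).infix ?_)
    obtain ⟨n, rfl⟩ := Nat.exists_eq_succ_of_ne_zero hn
    refine ⟨(List.replicate n D.arrows).flatten, (List.replicate n D.arrows).flatten, ?_⟩
    have h₁ : ((D.pow n.succ hn).arrows : List E) =
        (List.replicate n D.arrows).flatten ++ D.arrows := by
      rw [Cycle.pow_arrows, Nat.succ_eq_add_one, List.replicate_succ']; simp
    have h₂ : ((D.pow n.succ hn).arrows : List E) =
        D.arrows ++ (List.replicate n D.arrows).flatten := by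
      rw [Cycle.pow_arrows, Nat.succ_eq_add_one, List.replicate_succ]; simp
    conv_rhs => arg 1; rw [h₁]
    conv_rhs => arg 2; rw [h₂]
    simp
  obtain ⟨D₀, ⟨hD₀, j, rfl⟩, huniq⟩ := hex D hDp hDc
  refine ⟨_, ⟨hX _ n hn hD₀, j, Cycle.rot_iterate_pow D hn j⟩, ?_⟩
  rintro F ⟨⟨D₁, hD₁, n₁, hn₁, e⟩, i, hi⟩
  obtain rfl : F = D₁.pow n₁ (Nat.one_le_iff_ne_zero.1 hn₁) := Cycle.toPath_injective e
  have hn₁' := Nat.one_le_iff_ne_zero.1 hn₁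
  rw [Cycle.rot_iterate_pow] at hi
  -- the primitive roots have the same length, the period
  have hlen : (Cycle.rot^[i] D).length = D₁.length := by
    have h₁ := congrArg Cycle.period hi
    rw [Cycle.period_pow, Cycle.period_pow, (hP D₁ hD₁).1.period_eq] at h₁
    rw [← h₁, Cycle.rot_iterate_length, ← hDp.period_eq]
    exact (Function.minimalPeriod_apply_iterate
      (Function.mk_mem_periodicPts D.length_pos D.rot_iterate_length_self) i).symm
  have hnn : n = n₁ := by
    have h₁ := congrArg (fun F : Cycle Q => F.length) hi
    simp only [Cycle.length_pow, hlen] at h₁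
    exact Nat.eq_of_mul_eq_mul_right D₁.length_pos h₁
  subst hnn
  have e₁ := Cycle.pow_left_injective hn hi
  have := huniq D₁ ⟨hD₁, i, e₁⟩
  rw [this]

end CircuitFamilies

/-! ### The graph cohomology of the quiver and of the circuits -/

section Tree

variable {V : Type v} {E : Type w} {Q : ArrowQuiver V E} {T : Set E}

/-- A function on the vertices that takes the same value at both ends of the arrows of a spanning
tree is constant. -/
theorem ArrowQuiver.IsSpanningTree.eq_of_forall_mem (hT : Q.IsSpanningTree T) {X : Type*}
    {p : V → X} (h : ∀ c ∈ T, p (Q.s c) = p (Q.t c)) (x y : V) : p x = p y := by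
  obtain ⟨W⟩ := hT.isTree.connected.preconnected x y
  induction W with
  | nil => rfl
  | cons hadj _ ih =>
    rw [← ih]
    obtain ⟨⟨c, hc, e⟩, -⟩ := (SimpleGraph.fromEdgeSet_adj _).1 hadj
    rcases Sym2.eq_iff.1 e with ⟨rfl, rfl⟩ | ⟨rfl, rfl⟩
    · exact h c hc
    · exact (h c hc).symm

/-- Removing an arrow `c` from a spanning tree leaves two components; `p` is the characteristic
function of the component of the source of `c`. -/
theorem ArrowQuiver.IsSpanningTree.exists_potential (hT : Q.IsSpanningTree T) (k : Type*) [Ring k]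
    {c : E} (hc : c ∈ T) : ∃ p : V → k, p (Q.s c) - p (Q.t c) = 1 ∧
      ∀ d ∈ T, d ≠ c → p (Q.s d) = p (Q.t d) := by
  classical
  set G := SimpleGraph.fromEdgeSet ((fun c => s(Q.s c, Q.t c)) '' T) with hG
  set G' := G.deleteEdges {s(Q.s c, Q.t c)} with hG'
  have hadj : ∀ d ∈ T, G.Adj (Q.s d) (Q.t d) := fun d hd =>
    (SimpleGraph.fromEdgeSet_adj _).2 ⟨⟨d, hd, rfl⟩, hT.no_loop d hd⟩
  have hb : ¬ G'.Reachable (Q.s c) (Q.t c) :=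
    (SimpleGraph.isBridge_iff.1 (SimpleGraph.isAcyclic_iff_forall_isBridge.1 hT.isTree.isAcyclic
      (hadj c hc)))
  refine ⟨fun x => if G'.Reachable (Q.s c) x then 1 else 0, ?_, fun d hd hdc => ?_⟩
  · simp [hb]
  · have h' : G'.Adj (Q.s d) (Q.t d) := by
      refine SimpleGraph.deleteEdges_adj.2 ⟨hadj d hd, fun h => hdc (hT.injOn hd hc h)⟩
    refine if_congr ⟨fun h => h.trans h'.reachable, fun h => h.trans h'.symm.reachable⟩ rfl rfl

theorem ArrowQuiver.IsSpanningTree.exists_incident (hT : Q.IsSpanningTree T) [hE : Nonempty E]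
    (x : V) : ∃ c, Q.s c = x ∨ Q.t c = x := by
  classical
  by_contra! h
  obtain ⟨c⟩ := hE
  have := hT.eq_of_forall_mem (p := fun y => decide (y = x))
    (fun d _ => by simp [h d]) x (Q.s c)
  simp [h c] at this

end Tree

section GraphCohomology

open PathAlgebra

variable {k : Type u} [Field k] {V : Type v} {E : Type w} [Fintype V] {Q : ArrowQuiver V E}
  {I : TwoSidedIdeal (PathAlgebra k Q)}

theorem isParallelPair_trivial (x : V) : IsParallelPair I 0 (Path.trivial x, Path.trivial x) :=
  ⟨List.IsChain.nil, rfl, List.IsChain.nil, rfl, rfl⟩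

theorem isParallelPair_ofArrow (c : E) : IsParallelPair I 1 (Path.ofArrow c, Path.ofArrow c) :=
  ⟨List.isChain_singleton _, rfl, List.isChain_singleton _, rfl, rfl⟩

variable (I) in
/-- A function on the vertices, as an element of `k (Γ_0 ∥ B)` supported on the pairs
`(e_x, e_x)`. -/
noncomputable def vertexCochain (p : V → k) : ParallelCochain I 0 :=
  ∑ x, p x • pair I 0 (Path.trivial x) (Path.trivial x)

open Classical in
theorem pcoef_vertexCochain (p : V → k) (x : V) (α : Path Q) :
    pcoef I 0 (Path.trivial x) α (vertexCochain I p) = if α = Path.trivial x then p x else 0 := by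
  rw [vertexCochain, map_sum, Finset.sum_eq_single x]
  · rw [map_smul, pcoef_pair _ _ (isParallelPair_trivial x)]
    simp [eq_comm]
  · intro y _ hy
    rw [map_smul, pcoef_pair _ _ (isParallelPair_trivial y), if_neg, smul_zero]
    rintro ⟨h, -⟩
    exact hy (congrArg Path.src h)
  · simp

namespace IsCircuitFamily

variable {m : ℕ} {Z : Set (Cycle Q)} {x y : Cycle Q → Path Q × Path Q} {C : Cycle Q}

open Classical in
theorem pcoef_sum (hF : IsCircuitFamily I m Z x y) (hC : C ∈ Z) (D : Cycle Q) :
    pcoef I m (x D).1 (x D).2 (∑ i ∈ Finset.range C.period,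
      pair I m (x (Cycle.rot^[i] C)).1 (x (Cycle.rot^[i] C)).2) =
    ∑ i ∈ Finset.range C.period, if Cycle.rot^[i] C = D then 1 else 0 := by
  rw [map_sum]
  refine Finset.sum_congr rfl fun i _ => ?_
  obtain ⟨b, hb⟩ := hF.left _ (hF.rot_iterate hC i)
  rw [pcoef_pair _ _ hb.parallel]
  refine if_congr ?_ rfl rfl
  rw [← Prod.ext_iff]
  exact hF.injective_x.eq_iff

theorem pcoef_sum_self (hF : IsCircuitFamily I m Z x y) (hC : C ∈ Z) :
    pcoef I m (x C).1 (x C).2 (∑ i ∈ Finset.range C.period,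
      pair I m (x (Cycle.rot^[i] C)).1 (x (Cycle.rot^[i] C)).2) = 1 := by
  classical
  rw [hF.pcoef_sum hC, Finset.sum_eq_single 0]
  · simp
  · intro i hi hi'
    refine if_neg fun he => ?_
    have := Nat.le_of_dvd (Nat.pos_of_ne_zero hi') (Function.IsPeriodicPt.minimalPeriod_dvd he)
    rw [Finset.mem_range] at hi
    exact absurd hi this.not_gt
  · intro h
    exact absurd (Finset.mem_range.2 C.period_pos) h

theorem pcoef_sum_of_ne (hF : IsCircuitFamily I m Z x y) {X : Set (Cycle Q)} {Z' : Set (Cycle Q)}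
    (hX : IsCircuitReps Z' X) (hCZ : C ∈ Z) {D : Cycle Q} (hC : C ∈ X) (hD : D ∈ X) (h : C ≠ D) :
    pcoef I m (x D).1 (x D).2 (∑ i ∈ Finset.range C.period,
      pair I m (x (Cycle.rot^[i] C)).1 (x (Cycle.rot^[i] C)).2) = 0 := by
  classical
  rw [hF.pcoef_sum hCZ]
  refine Finset.sum_eq_zero fun i _ => if_neg fun he => h ?_
  exact (hX.2 C (hX.1 C hC)).unique ⟨hC, Cycle.IsConj.refl C⟩ ⟨hD, i, he⟩

end IsCircuitFamily

variable [Fintype E]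

/-- The differential from degree zero restricts to that of the graph cohomology of the quiver. -/
theorem parallelD_vertexCochain (p : V → k) : parallelD I 0 (vertexCochain I p) =
    ∑ c : E, (p (Q.s c) - p (Q.t c)) • pair I 1 (Path.ofArrow c) (Path.ofArrow c) := by
  classical
  refine ext_pcoef fun γ α hp => ?_
  obtain ⟨c, hc⟩ := List.length_eq_one_iff.1 hp.length_fst
  obtain rfl := Path.eq_ofArrow hc
  rw [pcoef_parallelD _ hp.inΓm hp.snd_mem, map_sum, Finset.sum_eq_single c, map_smul,
    pcoef_pair _ _ (isParallelPair_ofArrow c), Path.ofArrow_tl, Path.ofArrow_it,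
    pcoef_vertexCochain, pcoef_vertexCochain, ← ite_and, ← ite_and]
  · have h₁ : ((Path.ofArrow c : Path Q).SameLast α ∧ α.tl = Path.trivial (Q.s c)) ↔
        Path.ofArrow c = α := by
      constructor
      · rintro ⟨⟨d, hd₁, hd₂⟩, h⟩
        obtain rfl : c = d := Option.some.inj hd₁
        have h' := congrArg Path.arrows h
        rw [Path.tl_arrows] at h'
        refine (Path.eq_ofArrow ?_).symm
        rw [← List.cons_head?_tail hd₂, h']; rfl
      · rintro rfl
        exact ⟨⟨c, rfl, rfl⟩, Path.ofArrow_tl c⟩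
    have h₂ : ((Path.ofArrow c : Path Q).SameFirst α ∧ α.it = Path.trivial (Q.t c)) ↔
        Path.ofArrow c = α := by
      constructor
      · rintro ⟨⟨d, hd₁, hd₂⟩, h⟩
        obtain rfl : c = d := Option.some.inj hd₁
        have h' := congrArg Path.arrows h
        rw [Path.it_arrows] at h'
        refine (Path.eq_ofArrow ?_).symm
        rw [← List.dropLast_append_getLast? c hd₂, h']; rfl
      · rintro rfl
        exact ⟨⟨c, rfl, rfl⟩, Path.ofArrow_it c⟩
    rw [if_congr h₁ rfl rfl, if_congr h₂ rfl rfl]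
    by_cases h : Path.ofArrow c = α <;> simp [h]
  · intro d _ hd
    rw [map_smul, pcoef_pair _ _ (isParallelPair_ofArrow d), if_neg, smul_zero]
    rintro ⟨h, -⟩
    exact hd (List.singleton_injective (congrArg Path.arrows h))
  · simp

namespace IsCircuitFamily

variable {m : ℕ} {Z : Set (Cycle Q)} {x y : Cycle Q → Path Q × Path Q} {C : Cycle Q}

theorem parallelD_pair (hF : IsCircuitFamily I m Z x y) (hI : IsGentle I) (hC : C ∈ Z) :
    parallelD I m (pair I m (x C).1 (x C).2) = pair I (m + 1) (y C).1 (y C).2 -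
      (-1 : k) ^ m • pair I (m + 1) (y C.rot).1 (y C.rot).2 := by
  obtain ⟨b, hb⟩ := hF.left C hC
  obtain ⟨a, ha⟩ := hF.right C hC
  exact hI.parallelD_pair hb.parallel (hF.ne C hC) (Or.inl ⟨b, _, hb, rfl⟩)
    (Or.inl ⟨a, _, ha, rfl⟩)

theorem pcoef_parallelD (hF : IsCircuitFamily I m Z x y) (hC : C ∈ Z) (z : ParallelCochain I m) :
    pcoef I (m + 1) (y C.rot).1 (y C.rot).2 (parallelD I m z) =
      pcoef I m (x C.rot).1 (x C.rot).2 z - (-1) ^ m * pcoef I m (x C).1 (x C).2 z := by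
  obtain ⟨b, hb⟩ := hF.left _ (hF.rot C hC)
  obtain ⟨a, ha⟩ := hF.right C hC
  exact pcoef_parallelD_of_ext z hb ha

theorem pcoef_rot_iterate (hF : IsCircuitFamily I m Z x y) (hC : C ∈ Z) {z : ParallelCochain I m}
    (hz : parallelD I m z = 0) (n : ℕ) :
    pcoef I m (x (Cycle.rot^[n] C)).1 (x (Cycle.rot^[n] C)).2 z =
      ((-1) ^ m) ^ n * pcoef I m (x C).1 (x C).2 z := by
  induction n with
  | zero => simp
  | succ n ih =>
    have := hF.pcoef_parallelD (hF.rot_iterate hC n) z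
    rw [hz, map_zero, eq_comm, sub_eq_zero] at this
    rw [Function.iterate_succ_apply', this, ih, pow_succ]
    ring

theorem sub_smul_rot_iterate_mem (hF : IsCircuitFamily I m Z x y) (hI : IsGentle I) (hC : C ∈ Z)
    (n : ℕ) : pair I (m + 1) (y C).1 (y C).2 - ((-1 : k) ^ m) ^ n •
      pair I (m + 1) (y (Cycle.rot^[n] C)).1 (y (Cycle.rot^[n] C)).2 ∈
        coboundaries (parallelD I) (m + 1) := by
  induction n with
  | zero => simp
  | succ n ih =>
    have h : _ ∈ coboundaries (parallelD I) (m + 1) :=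
      ⟨_, hF.parallelD_pair hI (hF.rot_iterate hC n)⟩
    have := Submodule.add_mem _ ih (Submodule.smul_mem _ (((-1 : k) ^ m) ^ n) h)
    rw [Function.iterate_succ_apply']
    convert this using 1
    rw [smul_sub, smul_smul, pow_succ]
    abel

/-- If the coefficients of a coboundary vanish at all edges of a circuit but one, then also the
last one vanishes, if there is no sign: the sum of all of them telescopes. -/
theorem pcoef_parallelD_eq_zero (hF : IsCircuitFamily I m Z x y) (hC : C ∈ Z)
    (hm : (-1 : k) ^ m = 1) (w : ParallelCochain I m)
    (h : ∀ j, Cycle.rot^[j] C ≠ C →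
      pcoef I (m + 1) (y (Cycle.rot^[j] C)).1 (y (Cycle.rot^[j] C)).2 (parallelD I m w) = 0) :
    pcoef I (m + 1) (y C).1 (y C).2 (parallelD I m w) = 0 := by
  have hs := Finset.sum_range_sub (fun i => pcoef I m (x (Cycle.rot^[i] C)).1
    (x (Cycle.rot^[i] C)).2 w) C.period
  rw [C.rot_iterate_period, Function.iterate_zero_apply, sub_self] at hs
  have hp := C.period_pos
  rw [Finset.sum_eq_single (C.period - 1)] at hs
  · have := hF.pcoef_parallelD (hF.rot_iterate hC (C.period - 1)) w
    rw [← Function.iterate_succ_apply' Cycle.rot, hm, one_mul, Nat.succ_eq_add_one,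
      Nat.sub_add_cancel hp, C.rot_iterate_period] at this
    rw [this, ← hs, Nat.sub_add_cancel hp, C.rot_iterate_period]
  · intro i hi hi'
    have := hF.pcoef_parallelD (hF.rot_iterate hC i) w
    rw [← Function.iterate_succ_apply' Cycle.rot, hm, one_mul, h] at this
    · exact this.symm
    · intro he
      have := Nat.le_of_dvd i.succ_pos (Function.IsPeriodicPt.minimalPeriod_dvd he)
      rw [Finset.mem_range] at hi
      unfold Cycle.period at hi hi'
      omega
  · intro h'
    exact absurd (Finset.mem_range.2 (Nat.sub_lt hp one_pos)) h'

theorem parallelD_sum (hF : IsCircuitFamily I m Z x y) (hI : IsGentle I) (hC : C ∈ Z)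
    (hm : (-1 : k) ^ m = 1) :
    parallelD I m (∑ i ∈ Finset.range C.period,
      pair I m (x (Cycle.rot^[i] C)).1 (x (Cycle.rot^[i] C)).2) = 0 := by
  rw [map_sum, Finset.sum_congr rfl fun i _ => hF.parallelD_pair hI (hF.rot_iterate hC i)]
  simp only [hm, one_smul, ← Function.iterate_succ_apply' Cycle.rot]
  have hs := Finset.sum_range_sub' (fun i => pair I (m + 1) (y (Cycle.rot^[i] C)).1
    (y (Cycle.rot^[i] C)).2) C.period
  rw [C.rot_iterate_period, Function.iterate_zero_apply, sub_self] at hs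
  exact hs

end IsCircuitFamily

end GraphCohomology

/-! ### Reduced cochains -/

section Reduced

open PathAlgebra

variable {k : Type u} [Field k] {V : Type v} {E : Type w} {Q : ArrowQuiver V E}

theorem not_sameFirst_of_fst {y : Path Q × Path Q} (h : y.1.arrows = []) :
    ¬ y.1.SameFirst y.2 := by rintro ⟨c, hc, -⟩; simp [h] at hc

theorem not_sameFirst_of_snd {y : Path Q × Path Q} (h : y.2.arrows = []) :
    ¬ y.1.SameFirst y.2 := by rintro ⟨c, -, hc⟩; simp [h] at hc

theorem not_sameLast_of_fst {y : Path Q × Path Q} (h : y.1.arrows = []) :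
    ¬ y.1.SameLast y.2 := by rintro ⟨c, hc, -⟩; simp [h] at hc

theorem not_sameLast_of_snd {y : Path Q × Path Q} (h : y.2.arrows = []) :
    ¬ y.1.SameLast y.2 := by rintro ⟨c, -, hc⟩; simp [h] at hc

variable (k) in
/-- The pairs `(c, c)`, `(c, c α)` and `(b C, b)` among the generators, of degree `m`. -/
def IsArcRep (T : Set E) (XB XΓ : Set (Cycle Q)) (m : ℕ) (y : Path Q × Path Q) : Prop :=
  (∃ c, c ∉ T ∧ y = (Path.ofArrow c, Path.ofArrow c)) ∨
  (∃ C ∈ XB, y = (Path.ofArrow C.firstArrow, C.firstMul)) ∨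
  (∃ C ∈ XΓ, (Odd m ∨ ringChar k = 2) ∧ y = (C.firstMul, Path.ofArrow C.firstArrow))

variable {T : Set E} {XB XΓ : Set (Cycle Q)} {m : ℕ}

theorem IsArcRep.sameFirst {y : Path Q × Path Q} (h : IsArcRep k T XB XΓ m y) :
    y.1.SameFirst y.2 := by
  rcases h with ⟨c, -, rfl⟩ | ⟨C, -, rfl⟩ | ⟨C, -, -, rfl⟩
  · exact ⟨c, rfl, rfl⟩
  · exact ⟨_, rfl, C.firstMul_getLast⟩
  · exact ⟨_, C.firstMul_getLast, rfl⟩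

theorem neg_one_pow_eq_one_iff_even_or : (-1 : k) ^ m = 1 ↔ Even m ∨ ringChar k = 2 := by
  rw [← neg_one_eq_one_iff]
  by_cases h : (-1 : k) = 1
  · simp [h]
  · simp [h, neg_one_pow_eq_one_iff_even h]

theorem odd_succ_or_iff : (Odd (m + 1) ∨ ringChar k = 2) ↔ (-1 : k) ^ m = 1 := by
  rw [neg_one_pow_eq_one_iff_even_or, Nat.odd_add_one, Nat.not_odd_iff_even]

theorem neg_one_pow_pow_self (h : (-1 : k) ^ m ≠ 1) : ((-1 : k) ^ m) ^ m = -1 ∧ (2 : k) ≠ 0 := by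
  rw [Ne, neg_one_pow_eq_one_iff_even_or, not_or, Nat.not_even_iff_odd] at h
  refine ⟨by rw [h.1.neg_one_pow, h.1.neg_one_pow], fun h2 => h.2 ?_⟩
  rw [← neg_one_eq_one_iff, neg_eq_iff_add_eq_zero, one_add_one_eq_two]
  exact h2

theorem notMem_of_isArcRep {c : E} (h : IsArcRep k T XB XΓ m
    ((Path.ofArrow c : Path Q), Path.ofArrow c)) : c ∉ T := by
  rcases h with ⟨d, hd, e⟩ | ⟨C, -, e⟩ | ⟨C, -, -, e⟩
  · have := congrArg Path.arrows (congrArg Prod.fst e)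
    rwa [List.singleton_injective this]
  · exact absurd (congrArg Prod.snd e) (Cycle.ofArrow_ne_firstMul _ C)
  · exact absurd (congrArg Prod.fst e) (Cycle.ofArrow_ne_firstMul _ C)

theorem mem_of_isArcRep_B {C : Cycle Q} (h : IsArcRep k T XB XΓ m
    (Path.ofArrow C.firstArrow, C.firstMul)) : C ∈ XB := by
  rcases h with ⟨d, hd, e⟩ | ⟨D, hD, e⟩ | ⟨D, -, -, e⟩
  · exact absurd (congrArg Prod.snd e).symm (Cycle.ofArrow_ne_firstMul _ C)
  · rwa [Cycle.firstMul_injective (congrArg Prod.snd e)]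
  · exact absurd (congrArg Prod.fst e) (Cycle.ofArrow_ne_firstMul _ D)

theorem mem_of_isArcRep_Γ {C : Cycle Q} (h : IsArcRep k T XB XΓ m
    (C.firstMul, Path.ofArrow C.firstArrow)) : C ∈ XΓ := by
  rcases h with ⟨d, hd, e⟩ | ⟨D, -, e⟩ | ⟨D, hD, -, e⟩
  · exact absurd (congrArg Prod.fst e).symm (Cycle.ofArrow_ne_firstMul _ C)
  · exact absurd (congrArg Prod.snd e) (Cycle.ofArrow_ne_firstMul _ D)
  · rwa [Cycle.firstMul_injective (congrArg Prod.fst e)]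

variable [Fintype V] {I : TwoSidedIdeal (PathAlgebra k Q)}

variable (I) in
/-- The pairs of paths that suffice to represent all cohomology classes in degree `m`. The others
are removed with the differentials of the pairs obtained by removing a common last arrow or, where
this is impossible, a common first arrow. -/
structure IsReduced (T : Set E) (XB XΓ : Set (Cycle Q)) (m : ℕ) (y : Path Q × Path Q) :
    Prop where
  sameLast : y.1.SameLast y.2 → IsArcRep k T XB XΓ m y
  sameFirst : y.1.SameFirst y.2 → y.1.SameLast y.2 ∨
    ∃ n b w, m = n + 1 ∧ LeftExt I n b (y.1.it, y.2.it) w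

variable (I) in
/-- The cochains supported on the reduced pairs. -/
def reducedCochains (T : Set E) (XB XΓ : Set (Cycle Q)) (m : ℕ) :
    Submodule k (ParallelCochain I m) where
  carrier := {z | ∀ y, ¬ IsReduced I T XB XΓ m y → pcoef I m y.1 y.2 z = 0}
  add_mem' hz hw y hy := by rw [map_add, hz y hy, hw y hy, add_zero]
  zero_mem' y _ := map_zero _
  smul_mem' c z hz y hy := by rw [map_smul, hz y hy, smul_zero]

theorem IsReduced.pair_mem {y : Path Q × Path Q} (h : IsReduced I T XB XΓ m y) :
    pair I m y.1 y.2 ∈ reducedCochains I T XB XΓ m := by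
  classical
  intro y' hy'
  by_cases hy : IsParallelPair I m y
  · rw [pcoef_pair _ _ hy, if_neg]
    rintro ⟨h₁, h₂⟩
    exact hy' ((Prod.ext h₁ h₂ : y = y') ▸ h)
  · rw [pair, dif_neg hy, map_zero]

theorem isReduced_of_not_same {y : Path Q × Path Q} (h₁ : ¬ y.1.SameFirst y.2)
    (h₂ : ¬ y.1.SameLast y.2) : IsReduced I T XB XΓ m y :=
  ⟨fun h => absurd h h₂, fun h => absurd h h₁⟩

theorem IsArcRep.isReduced {y : Path Q × Path Q} (h : IsArcRep k T XB XΓ m y)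
    (h' : y.1.SameLast y.2) : IsReduced I T XB XΓ m y := ⟨fun _ => h, fun _ => Or.inl h'⟩

variable [Fintype E]

/-- In degree `m`, moving once around a circuit of the cyclic graph multiplies an edge by `(-1) ^ m`
at each step, up to coboundaries. If the sign is trivial, every edge is equivalent to the one at the
representative; otherwise the total sign of a circuit of odd length `m` is `-1`, and twice the edge
is a coboundary. -/
theorem IsCircuitFamily.pair_mem {Z : Set (Cycle Q)} {x y : Cycle Q → Path Q × Path Q}
    (hF : IsCircuitFamily I m Z x y) (hI : IsGentle I) {C : Cycle Q} (hC : C ∈ Z)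
    (hrep : (-1 : k) ^ m = 1 → ∃ n, IsReduced I T XB XΓ (m + 1) (y (Cycle.rot^[n] C)))
    (hlen : (-1 : k) ^ m ≠ 1 → C.length = m) :
    pair I (m + 1) (y C).1 (y C).2 ∈
      reducedCochains I T XB XΓ (m + 1) ⊔ coboundaries (parallelD I) (m + 1) := by
  by_cases hm : (-1 : k) ^ m = 1
  · obtain ⟨n, hn⟩ := hrep hm
    have h₁ := hF.sub_smul_rot_iterate_mem hI hC n
    rw [hm, one_pow, one_smul] at h₁
    have := Submodule.add_mem _ (Submodule.mem_sup_right h₁) (Submodule.mem_sup_left hn.pair_mem)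
    rwa [sub_add_cancel] at this
  · have h₁ := hF.sub_smul_rot_iterate_mem hI hC C.length
    obtain ⟨e, h2⟩ := neg_one_pow_pow_self hm
    rw [C.rot_iterate_length_self, hlen hm, e, neg_one_smul, sub_neg_eq_add, ← two_smul k] at h₁
    exact Submodule.mem_sup_right ((Submodule.smul_mem_iff _ h2).1 h₁)

/-- The pairs `(c, c)` with `c` in the spanning tree are, up to coboundaries, combinations of those
with `c` outside of the spanning tree. -/
theorem ofArrow_pair_mem (hT : Q.IsSpanningTree T) (c : E) :
    pair I 1 (Path.ofArrow c) (Path.ofArrow c) ∈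
      reducedCochains I T XB XΓ 1 ⊔ coboundaries (parallelD I) 1 := by
  have hred : ∀ d ∉ T, pair I 1 (Path.ofArrow d) (Path.ofArrow d) ∈
      reducedCochains I T XB XΓ 1 := fun d hd =>
    (IsArcRep.isReduced (k := k) (I := I) (Or.inl ⟨d, hd, rfl⟩) ⟨d, rfl, rfl⟩ :
      IsReduced I T XB XΓ 1 (Path.ofArrow d, Path.ofArrow d)).pair_mem
  by_cases hc : c ∈ T
  swap
  · exact Submodule.mem_sup_left (hred c hc)
  classical
  obtain ⟨p, hp₁, hp⟩ := hT.exists_potential k hc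
  have h := parallelD_vertexCochain (I := I) p
  rw [← Finset.add_sum_erase _ _ (Finset.mem_univ c), hp₁, one_smul] at h
  rw [eq_sub_of_add_eq h.symm]
  refine Submodule.sub_mem _ (Submodule.mem_sup_right ⟨_, rfl⟩)
    (Submodule.mem_sup_left (Submodule.sum_mem _ fun d hd => ?_))
  by_cases hdT : d ∈ T
  · rw [hp d hdT (Finset.ne_of_mem_erase hd), sub_self, zero_smul]
    exact Submodule.zero_mem _
  · exact Submodule.smul_mem _ _ (hred d hdT)

/-- Every pair is, up to coboundaries, a combination of reduced pairs. If the two paths have a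
common last arrow, it is exchanged, by means of the differential of the pair without that arrow,
for a common first arrow, unless a circuit or the tree intervenes. -/
theorem pair_mem_reduced_sup (hI : IsGentle I) (hT : Q.IsSpanningTree T)
    (hXB : IsCocompleteReps I XB) (hXΓ : IsCompleteReps I XΓ) {y : Path Q × Path Q}
    (hy : IsParallelPair I m y) :
    pair I m y.1 y.2 ∈ reducedCochains I T XB XΓ m ⊔ coboundaries (parallelD I) m := by
  by_cases hs : y.1.SameLast y.2
  · obtain ⟨n, rfl⟩ : ∃ n, m = n + 1 := by
      obtain ⟨c, hc, -⟩ := hs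
      have := hy.length_fst
      cases m with
      | zero => rw [List.length_eq_zero_iff.1 this] at hc; simp at hc
      | succ n => exact ⟨n, rfl⟩
    obtain ⟨b, hb⟩ := exists_leftExt_of_sameLast hy hs
    generalize hx : ((y.1.tl, y.2.tl) : Path Q × Path Q) = x at hb
    by_cases hne : x.1.arrows ≠ [] ∨ x.2.arrows ≠ []
    swap
    · push Not at hne
      have e₁ := Path.eq_ofArrow (hb.fst_arrows.trans (by rw [hne.1]))
      have e₂ := Path.eq_ofArrow (hb.snd_arrows.trans (by rw [hne.2]))
      have hn : n = 0 := by
        have := hb.parallel.length_fst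
        rw [Path.length, hne.1] at this
        exact this.symm
      subst hn
      rw [e₁, e₂]
      exact ofArrow_pair_mem hT b
    by_cases hf : y.1.SameFirst y.2
    -- the pair `x` has no extension on the right, or both extensions lie in the graph of a circuit
    · by_cases hf' : x.1.SameFirst x.2
      · have h := hI.parallelD_pair hb.parallel hne (Or.inl ⟨b, y, hb, rfl⟩)
          (Or.inr ⟨fun a w hw => hw.not_sameFirst hf', rfl⟩)
        rw [smul_zero, sub_zero] at h
        exact Submodule.mem_sup_right ⟨_, h⟩
      · rcases hb.exists_cycle hne hf hf' with ⟨C, hC, e⟩ | ⟨C, hC, e⟩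
        · have hF := isCircuitFamily_isCocomplete (I := I)
          have hn : n = 0 := by
            have := hb.parallel.length_fst
            rw [e] at this
            exact this.symm
          subst hn
          obtain ⟨b', hb'⟩ := hF.left C hC
          rw [hb.unique hI hne (e ▸ hb')]
          refine hF.pair_mem hI hC (fun _ => ?_) (fun h => absurd (pow_zero _) h)
          obtain ⟨D, ⟨hD, i, hi⟩, -⟩ := hXB.isCircuitReps.2 C hC
          refine ⟨i, IsArcRep.isReduced (Or.inr (Or.inl ⟨D, hD, by rw [hi]⟩)) ?_⟩
          exact ⟨_, rfl, rfl⟩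
        · have hF := isCircuitFamily_isComplete (I := I) n
          have hn : C.length = n := by
            have := hb.parallel.length_fst
            rw [e] at this
            exact this
          obtain ⟨b', hb'⟩ := hF.left C ⟨hC, hn⟩
          rw [hb.unique hI hne (e ▸ hb')]
          refine hF.pair_mem hI ⟨hC, hn⟩ (fun h => ?_) (fun _ => hn)
          obtain ⟨D, ⟨hD, i, hi⟩, -⟩ := hXΓ.isCircuitReps.2 C hC
          refine ⟨i, IsArcRep.isReduced
            (Or.inr (Or.inr ⟨D, hD, odd_succ_or_iff.2 h, by rw [hi]⟩)) ?_⟩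
          exact ⟨_, rfl, rfl⟩
    -- the differential of `x` exchanges `y` for the extension of `x` on the right, if there is one
    · by_cases hr : ∃ a w, RightExt I n a x w
      · obtain ⟨a, w, hw⟩ := hr
        have h := hI.parallelD_pair hb.parallel hne (Or.inl ⟨b, y, hb, rfl⟩)
          (Or.inl ⟨a, w, hw, rfl⟩)
        have hw' : IsReduced I T XB XΓ (n + 1) w := by
          refine ⟨fun h => absurd (hb.sameFirst_of_sameLast hI hne hw h) hf, fun _ =>
            Or.inr ⟨n, b, y, rfl, ?_⟩⟩
          rwa [hw.fst_it, hw.snd_it]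
        rw [eq_comm, sub_eq_iff_eq_add] at h
        rw [h]
        exact Submodule.add_mem _ (Submodule.mem_sup_right ⟨_, rfl⟩)
          (Submodule.smul_mem _ _ (Submodule.mem_sup_left hw'.pair_mem))
      · push Not at hr
        have h := hI.parallelD_pair hb.parallel hne (Or.inl ⟨b, y, hb, rfl⟩)
          (Or.inr ⟨hr, rfl⟩)
        rw [smul_zero, sub_zero] at h
        exact Submodule.mem_sup_right ⟨_, h⟩
  by_cases hf : y.1.SameFirst y.2
  · obtain ⟨n, rfl⟩ : ∃ n, m = n + 1 := by
      obtain ⟨c, hc, -⟩ := hf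
      have := hy.length_fst
      cases m with
      | zero => rw [List.length_eq_zero_iff.1 this] at hc; simp at hc
      | succ n => exact ⟨n, rfl⟩
    by_cases hl : ∃ b w, LeftExt I n b (y.1.it, y.2.it) w
    · obtain ⟨b, w, hw⟩ := hl
      exact Submodule.mem_sup_left
        (⟨fun h => absurd h hs, fun _ => Or.inr ⟨n, b, w, rfl, hw⟩⟩ :
          IsReduced I T XB XΓ (n + 1) y).pair_mem
    -- without its common first arrow, the pair has no other extension
    · push Not at hl
      obtain ⟨a, ha⟩ := exists_rightExt_of_sameFirst hy hf
      have hne : y.1.it.arrows ≠ [] ∨ y.2.it.arrows ≠ [] := by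
        by_contra! hne
        refine hs ⟨a, ?_, ?_⟩
        · rw [ha.fst_arrows]; simp only [hne.1]; rfl
        · rw [ha.snd_arrows]; simp only [hne.2]; rfl
      have h := hI.parallelD_pair ha.parallel hne (Or.inr ⟨hl, rfl⟩) (Or.inl ⟨a, y, ha, rfl⟩)
      rw [zero_sub] at h
      have h' : pair I (n + 1) y.1 y.2 ∈ coboundaries (parallelD I) (n + 1) := by
        have h₁ : -((-1 : k) ^ n • pair I (n + 1) y.1 y.2) ∈ coboundaries (parallelD I) (n + 1) :=
          ⟨_, h⟩
        rw [Submodule.neg_mem_iff] at h₁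
        exact (Submodule.smul_mem_iff _ (by simp)).1 h₁
      exact Submodule.mem_sup_right h'
  · exact Submodule.mem_sup_left (isReduced_of_not_same hf hs).pair_mem

theorem reduced_sup_coboundaries (hI : IsGentle I) (hT : Q.IsSpanningTree T)
    (hXB : IsCocompleteReps I XB) (hXΓ : IsCompleteReps I XΓ) :
    reducedCochains I T XB XΓ m ⊔ coboundaries (parallelD I) m = ⊤ := by
  refine eq_top_iff.2 fun z _ => ?_
  induction z using Finsupp.induction_linear with
  | zero => exact Submodule.zero_mem _
  | add z w hz hw => exact Submodule.add_mem _ (hz trivial) (hw trivial)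
  | single x c =>
    rw [single_eq_smul_pair]
    exact Submodule.smul_mem _ _ (pair_mem_reduced_sup hI hT hXB hXΓ x.2)

end Reduced

/-! ### The generators -/

section Generators

open PathAlgebra

variable {k : Type u} [Field k] {V : Type v} {E : Type w} [Fintype V] {Q : ArrowQuiver V E}
  {I : TwoSidedIdeal (PathAlgebra k Q)} {T : Set E} {XB XΓ : Set (Cycle Q)} {m : ℕ}

/-- A pair of paths that occurs in the cocycle of a generator with coefficient one and in no other
generator. For the sum over all vertices, the vertex `x` is chosen. -/
def Generator.lead (x : V) : Generator I T XB XΓ m → Path Q × Path Q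
  | .unit _ => (Path.trivial x, Path.trivial x)
  | .bMax _ α _ _ => (Path.trivial α.src, α)
  | .bSum _ α _ => (Path.trivial α.src, α.toPath)
  | .fundamental _ c _ => (Path.ofArrow c, Path.ofArrow c)
  | .bPlus _ α _ => (Path.ofArrow α.firstArrow, α.firstMul)
  | .clean γ α _ _ _ _ => (γ, α)
  | .gammaSum C _ _ _ => (C.toPath, Path.trivial C.src)
  | .gammaPlus C _ _ _ => (C.firstMul, Path.ofArrow C.firstArrow)

variable [Fintype E]

/-- A reduced cocycle is zero if its coefficients at the leading pairs of all generators vanish. -/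
theorem eq_zero_of_lead (hI : IsGentle I) (hT : Q.IsSpanningTree T)
    (hXB : IsCocompleteReps I XB) (hXΓ : IsCompleteReps I XΓ) (x₀ : V) {z : ParallelCochain I m}
    (hz : z ∈ reducedCochains I T XB XΓ m) (hd : parallelD I m z = 0)
    (h : ∀ g : Generator I T XB XΓ m, pcoef I m (g.lead x₀).1 (g.lead x₀).2 z = 0) : z = 0 := by
  suffices ∀ y, IsParallelPair I m y → pcoef I m y.1 y.2 z = 0 from
    ext_pcoef fun γ α hp => (this (γ, α) hp).trans (map_zero _).symm
  intro y hy
  by_cases hred : IsReduced I T XB XΓ m y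
  swap
  · exact hz y hred
  by_cases hne : y.1.arrows ≠ [] ∨ y.2.arrows ≠ []
  swap
  · push Not at hne
    obtain rfl : 0 = m := by rw [← hy.length_fst, Path.length, hne.1]; rfl
    have hp : ∀ c ∈ T, pcoef I 0 (Path.trivial (Q.s c)) (Path.trivial (Q.s c)) z =
        pcoef I 0 (Path.trivial (Q.t c)) (Path.trivial (Q.t c)) z := by
      intro c _
      have := pcoef_parallelD z (isParallelPair_ofArrow (I := I) c).inΓm
        (isParallelPair_ofArrow c).snd_mem
      rw [hd, map_zero, if_pos ⟨c, rfl, rfl⟩, if_pos ⟨c, rfl, rfl⟩, pow_zero, one_mul,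
        Path.ofArrow_tl, Path.ofArrow_it] at this
      exact (sub_eq_zero.1 this.symm)
    have e₁ := Path.eq_trivial hne.1
    have e₂ := Path.eq_trivial hne.2
    rw [e₁, e₂, ← hy.src_eq]
    exact (hT.eq_of_forall_mem (p := fun x => pcoef I 0 (Path.trivial x) (Path.trivial x) z)
      hp _ x₀).trans (h (.unit rfl))
  by_cases hs : y.1.SameLast y.2
  · rcases hred.sameLast hs with ⟨c, hc, rfl⟩ | ⟨C, hC, rfl⟩ | ⟨C, hC, hpar, rfl⟩
    · exact h (.fundamental hy.length_fst.symm c hc)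
    · exact h (.bPlus hy.length_fst.symm C hC)
    · exact h (.gammaPlus C hC hy.length_fst hpar)
  by_cases hf : y.1.SameFirst y.2
  · obtain ⟨n, b, w, rfl, hw⟩ := (hred.sameFirst hf).resolve_left hs
    obtain ⟨a, ha⟩ := exists_rightExt_of_sameFirst hy hf
    have hne' : y.1.it.arrows ≠ [] ∨ y.2.it.arrows ≠ [] := by
      by_contra! hne'
      refine hs ⟨a, ?_, ?_⟩
      · rw [ha.fst_arrows]; simp only [hne'.1]; rfl
      · rw [ha.snd_arrows]; simp only [hne'.2]; rfl
    obtain ⟨W, hW, hW'⟩ := hw.exists_square hI hne' ha hs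
    have := pcoef_parallelD_of_ext z hW hW'
    rw [hd, map_zero, hz w fun hr => hW'.not_sameFirst (hr.sameLast hw.sameLast).sameFirst,
      mul_zero, sub_zero] at this
    exact this.symm
  by_cases hl : ∃ b w, LeftExt I m b y w
  · obtain ⟨b, w, hw⟩ := hl
    by_cases hwf : w.1.SameFirst w.2
    · rcases hw.exists_cycle hne hwf hf with ⟨C, hC, rfl⟩ | ⟨C, hC, rfl⟩
      · have hF := isCircuitFamily_isCocomplete (I := I)
        obtain rfl : 0 = m := hy.length_fst
        obtain ⟨D, ⟨hD, i, hi⟩, -⟩ := hXB.isCircuitReps.2 C hC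
        have := hF.pcoef_rot_iterate hC hd i
        rw [hi, pow_zero, one_pow, one_mul] at this
        exact this.symm.trans (h (.bSum rfl D hD))
      · have hm : C.length = m := hy.length_fst
        have hF := isCircuitFamily_isComplete (I := I) m
        by_cases hpar : (-1 : k) ^ m = 1
        · obtain ⟨D, ⟨hD, i, hi⟩, -⟩ := hXΓ.isCircuitReps.2 C hC
          have := hF.pcoef_rot_iterate ⟨hC, hm⟩ hd i
          rw [hi, hpar, one_pow, one_mul] at this
          refine this.symm.trans (h (.gammaSum D hD ?_ (neg_one_pow_eq_one_iff_even_or.1 hpar)))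
          rw [← hi, Cycle.rot_iterate_length, hm]
        · obtain ⟨e, h2⟩ := neg_one_pow_pow_self hpar
          have := hF.pcoef_rot_iterate ⟨hC, hm⟩ hd C.length
          rw [C.rot_iterate_length_self, hm, e, neg_one_mul, eq_neg_iff_add_eq_zero,
            ← two_mul] at this
          exact (mul_eq_zero.1 this).resolve_left h2
    · have := pcoef_parallelD_of_leftExt z hw hwf
      rw [hd, map_zero] at this
      exact this.symm
  by_cases hr : ∃ a w, RightExt I m a y w
  · obtain ⟨a, w, hw⟩ := hr
    have := pcoef_parallelD_of_rightExt z hw fun h => hl (hw.exists_leftExt hne h hs)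
    rw [hd, map_zero, eq_comm, neg_eq_zero] at this
    exact (mul_eq_zero.1 this).resolve_left (by simp)
  push Not at hl hr
  by_cases h₁ : y.1.arrows = []
  · obtain rfl : 0 = m := by rw [← hy.length_fst, Path.length, h₁]; rfl
    have e₁ : y.1 = Path.trivial y.2.src := (Path.eq_trivial h₁).trans (by rw [hy.src_eq])
    rw [e₁]
    exact h (.bMax rfl y.2 (isBMaximal_of_not_ext hy h₁ hl hr)
      (hy.src_eq.symm.trans ((y.1.src_eq_tgt h₁).trans hy.tgt_eq)))
  · exact h (.clean y.1 y.2 hy (hI.isΓMaximal_of_not_ext hy h₁ hl hr hs hf) hf hs)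

/-- The coefficients of a reduced coboundary at the leading pairs of the generators vanish. -/
theorem lead_eq_zero_of_mem_coboundaries (hT : Q.IsSpanningTree T)
    (hXB : IsCocompleteReps I XB) (hXΓ : IsCompleteReps I XΓ) (x₀ : V) {z : ParallelCochain I m}
    (hz : z ∈ reducedCochains I T XB XΓ m) (hd : z ∈ coboundaries (parallelD I) m)
    (g : Generator I T XB XΓ m) : pcoef I m (g.lead x₀).1 (g.lead x₀).2 z = 0 := by
  cases m with
  | zero => rw [(Submodule.mem_bot k).1 hd, map_zero]
  | succ m =>
    obtain ⟨w, rfl⟩ := hd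
    cases g with
    | unit hm => exact absurd hm m.succ_ne_zero
    | bMax hm => exact absurd hm m.succ_ne_zero
    | bSum hm => exact absurd hm m.succ_ne_zero
    | fundamental hm c hc =>
      obtain rfl : m = 0 := Nat.succ_injective hm
      have hD : ∀ c, pcoef I 1 (Path.ofArrow c) (Path.ofArrow c) (parallelD I 0 w) =
          pcoef I 0 (Path.trivial (Q.s c)) (Path.trivial (Q.s c)) w -
            pcoef I 0 (Path.trivial (Q.t c)) (Path.trivial (Q.t c)) w := by
        intro c
        have := pcoef_parallelD w (isParallelPair_ofArrow (I := I) c).inΓm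
          (isParallelPair_ofArrow c).snd_mem
        rwa [if_pos ⟨c, rfl, rfl⟩, if_pos ⟨c, rfl, rfl⟩, pow_zero, one_mul,
          Path.ofArrow_tl, Path.ofArrow_it] at this
      have hp : ∀ d ∈ T, pcoef I 0 (Path.trivial (Q.s d)) (Path.trivial (Q.s d)) w =
          pcoef I 0 (Path.trivial (Q.t d)) (Path.trivial (Q.t d)) w := by
        intro d hd
        rw [← sub_eq_zero, ← hD]
        exact hz (Path.ofArrow d, Path.ofArrow d) fun hr =>
          notMem_of_isArcRep (hr.sameLast ⟨d, rfl, rfl⟩) hd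
      refine (hD c).trans (sub_eq_zero.2 ?_)
      exact hT.eq_of_forall_mem (p := fun x => pcoef I 0 (Path.trivial x) (Path.trivial x) w) hp _ _
    | bPlus hm C hC =>
      obtain rfl : m = 0 := Nat.succ_injective hm
      have hR := hXB.isCircuitReps
      refine (isCircuitFamily_isCocomplete (I := I)).pcoef_parallelD_eq_zero (hR.1 C hC)
        (pow_zero _) w fun j hj => hz _ fun hr => hj ?_
      have := mem_of_isArcRep_B (hr.sameLast ⟨_, rfl, rfl⟩)
      exact (hR.2 C (hR.1 C hC)).unique ⟨this, j, rfl⟩ ⟨hC, Cycle.IsConj.refl C⟩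
    | clean γ α h _ hf hl => exact pcoef_parallelD_eq_zero w hf hl
    | gammaSum C =>
      exact pcoef_parallelD_eq_zero w (not_sameFirst_of_snd (y := (_, Path.trivial C.src)) rfl)
        (not_sameLast_of_snd (y := (_, Path.trivial C.src)) rfl)
    | gammaPlus C hC hm hpar =>
      have hm' : C.length = m := Nat.succ_injective hm
      have hR := hXΓ.isCircuitReps
      refine (isCircuitFamily_isComplete (I := I) m).pcoef_parallelD_eq_zero ⟨hR.1 C hC, hm'⟩
        (odd_succ_or_iff.1 hpar) w fun j hj => hz _ fun hr => hj ?_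
      have := mem_of_isArcRep_Γ (hr.sameLast ⟨_, rfl, rfl⟩)
      exact (hR.2 C (hR.1 C hC)).unique ⟨this, j, rfl⟩ ⟨hC, Cycle.IsConj.refl C⟩

end Generators

/-! ### Bases of cohomology spaces from dual functionals -/

section CohomologyBasis

variable {k : Type u} [Field k] {C : ℕ → Type v} [∀ m, AddCommGroup (C m)] [∀ m, Module k (C m)]
  (d : ∀ m, C m →ₗ[k] C (m + 1)) {m : ℕ} {ι : Type w}

theorem cohomologyClass_sum_smul (s : Finset ι) (l : ι → k) (v : ι → LinearMap.ker (d m)) :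
    cohomologyClass d (∑ g ∈ s, l g • v g) = ∑ g ∈ s, l g • cohomologyClass d (v g) :=
  (map_sum ((coboundaries d m).submoduleOf (LinearMap.ker (d m))).mkQ _ _).trans
    (Finset.sum_congr rfl fun _ _ => map_smul _ _ _)

theorem map_eq_zero_of_mem_coboundaries (hdd : ∀ m, d (m + 1) ∘ₗ d m = 0) {c : C m}
    (hc : c ∈ coboundaries d m) : d m c = 0 := by
  cases m with
  | zero => rw [(Submodule.mem_bot k).1 hc, map_zero]
  | succ m =>
    obtain ⟨w, rfl⟩ := hc
    exact LinearMap.congr_fun (hdd m) w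

variable {d} {v : ι → LinearMap.ker (d m)} {φ : ι → C m →ₗ[k] k} {R : Submodule k (C m)}

/-- Functionals dual to the cocycles `v g` recover the coefficients of a combination of these. -/
theorem dual_apply_sum_smul (hself : ∀ g, φ g (v g) = 1) (hne : ∀ g g', g ≠ g' → φ g (v g') = 0)
    (s : Finset ι) (l : ι → k) {g : ι} (hg : g ∉ s → l g = 0) :
    φ g ((∑ g ∈ s, l g • v g : LinearMap.ker (d m)) : C m) = l g := by
  rw [Submodule.coe_sum, map_sum, Finset.sum_eq_single g]
  · rw [Submodule.coe_smul, map_smul, hself, smul_eq_mul, mul_one]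
  · intro g' _ h
    rw [Submodule.coe_smul, map_smul, hne g g' h.symm, smul_zero]
  · intro h
    rw [hg h, zero_smul, Submodule.coe_zero, map_zero]

theorem sum_smul_coe_mem (hv : ∀ g, (v g : C m) ∈ R) (s : Finset ι) (l : ι → k) :
    ((∑ g ∈ s, l g • v g : LinearMap.ker (d m)) : C m) ∈ R := by
  rw [Submodule.coe_sum]
  exact R.sum_mem fun g _ => R.smul_mem _ (hv g)

/-- Cocycles with dual functionals that vanish on the coboundaries in a space `R` containing the
cocycles are linearly independent modulo coboundaries. -/
theorem linearIndependent_cohomologyClass (hself : ∀ g, φ g (v g) = 1)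
    (hne : ∀ g g', g ≠ g' → φ g (v g') = 0) (hv : ∀ g, (v g : C m) ∈ R)
    (hR : ∀ z ∈ R, z ∈ coboundaries d m → ∀ g, φ g z = 0) :
    LinearIndependent k fun g => cohomologyClass d (v g) := by
  rw [linearIndependent_iff']
  intro s l hl g hg
  rw [← cohomologyClass_sum_smul] at hl
  rw [← dual_apply_sum_smul hself hne s l fun h => absurd hg h]
  exact hR _ (sum_smul_coe_mem hv s l)
    ((Submodule.Quotient.mk_eq_zero ((coboundaries d m).submoduleOf _)).1 hl) g

/-- The classes of the cocycles `v g` span the cohomology if all cochains are, up to coboundaries,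
in a space `R` in which a cocycle is determined by its values under the dual functionals. -/
theorem top_le_span_cohomologyClass (hdd : ∀ m, d (m + 1) ∘ₗ d m = 0)
    (hself : ∀ g, φ g (v g) = 1) (hne : ∀ g g', g ≠ g' → φ g (v g') = 0)
    (hv : ∀ g, (v g : C m) ∈ R) (hR : R ⊔ coboundaries d m = ⊤)
    (hfin : ∀ z, {g | φ g z ≠ 0}.Finite) (hzero : ∀ z ∈ R, d m z = 0 → (∀ g, φ g z = 0) → z = 0) :
    ⊤ ≤ Submodule.span k (Set.range fun g => cohomologyClass d (v g)) := by
  intro x _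
  obtain ⟨⟨z, hz⟩, rfl⟩ := Submodule.Quotient.mk_surjective _ x
  have hz' : z ∈ R ⊔ coboundaries d m := by rw [hR]; trivial
  obtain ⟨r, hr, c, hc, rfl⟩ := Submodule.mem_sup.1 hz'
  have hdr : d m r = 0 := by
    rw [LinearMap.mem_ker, map_add, map_eq_zero_of_mem_coboundaries d hdd hc, add_zero] at hz
    exact hz
  let s := ∑ g ∈ (hfin r).toFinset, φ g r • v g
  have hsum : r = s := by
    refine sub_eq_zero.1 (hzero _ (R.sub_mem hr (sum_smul_coe_mem hv _ _)) ?_ fun g => ?_)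
    · rw [map_sub, hdr, LinearMap.mem_ker.1 s.2, sub_zero]
    · rw [map_sub, dual_apply_sum_smul hself hne _ fun g => φ g r, sub_self]
      intro hg
      by_contra h
      exact hg ((hfin r).mem_toFinset.2 h)
  have hcl : (Submodule.Quotient.mk ⟨r + c, hz⟩ : Cohomology d m) = cohomologyClass d s := by
    refine (Submodule.Quotient.eq ((coboundaries d m).submoduleOf _)).2 ?_
    show r + c - (s : C m) ∈ coboundaries d m
    rw [← hsum, add_sub_cancel_left]
    exact hc
  rw [hcl, cohomologyClass_sum_smul]
  exact Submodule.sum_mem _ fun g _ => Submodule.smul_mem _ _ (Submodule.subset_span ⟨g, rfl⟩)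

end CohomologyBasis

/-! ### The cohomology classes of the generators form a basis -/

section GeneratorCochains

open PathAlgebra

variable {k : Type u} [Field k] {V : Type v} {E : Type w} [Fintype V] {Q : ArrowQuiver V E}
  {I : TwoSidedIdeal (PathAlgebra k Q)} {T : Set E} {XB XΓ : Set (Cycle Q)} {m : ℕ}

theorem eq_of_pcoef_pair_ne_zero {γ α γ' α' : Path Q} (h : pcoef I m γ α (pair I m γ' α') ≠ 0) :
    γ' = γ ∧ α' = α := by
  classical
  by_cases hp : IsParallelPair I m (γ', α')
  · rw [pcoef_pair _ _ hp] at h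
    by_contra h'
    exact h (if_neg h')
  · rw [pair, dif_neg hp, map_zero] at h
    exact absurd rfl h

theorem Generator.cochain_unit : (Generator.unit rfl : Generator I T XB XΓ 0).cochain =
    vertexCochain I fun _ => 1 := by
  simp [Generator.cochain, vertexCochain]

theorem IsBMaximal.isParallelPair {α : Path Q} (h : IsBMaximal I α) (closed : α.src = α.tgt) :
    IsParallelPair I 0 (Path.trivial α.src, α) :=
  ⟨List.IsChain.nil, rfl, h.1, rfl, closed⟩

theorem Generator.pcoef_lead_self (hXB : IsCocompleteReps I XB) (hXΓ : IsCompleteReps I XΓ)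
    (x₀ : V) (g : Generator I T XB XΓ m) :
    pcoef I m (g.lead x₀).1 (g.lead x₀).2 g.cochain = 1 := by
  classical
  have hp : ∀ {γ α : Path Q}, IsParallelPair I m (γ, α) → pcoef I m γ α (pair I m γ α) = 1 :=
    fun h => by rw [pcoef_pair _ _ h, if_pos ⟨rfl, rfl⟩]
  cases g with
  | unit hm =>
    cases hm
    rw [Generator.cochain_unit]
    exact (pcoef_vertexCochain _ _ _).trans (if_pos rfl)
  | bMax hm α hα closed =>
    cases hm
    exact hp (hα.isParallelPair closed)
  | bSum hm α hα =>
    cases hm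
    exact isCircuitFamily_isCocomplete.pcoef_sum_self (hXB.isCircuitReps.1 α hα)
  | fundamental hm c hc =>
    cases hm
    exact hp (isParallelPair_ofArrow c)
  | bPlus hm α hα =>
    cases hm
    obtain ⟨b, hb⟩ := isCircuitFamily_isCocomplete.left α (hXB.isCircuitReps.1 α hα)
    exact hp hb.par
  | clean γ α h => exact hp h
  | gammaSum C hC hm =>
    exact (isCircuitFamily_isComplete m).pcoef_sum_self ⟨hXΓ.1 C hC, hm⟩
  | gammaPlus C hC hm =>
    cases hm
    obtain ⟨b, hb⟩ := (isCircuitFamily_isComplete C.length).left C ⟨hXΓ.1 C hC, rfl⟩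
    exact hp hb.par

open Classical in
variable (I) in
/-- The family of generators in which a pair of paths can occur. -/
noncomputable def pairKind (y : Path Q × Path Q) : ℕ :=
  if y.1.SameFirst y.2 then
    if y.1.length = 1 then if y.2.length = 1 then 4 else 5 else 8
  else if y.1.length = 0 then
    if y.2.length = 0 then 1 else if IsBMaximal I y.2 then 2 else 3
  else if IsΓMaximal I y.1 then 6 else 7

/-- The number of the family to which a generator belongs. -/
def Generator.kind : Generator I T XB XΓ m → ℕ
  | .unit .. => 1
  | .bMax .. => 2
  | .bSum .. => 3
  | .fundamental .. => 4
  | .bPlus .. => 5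
  | .clean .. => 6
  | .gammaSum .. => 7
  | .gammaPlus .. => 8

theorem IsBMaximal.arrows_ne_nil [Nonempty E] (hT : Q.IsSpanningTree T) {p : Path Q}
    (h : IsBMaximal I p) : p.arrows ≠ [] := by
  intro hp
  have hx := isParallelPair_trivial (I := I) p.src
  rw [← Path.eq_trivial hp] at hx
  obtain ⟨c, hc | hc⟩ := hT.exists_incident p.src
  · obtain ⟨y, hy⟩ := exists_leftExt hx (hc.trans (p.src_eq_tgt hp)) (by simp [hp]) (by simp [hp])
    exact not_leftExt_of_isBMaximal h hy
  · obtain ⟨y, hy⟩ := exists_rightExt hx hc.symm (by simp [hp]) (by simp [hp])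
    exact not_rightExt_of_isBMaximal h hy

theorem IsΓMaximal.arrows_ne_nil [Nonempty E] (hT : Q.IsSpanningTree T) {p : Path Q}
    (h : IsΓMaximal I p) : p.arrows ≠ [] := by
  intro hp
  have hx := isParallelPair_trivial (I := I) p.src
  rw [← Path.eq_trivial hp] at hx
  obtain ⟨c, hc | hc⟩ := hT.exists_incident p.src
  · obtain ⟨y, hy⟩ := exists_leftExt hx (hc.trans (p.src_eq_tgt hp)) (by simp [hp]) (by simp [hp])
    exact not_leftExt_of_isΓMaximal h hy
  · obtain ⟨y, hy⟩ := exists_rightExt hx hc.symm (by simp [hp]) (by simp [hp])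
    exact not_rightExt_of_isΓMaximal h hy

/-- The pairs that occur in the cocycle of a generator are reduced, and they are of the kind of the
generator. -/
theorem Generator.isReduced_and_pairKind [Nonempty E] (hT : Q.IsSpanningTree T)
    (hXB : IsCocompleteReps I XB) (hXΓ : IsCompleteReps I XΓ) (g : Generator I T XB XΓ m)
    {y : Path Q × Path Q} (h : pcoef I m y.1 y.2 g.cochain ≠ 0) :
    IsReduced I T XB XΓ m y ∧ pairKind I y = g.kind := by
  classical
  have hl : ∀ p : Path Q, p.arrows ≠ [] → p.length ≠ 0 := fun p hp h =>
    hp (List.length_eq_zero_iff.1 h)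
  have hl' : ∀ C : Cycle Q, C.firstMul.length ≠ 1 := fun C h => by
    rw [Path.length, C.firstMul_arrows, List.length_cons] at h
    exact C.length_pos.ne' (Nat.succ_injective h)
  have h₀ : ∀ x : V, (Path.trivial x : Path Q).length = 0 := fun _ => rfl
  have h₁' : ∀ c : E, (Path.ofArrow c : Path Q).length = 1 := fun _ => rfl
  cases g with
  | unit hm =>
    cases hm
    rw [Generator.cochain_unit, vertexCochain, map_sum] at h
    obtain ⟨x, -, hx⟩ := Finset.exists_ne_zero_of_sum_ne_zero h
    rw [map_smul] at hx
    obtain ⟨h₁, h₂⟩ := eq_of_pcoef_pair_ne_zero (right_ne_zero_of_smul hx)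
    obtain rfl : (Path.trivial x, Path.trivial x) = y := Prod.ext h₁ h₂
    have hs := not_sameFirst_of_fst (y := ((Path.trivial x : Path Q), Path.trivial x)) rfl
    exact ⟨isReduced_of_not_same hs (not_sameLast_of_fst rfl), by
      rw [pairKind, if_neg hs, if_pos (h₀ x), if_pos (h₀ x)]; rfl⟩
  | bMax hm α hα closed =>
    obtain ⟨h₁, h₂⟩ := eq_of_pcoef_pair_ne_zero h
    obtain rfl : (Path.trivial α.src, α) = y := Prod.ext h₁ h₂
    have hs := not_sameFirst_of_fst (y := ((Path.trivial α.src : Path Q), α)) rfl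
    exact ⟨isReduced_of_not_same hs (not_sameLast_of_fst rfl), by
      rw [pairKind, if_neg hs, if_pos (h₀ _), if_neg (hl _ (hα.arrows_ne_nil hT)), if_pos hα]; rfl⟩
  | bSum hm α hα =>
    cases hm
    rw [Generator.cochain, map_sum] at h
    obtain ⟨i, -, hx⟩ := Finset.exists_ne_zero_of_sum_ne_zero h
    obtain ⟨h₁, h₂⟩ := eq_of_pcoef_pair_ne_zero hx
    set C := Cycle.rot^[i] α with hC
    obtain rfl : (Path.trivial C.src, C.toPath) = y := Prod.ext h₁ h₂
    have hs := not_sameFirst_of_fst (y := ((Path.trivial C.src : Path Q), C.toPath)) rfl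
    have hF := isCircuitFamily_isCocomplete (I := I)
    obtain ⟨b, hb⟩ := hF.left C (hF.rot_iterate (hXB.isCircuitReps.1 α hα) i)
    have hmax : ¬ IsBMaximal I C.toPath := fun h => not_leftExt_of_isBMaximal h hb
    exact ⟨isReduced_of_not_same hs (not_sameLast_of_fst rfl), by
      rw [pairKind, if_neg hs, if_pos (h₀ _), if_neg (hl _ C.pos), if_neg hmax]; rfl⟩
  | fundamental hm c hc =>
    obtain ⟨h₁, h₂⟩ := eq_of_pcoef_pair_ne_zero h
    obtain rfl : (Path.ofArrow c, Path.ofArrow c) = y := Prod.ext h₁ h₂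
    have hr : IsArcRep k T XB XΓ m (Path.ofArrow c, Path.ofArrow c) := Or.inl ⟨c, hc, rfl⟩
    exact ⟨hr.isReduced ⟨c, rfl, rfl⟩, by
      rw [pairKind, if_pos hr.sameFirst, if_pos (h₁' c), if_pos (h₁' c)]; rfl⟩
  | bPlus hm C hC =>
    obtain ⟨h₁, h₂⟩ := eq_of_pcoef_pair_ne_zero h
    obtain rfl : (Path.ofArrow C.firstArrow, C.firstMul) = y := Prod.ext h₁ h₂
    have hr : IsArcRep k T XB XΓ m (Path.ofArrow C.firstArrow, C.firstMul) :=
      Or.inr (Or.inl ⟨C, hC, rfl⟩)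
    exact ⟨hr.isReduced ⟨_, rfl, rfl⟩, by
      rw [pairKind, if_pos hr.sameFirst, if_pos (h₁' _), if_neg (hl' C)]; rfl⟩
  | clean γ α hp hγ hf hs =>
    obtain ⟨h₁, h₂⟩ := eq_of_pcoef_pair_ne_zero h
    obtain rfl : (γ, α) = y := Prod.ext h₁ h₂
    exact ⟨isReduced_of_not_same hf hs, by
      rw [pairKind, if_neg hf, if_neg (hl _ (hγ.arrows_ne_nil hT)), if_pos hγ]; rfl⟩
  | gammaSum C₀ hC₀ hm hpar =>
    rw [Generator.cochain, map_sum] at h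
    obtain ⟨i, -, hx⟩ := Finset.exists_ne_zero_of_sum_ne_zero h
    obtain ⟨h₁, h₂⟩ := eq_of_pcoef_pair_ne_zero hx
    set C := Cycle.rot^[i] C₀ with hC
    obtain rfl : (C.toPath, Path.trivial C.src) = y := Prod.ext h₁ h₂
    have hs := not_sameFirst_of_snd (y := (C.toPath, (Path.trivial C.src : Path Q))) rfl
    have hF := isCircuitFamily_isComplete (I := I) m
    obtain ⟨b, hb⟩ := hF.left C (hF.rot_iterate ⟨hXΓ.1 C₀ hC₀, hm⟩ i)
    have hmax : ¬ IsΓMaximal I C.toPath := fun h => not_leftExt_of_isΓMaximal h hb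
    exact ⟨isReduced_of_not_same hs (not_sameLast_of_snd rfl), by
      rw [pairKind, if_neg hs, if_neg (hl _ C.pos), if_neg hmax]; rfl⟩
  | gammaPlus C hC hm hpar =>
    obtain ⟨h₁, h₂⟩ := eq_of_pcoef_pair_ne_zero h
    obtain rfl : (C.firstMul, Path.ofArrow C.firstArrow) = y := Prod.ext h₁ h₂
    have hr : IsArcRep k T XB XΓ m (C.firstMul, Path.ofArrow C.firstArrow) :=
      Or.inr (Or.inr ⟨C, hC, hpar, rfl⟩)
    exact ⟨hr.isReduced ⟨_, rfl, rfl⟩, by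
      rw [pairKind, if_pos hr.sameFirst, if_neg (hl' C)]; rfl⟩

theorem Generator.cochain_mem [Nonempty E] (hT : Q.IsSpanningTree T)
    (hXB : IsCocompleteReps I XB) (hXΓ : IsCompleteReps I XΓ) (g : Generator I T XB XΓ m) :
    g.cochain ∈ reducedCochains I T XB XΓ m := fun _ hy => by
  by_contra h
  exact hy (g.isReduced_and_pairKind hT hXB hXΓ h).1

/-- The leading pair of a generator occurs in no other generator: generators of different families
have pairs of different kinds. -/
theorem Generator.pcoef_lead_of_ne [Nonempty E] (hT : Q.IsSpanningTree T)
    (hXB : IsCocompleteReps I XB) (hXΓ : IsCompleteReps I XΓ) (x₀ : V)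
    {g g' : Generator I T XB XΓ m} (h : g ≠ g') :
    pcoef I m (g.lead x₀).1 (g.lead x₀).2 g'.cochain = 0 := by
  by_contra hne
  have hk : g.kind = g'.kind := by
    rw [← (g'.isReduced_and_pairKind hT hXB hXΓ hne).2]
    refine ((g.isReduced_and_pairKind hT hXB hXΓ (y := g.lead x₀) ?_).2).symm
    rw [g.pcoef_lead_self hXB hXΓ]
    exact one_ne_zero
  cases g <;> cases g' <;> try (exfalso; simp only [Generator.kind] at hk; omega)
  case unit.unit => exact h rfl
  case bMax.bMax =>
    obtain ⟨-, h₂⟩ := eq_of_pcoef_pair_ne_zero hne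
    subst h₂
    exact h rfl
  case bSum.bSum hm C hC _ D hD =>
    cases hm
    refine hne (isCircuitFamily_isCocomplete.pcoef_sum_of_ne hXB.isCircuitReps
      (hXB.isCircuitReps.1 D hD) hD hC ?_)
    rintro rfl
    exact h rfl
  case fundamental.fundamental c hc _ d hd =>
    obtain ⟨h₁, -⟩ := eq_of_pcoef_pair_ne_zero hne
    obtain rfl := List.singleton_injective (congrArg Path.arrows h₁)
    exact h rfl
  case bPlus.bPlus =>
    obtain ⟨-, h₂⟩ := eq_of_pcoef_pair_ne_zero hne
    obtain rfl := Cycle.firstMul_injective h₂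
    exact h rfl
  case clean.clean =>
    obtain ⟨h₁, h₂⟩ := eq_of_pcoef_pair_ne_zero hne
    subst h₁ h₂
    exact h rfl
  case gammaSum.gammaSum C hC hm _ D hD hm' _ =>
    refine hne ((isCircuitFamily_isComplete m).pcoef_sum_of_ne hXΓ.isCircuitReps
      ⟨hXΓ.1 D hD, hm'⟩ hD hC ?_)
    rintro rfl
    exact h rfl
  case gammaPlus.gammaPlus =>
    obtain ⟨h₁, -⟩ := eq_of_pcoef_pair_ne_zero hne
    obtain rfl := Cycle.firstMul_injective h₁
    exact h rfl

/-- A cochain has finite support, and a pair leads at most one generator. -/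
theorem finite_lead_ne_zero [Nonempty E] (hT : Q.IsSpanningTree T)
    (hXB : IsCocompleteReps I XB) (hXΓ : IsCompleteReps I XΓ) (x₀ : V) (z : ParallelCochain I m) :
    {g : Generator I T XB XΓ m | pcoef I m (g.lead x₀).1 (g.lead x₀).2 z ≠ 0}.Finite := by
  refine Set.Finite.of_finite_image (f := Generator.lead x₀)
    ((z.support.finite_toSet.image Subtype.val).subset ?_) ?_
  · rintro _ ⟨g, hg, rfl⟩
    have hg' : pcoef I m (g.lead x₀).1 (g.lead x₀).2 z ≠ 0 := hg
    generalize g.lead x₀ = y at hg'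
    by_cases hp : IsParallelPair I m y
    · exact ⟨⟨y, hp⟩, Finsupp.mem_support_iff.2 fun h => hg' ((pcoef_of hp z).trans h), rfl⟩
    · exact absurd (pcoef_of_not hp z) hg'
  · intro g _ g' _ h
    by_contra hne
    have h₁ := Generator.pcoef_lead_of_ne hT hXB hXΓ x₀ hne
    rw [h, g'.pcoef_lead_self hXB hXΓ] at h₁
    exact one_ne_zero h₁

variable [Fintype E]

theorem parallelD_pair_eq_zero_of_same {y : Path Q × Path Q} (hy : IsParallelPair I m y)
    (hs : y.1.SameLast y.2) (hf : y.1.SameFirst y.2) : parallelD I m (pair I m y.1 y.2) = 0 :=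
  parallelD_pair_eq_zero hy (fun _ _ h => h.not_sameLast hs) (fun _ _ h => h.not_sameFirst hf)

/-- The generators are cocycles. -/
theorem Generator.parallelD_cochain (hI : IsGentle I) (hXB : IsCocompleteReps I XB)
    (hXΓ : IsCompleteReps I XΓ) (g : Generator I T XB XΓ m) : parallelD I m g.cochain = 0 := by
  cases g with
  | unit hm =>
    cases hm
    rw [Generator.cochain_unit, parallelD_vertexCochain]
    simp
  | bMax hm α hα closed =>
    cases hm
    have := parallelD_pair_eq_zero (hα.isParallelPair closed)
      (fun _ _ => not_leftExt_of_isBMaximal hα) (fun _ _ => not_rightExt_of_isBMaximal hα)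
    rwa [Generator.cochain]
  | bSum hm α hα =>
    cases hm
    have := isCircuitFamily_isCocomplete.parallelD_sum hI (hXB.isCircuitReps.1 α hα) (pow_zero _)
    rwa [Generator.cochain]
  | fundamental hm c hc =>
    cases hm
    have := parallelD_pair_eq_zero_of_same (isParallelPair_ofArrow (I := I) c) ⟨c, rfl, rfl⟩
      ⟨c, rfl, rfl⟩
    rwa [Generator.cochain]
  | bPlus hm C hC =>
    cases hm
    obtain ⟨b, hb⟩ := isCircuitFamily_isCocomplete.left C (hXB.isCircuitReps.1 C hC)
    have := parallelD_pair_eq_zero_of_same hb.par hb.sameLast ⟨_, rfl, C.firstMul_getLast⟩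
    rwa [Generator.cochain]
  | clean γ α h hγ =>
    have := parallelD_pair_eq_zero h
      (fun _ _ => not_leftExt_of_isΓMaximal hγ) (fun _ _ => not_rightExt_of_isΓMaximal hγ)
    rwa [Generator.cochain]
  | gammaSum C hC hm hpar =>
    have := (isCircuitFamily_isComplete m).parallelD_sum hI ⟨hXΓ.1 C hC, hm⟩
      (neg_one_pow_eq_one_iff_even_or.2 hpar)
    rwa [Generator.cochain]
  | gammaPlus C hC hm =>
    cases hm
    obtain ⟨b, hb⟩ := (isCircuitFamily_isComplete C.length).left C ⟨hXΓ.1 C hC, rfl⟩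
    have := parallelD_pair_eq_zero_of_same hb.par hb.sameLast ⟨_, C.firstMul_getLast, rfl⟩
    rwa [Generator.cochain]

/-- A generator as an element of the space of cocycles. -/
noncomputable def Generator.cocycle (hI : IsGentle I) (hXB : IsCocompleteReps I XB)
    (hXΓ : IsCompleteReps I XΓ) (g : Generator I T XB XΓ m) : LinearMap.ker (parallelD I m) :=
  ⟨g.cochain, g.parallelD_cochain hI hXB hXΓ⟩

/-- The basis of the cohomology of the complex of parallel paths given by the classes of the
generators. -/
noncomputable def IsGentle.generatorBasis [Nonempty E] (hI : IsGentle I) (hT : Q.IsSpanningTree T)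
    (hXB : IsCocompleteReps I XB) (hXΓ : IsCompleteReps I XΓ) (m : ℕ) :
    Module.Basis (Generator I T XB XΓ m) k (ParallelCohomology I m) :=
  let x₀ : V := Q.s (Classical.arbitrary E)
  let φ (g : Generator I T XB XΓ m) := pcoef I m (g.lead x₀).1 (g.lead x₀).2
  have hself (g : Generator I T XB XΓ m) : φ g (g.cocycle hI hXB hXΓ) = 1 :=
    g.pcoef_lead_self hXB hXΓ x₀
  have hne (g g' : Generator I T XB XΓ m) (h : g ≠ g') : φ g (g'.cocycle hI hXB hXΓ) = 0 :=
    Generator.pcoef_lead_of_ne hT hXB hXΓ x₀ h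
  have hv (g : Generator I T XB XΓ m) :
      (g.cocycle hI hXB hXΓ : ParallelCochain I m) ∈ reducedCochains I T XB XΓ m :=
    g.cochain_mem hT hXB hXΓ
  Module.Basis.mk
    (linearIndependent_cohomologyClass hself hne hv fun _ hz hd =>
      lead_eq_zero_of_mem_coboundaries hT hXB hXΓ x₀ hz hd)
    (top_le_span_cohomologyClass hI.parallelD_comp_parallelD hself hne hv
      (reduced_sup_coboundaries hI hT hXB hXΓ) (finite_lead_ne_zero hT hXB hXΓ x₀)
      fun _ hz hd => eq_zero_of_lead hI hT hXB hXΓ x₀ hz hd)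

theorem IsGentle.generatorBasis_apply [Nonempty E] (hI : IsGentle I) (hT : Q.IsSpanningTree T)
    (hXB : IsCocompleteReps I XB) (hXΓ : IsCompleteReps I XΓ) (g : Generator I T XB XΓ m) :
    hI.generatorBasis hT hXB hXΓ m g = cohomologyClass (parallelD I) (g.cocycle hI hXB hXΓ) := by
  rw [generatorBasis, Module.Basis.mk_apply]

end GeneratorCochains

end GentleHH

theorem mainTheorem1 {k : Type*} {V : Type*} {E : Type*} [Field k] [Fintype V] [Fintype E]
    [Nonempty E] (Q : GentleHH.ArrowQuiver V E)
    (I : TwoSidedIdeal (GentleHH.PathAlgebra k Q)) (hI : GentleHH.IsGentle I)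
    (T : Set E) (hT : Q.IsSpanningTree T)
    (XB XΓ : Set (GentleHH.Cycle Q))
    (hXB : GentleHH.IsCocompleteReps I XB) (hXΓ : GentleHH.IsCompleteReps I XΓ) :
    (∀ m, GentleHH.parallelD I (m + 1) ∘ₗ GentleHH.parallelD I m = 0) ∧
    (∀ m (g : GentleHH.Generator I T XB XΓ m), GentleHH.parallelD I m g.cochain = 0) ∧
    ∃ Φ : ∀ m, GentleHH.HH k (GentleHH.BoundAlgebra I) m ≃ₗ[k] GentleHH.ParallelCohomology I m,
      (∀ m (f : LinearMap.ker (GentleHH.hochschildD k (GentleHH.BoundAlgebra I) m)),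
        ∃ z : LinearMap.ker (GentleHH.parallelD I m),
          GentleHH.Restricts I f.1 z.1 ∧
          Φ m (GentleHH.cohomologyClass (GentleHH.hochschildD k (GentleHH.BoundAlgebra I)) f) =
            GentleHH.cohomologyClass (GentleHH.parallelD I) z) ∧
      ∀ m, ∃ b : Module.Basis (GentleHH.Generator I T XB XΓ m) k
          (GentleHH.HH k (GentleHH.BoundAlgebra I) m),
        ∀ g, ∃ z : LinearMap.ker (GentleHH.parallelD I m), z.1 = g.cochain ∧
          Φ m (b g) = GentleHH.cohomologyClass (GentleHH.parallelD I) z := by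
  refine ⟨hI.parallelD_comp_parallelD, fun m g => g.parallelD_cochain hI hXB hXΓ, hI.comparison,
    fun m f => hI.comparison_class f,
    fun m => ⟨(hI.generatorBasis hT hXB hXΓ m).map (hI.comparison m).symm,
      fun g => ⟨g.cocycle hI hXB hXΓ, rfl, ?_⟩⟩⟩
  rw [Module.Basis.map_apply, LinearEquiv.apply_symm_apply, hI.generatorBasis_apply]
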